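/- Let $E/F$ be a quadratic extension of nonarchimedean local fields of characteristic zero, with nontrivial automorphism $x\mapsto\overline{x}$, rings of integers $\mathfrak o_E,\mathfrak o_F$, relative discriminant $D_{E/F}$, and normalized absolute value $|\cdot|_F$. Let $\eta$ be the quadratic character of $F^\times$ attached to $E/F$, let $\chi,\widetilde\eta:E^\times\to\mathbb C^\times$ be continuous characters with $\widetilde\eta|_{F^\times}=\eta$, and evaluate characters on matrices through the determinant. For an integer $n\ge 0$ put $G'=\mathrm{Res}_{E/F}\mathrm{GL}_{2n}$, $H'=\mathrm{Res}_{E/F}(\mathrm{GL}_n\times\mathrm{GL}_n)\subset G'$ (diagonal blocks), $H''=\mathrm{GL}_{2n,F}$, and $\chi_{H'}(h_1,h_2)=\chi(h_1\overline{h_2})$. The group $H'$ acts on $S'=\{s\in G' : s\overline s=1\}$ by $h\cdot s=hs\overline h^{-1}$; $s\in S'(F)$ is regular semisimple if its orbit is Zariski closed and its stabilizer is a torus of dimension $n$, and $x\in G'(F)$ is regular semisimple if $x\overline x^{-1}$ is. For $\alpha\in M_n(E)$ put $$s'(\alpha)=\begin{pmatrix}\alpha&1\\1-\alpha\overline\alpha&-\overline\alpha\end{pmatrix}.$$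 Let $n=n_1+n_2$ and let $Q=LU$ be the parabolic subgroup of $\mathrm{GL}_{2n}$ whose Levi subgroup $L\simeq\mathrm{GL}_{2n_1}\times\mathrm{GL}_{2n_2}$ and unipotent radical $U\simeq M_{2n_1\times 2n_2}$ consist of the matrices (in block sizes $n_1,n_2,n_1,n_2$) $$\begin{pmatrix} m_1^{(1)}&&m_1^{(2)}&\\&m_2^{(1)}&&m_2^{(2)}\\m_1^{(3)}&&m_1^{(4)}&\\&m_2^{(3)}&&m_2^{(4)}\end{pmatrix},\qquad \begin{pmatrix}1&u^{(1)}&&u^{(2)}\\&1&&\\&u^{(3)}&1&u^{(4)}\\&&&1\end{pmatrix}.$$ Let $x=(x_1,x_2)\in L(E)$, $x_i\in\mathrm{GL}_{2n_i}(E)$. Suppose that $x$, $x_1$ and $x_2$ are regular semisimple (for $n$, $n_1$, $n_2$ respectively) and that $x_i\overline{x_i}^{-1}=s'(\alpha_i)$ with $\alpha_i\in M_{n_i}(E)$. Let $\widetilde r_1,\dots,\widetilde r_{n_1}$ and $\widetilde s_1,\dots,\widetilde s_{n_2}$ be the eigenvalues of $\alpha_1\overline{\alpha_1}$ and $\alpha_2\overline{\alpha_2}$,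 and put $\lambda'=\prod_{i,j}(\widetilde r_i-\widetilde s_j)^{-1}$. Let $f'$ be a locally constant compactly supported function on $G'(F)$. Haar measures on all groups $\mathrm{GL}_m(E)$, $\mathrm{GL}_m(F)$ are normalized so that $\mathrm{GL}_m(\mathfrak o_E)$, $\mathrm{GL}_m(\mathfrak o_F)$ have volume one, and the Haar measure $dw$ on $U(E)$ so that $U(\mathfrak o_E)$ has volume $|D_{E/F}|_F^{n_1n_2}$ (which is one if $E/F$ is unramified). Put $f'_K(g)=\int_{K_{H'}}\int_{K_{H''}}f'(k_1^{-1}gk_2)\chi_{H'}(k_1)(\chi\eta)^{-1}(k_2)\,dk_1\,dk_2$ with $K_{H'}=\mathrm{GL}_n(\mathfrak o_E)^2$, $K_{H''}=\mathrm{GL}_{2n}(\mathfrak o_F)$, and for $y\in L(E)$ put $$f'^Q(y)=\delta_{Q(E)}(y)^{-1/2}\int_{U(E)}f'_K(wy)\,dw ,$$ where $\delta_{Q(E)}$ is the modulus character. Define $$O^{G'}(x,f')=(\chi\widetilde\eta)^{-1}(x)\int_{(H'\times H'')_x(F)\backslash (H'\times H'')(F)}f'(h^{-1}xh'')\chi_{H'}(h)(\chi\eta)^{-1}(h'')\,dh\,dh'',$$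 $$O^{L}(x,\phi)=(\chi\widetilde\eta)^{-1}(x)\int\phi(m^{-1}xm'')\chi_{H'}(m)(\chi\eta)^{-1}(m'')\,dm\,dm'',$$ the second integral being over $((H'\cap L)(F)\times L(F))_x\backslash((H'\cap L)(F)\times L(F))$; here $H'\cap L\subset\mathrm{Res}_{E/F}L$ and $(H'\cap L)(F)=\prod_{i}\mathrm{GL}_{n_i}(E)^2$. The two stabilizers coincide, are given the same Haar measure, and the quotients carry the quotient measures. Then $f'^Q$ is locally constant and compactly supported, both orbital integrals converge absolutely, $\lambda'\in F$, and $$O^{G'}(x,f')=|\lambda'|_F\cdot O^L(x,f'^Q).$$ -/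

import Mathlib

open MeasureTheory
open scoped ENNReal TensorProduct

namespace ParabolicDescent

noncomputable section

/-! ## General linear groups

`GL ι R` is used for finite index types `ι`; the integer `n` is the cardinality of `ι`, and
`2n × 2n` matrices are indexed by `ι ⊕ ι`. -/

/-- The Borel σ-algebra on `GL ι R`. -/
instance glMeasurableSpace {ι R : Type*} [Fintype ι] [DecidableEq ι] [CommRing R]
    [TopologicalSpace R] : MeasurableSpace (GL ι R) := borel _

instance glBorelSpace {ι R : Type*} [Fintype ι] [DecidableEq ι] [CommRing R]
    [TopologicalSpace R] : BorelSpace (GL ι R) := ⟨rfl⟩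

instance matrixLocallyCompact {ι κ R : Type*} [Finite ι] [Finite κ] [TopologicalSpace R]
    [LocallyCompactSpace R] : LocallyCompactSpace (Matrix ι κ R) :=
  inferInstanceAs (LocallyCompactSpace (ι → κ → R))

/-- The block diagonal embedding `(g, k) ↦ diag(g, k)`. -/
def diagGL {ι κ R : Type*} [Fintype ι] [DecidableEq ι] [Fintype κ] [DecidableEq κ] [CommRing R] :
    GL ι R × GL κ R →* GL (ι ⊕ κ) R where
  toFun p :=
    { val := Matrix.fromBlocks (p.1 : Matrix ι ι R) 0 0 (p.2 : Matrix κ κ R)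
      inv := Matrix.fromBlocks (p.1⁻¹ : GL ι R).val 0 0 (p.2⁻¹ : GL κ R).val
      val_inv := by
        rw [Matrix.fromBlocks_multiply]; simp
      inv_val := by
        rw [Matrix.fromBlocks_multiply]; simp }
  map_one' := Units.ext (by simp)
  map_mul' p q := Units.ext (by simp [Matrix.fromBlocks_multiply])

/-- Entrywise application of the Galois involution, `g ↦ ḡ`. -/
def conjGL {F E : Type*} [Field F] [Field E] [Algebra F E] (σ : E ≃ₐ[F] E)
    {ι : Type*} [Fintype ι] [DecidableEq ι] : GL ι E →* GL ι E :=
  Matrix.GeneralLinearGroup.map (σ : E →+* E)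

/-- The inclusion of `GL(F)` in `GL(E)`. -/
def extGL (F E : Type*) [Field F] [Field E] [Algebra F E]
    {ι : Type*} [Fintype ι] [DecidableEq ι] : GL ι F →* GL ι E :=
  Matrix.GeneralLinearGroup.map (algebraMap F E)

/-- The Levi subgroup `L` of `GL_{2n}`, `n = n₁ + n₂`: the pair `(m₁, m₂)`, with
`m_i ∈ GL_{2n_i}` in `n_i × n_i` blocks `m_i^{(1)}, …, m_i^{(4)}`, is sent to
`[m₁⁽¹⁾, 0, m₁⁽²⁾, 0; 0, m₂⁽¹⁾, 0, m₂⁽²⁾; m₁⁽³⁾, 0, m₁⁽⁴⁾, 0; 0, m₂⁽³⁾, 0, m₂⁽⁴⁾]`. -/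
def levi {a b R : Type*} [Fintype a] [DecidableEq a] [Fintype b] [DecidableEq b] [CommRing R] :
    GL (a ⊕ a) R × GL (b ⊕ b) R →* GL ((a ⊕ b) ⊕ (a ⊕ b)) R :=
  (Units.map (Matrix.reindexAlgEquiv R R (Equiv.sumSumSumComm a a b b) : _ →* _)).comp diagGL

/-- The unipotent radical `U` of `Q = LU`: a `2n₁ × 2n₂` matrix `u` in blocks `u⁽¹⁾, …, u⁽⁴⁾`
is sent to `[1, u⁽¹⁾, 0, u⁽²⁾; 0, 1, 0, 0; 0, u⁽³⁾, 1, u⁽⁴⁾; 0, 0, 0, 1]`. -/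
def unip {a b R : Type*} [Fintype a] [DecidableEq a] [Fintype b] [DecidableEq b] [CommRing R]
    (u : Matrix (a ⊕ a) (b ⊕ b) R) : GL ((a ⊕ b) ⊕ (a ⊕ b)) R :=
  let v : GL ((a ⊕ a) ⊕ (b ⊕ b)) R :=
    { val := Matrix.fromBlocks 1 u 0 1
      inv := Matrix.fromBlocks 1 (-u) 0 1
      val_inv := by simp [Matrix.fromBlocks_multiply]
      inv_val := by simp [Matrix.fromBlocks_multiply] }
  Units.map (Matrix.reindexAlgEquiv R R (Equiv.sumSumSumComm a a b b) : _ →* _) v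

/-! ## Regular semisimple elements -/

section Regular

variable {F E : Type*} [Field F] [Field E] [Algebra F E] {ι : Type*} [Fintype ι] [DecidableEq ι]

/-- The Galois involution on `(Res_{E/F} GL_ι)(R) = GL_ι(R ⊗_F E)`. -/
def conjBC (σ : E ≃ₐ[F] E) (R : Type*) [CommRing R] [Algebra F R] :
    GL ι (R ⊗[F] E) →* GL ι (R ⊗[F] E) :=
  Matrix.GeneralLinearGroup.map
    (Algebra.TensorProduct.map (AlgHom.id F R) (σ : E →ₐ[F] E) : R ⊗[F] E →+* R ⊗[F] E)

/-- The image in `GL_ι(R ⊗_F E)` of an element of `GL_ι(E)`. -/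
def toBC (F : Type*) {E : Type*} [Field F] [Field E] [Algebra F E] (R : Type*) [CommRing R]
    [Algebra F R] : GL ι E →* GL ι (R ⊗[F] E) :=
  Matrix.GeneralLinearGroup.map
    (Algebra.TensorProduct.includeRight : E →ₐ[F] R ⊗[F] E).toRingHom

/-- The `R`-points of the stabilizer of `s` in `H' = Res_{E/F}(GL_n × GL_n)`, which acts by
twisted conjugation `h · s = h s h̄⁻¹`. -/
def stabTwisted (σ : E ≃ₐ[F] E) (s : GL (ι ⊕ ι) E) (R : Type*) [CommRing R] [Algebra F R] :
    Subgroup (GL ι (R ⊗[F] E) × GL ι (R ⊗[F] E)) where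
  carrier := {h | diagGL h * toBC F R s * (conjBC σ R (diagGL h))⁻¹ = toBC F R s}
  one_mem' := by simp
  mul_mem' {h k} hh hk := by
    simp only [Set.mem_ofPred_eq, mul_inv_eq_iff_eq_mul] at hh hk ⊢
    rw [map_mul, map_mul, mul_assoc, hk, ← mul_assoc, hh, mul_assoc]
  inv_mem' {h} hh := by
    simp only [Set.mem_ofPred_eq, mul_inv_eq_iff_eq_mul] at hh ⊢
    rw [map_inv, map_inv, inv_mul_eq_iff_eq_mul, ← mul_assoc, hh, mul_assoc, mul_inv_cancel,
      mul_one]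

end Regular

/-- The stabilizer of `s` in `H'` is a torus of dimension `n`: over an algebraic closure `Ω` of `F`
it becomes isomorphic, as a group functor on commutative `Ω`-algebras, to `𝔾_m^n`. -/
def StabIsTorus.{u, v, w} {F : Type u} {E : Type v} [Field F] [Field E] [Algebra F E]
    {ι : Type w} [Fintype ι] [DecidableEq ι] (σ : E ≃ₐ[F] E) (s : GL (ι ⊕ ι) E) : Prop :=
  ∃ φ : ∀ (R : Type u) [CommRing R] [Algebra F R] [Algebra (AlgebraicClosure F) R]
      [IsScalarTower F (AlgebraicClosure F) R], (ι → Rˣ) ≃* stabTwisted σ s R,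
    ∀ (R R' : Type u) [CommRing R] [Algebra F R] [Algebra (AlgebraicClosure F) R]
      [IsScalarTower F (AlgebraicClosure F) R] [CommRing R'] [Algebra F R']
      [Algebra (AlgebraicClosure F) R'] [IsScalarTower F (AlgebraicClosure F) R']
      (f : R →ₐ[AlgebraicClosure F] R') (t : ι → Rˣ),
      let fE : R ⊗[F] E →+* R' ⊗[F] E :=
        (Algebra.TensorProduct.map (f.restrictScalars F) (AlgHom.id F E)).toRingHom
      ((φ R' (fun i => Units.map (f : R →* R') (t i)) : stabTwisted σ s R') :
          GL ι (R' ⊗[F] E) × GL ι (R' ⊗[F] E)) =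
        (Matrix.GeneralLinearGroup.map fE (φ R t).1.1,
          Matrix.GeneralLinearGroup.map fE (φ R t).1.2)

/-- Zariski closed subsets of a finite-dimensional vector space `V`: common zero sets of
polynomials in linear functionals. -/
def IsZariskiClosed (k : Type*) {V : Type*} [Field k] [AddCommGroup V] [Module k V]
    (Z : Set V) : Prop :=
  ∃ P : Set (MvPolynomial (Module.Dual k V) k),
    Z = {v | ∀ p ∈ P, MvPolynomial.eval (fun l : Module.Dual k V => l v) p = 0}

/-- The `H'`-orbit of `s` (under twisted conjugation) is Zariski closed. Geometric points are used;
`S' = {s | s s̄ = 1}` is closed in the affine space of matrices. -/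
def OrbitIsClosed {F E : Type*} [Field F] [Field E] [Algebra F E]
    {ι : Type*} [Fintype ι] [DecidableEq ι] (σ : E ≃ₐ[F] E) (s : GL (ι ⊕ ι) E) : Prop :=
  IsZariskiClosed (AlgebraicClosure F)
    (Set.range fun h : GL ι (AlgebraicClosure F ⊗[F] E) × GL ι (AlgebraicClosure F ⊗[F] E) =>
      ((diagGL h * toBC F (AlgebraicClosure F) s *
          (conjBC σ (AlgebraicClosure F) (diagGL h))⁻¹ :
          GL (ι ⊕ ι) (AlgebraicClosure F ⊗[F] E)) :
        Matrix (ι ⊕ ι) (ι ⊕ ι) (AlgebraicClosure F ⊗[F] E)))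

/-- `s ∈ S'(F)` is regular semisimple: its `H'`-orbit is Zariski closed and its stabilizer in `H'`
is a torus of dimension `n`. -/
def IsRegularSemisimple {F E : Type*} [Field F] [Field E] [Algebra F E]
    {ι : Type*} [Fintype ι] [DecidableEq ι] (σ : E ≃ₐ[F] E) (s : GL (ι ⊕ ι) E) : Prop :=
  s * conjGL σ s = 1 ∧ OrbitIsClosed σ s ∧ StabIsTorus σ s

/-- The image `x x̄⁻¹ ∈ S'(F)` of `x ∈ GL_{2n}(E)`; `x` is called regular semisimple when
`x x̄⁻¹` is. -/
def toSymm {F E : Type*} [Field F] [Field E] [Algebra F E] {ι : Type*} [Fintype ι] [DecidableEq ι]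
    (σ : E ≃ₐ[F] E) (x : GL ι E) : GL ι E :=
  x * (conjGL σ x)⁻¹

/-- The matrix `s'(α) = [α, 1; 1 - α ᾱ, -ᾱ]`. -/
def sPrime {F E : Type*} [Field F] [Field E] [Algebra F E] {ι : Type*} [Fintype ι] [DecidableEq ι]
    (σ : E ≃ₐ[F] E) (α : Matrix ι ι E) : Matrix (ι ⊕ ι) (ι ⊕ ι) E :=
  Matrix.fromBlocks α 1 (1 - α * α.map σ) (-α.map σ)

/-- `∏ (r_i - s_j)⁻¹` over the eigenvalues `r_i` of `A` and `s_j` of `B`, with multiplicity, in an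
algebraic closure. -/
def lambdaPrime {E : Type*} [Field E] {a b : Type*} [Fintype a] [DecidableEq a] [Fintype b]
    [DecidableEq b] (A : Matrix a a E) (B : Matrix b b E) : AlgebraicClosure E :=
  (((A.charpoly.map (algebraMap E (AlgebraicClosure E))).roots ×ˢ
    (B.charpoly.map (algebraMap E (AlgebraicClosure E))).roots).map
      (fun p => (p.1 - p.2)⁻¹)).prod

/-! ## Measures -/

/-- The normalized absolute value of a local field: the module of multiplication by `c`. -/
def normAbs (k : Type*) [NontriviallyNormedField k] [LocallyCompactSpace k] (c : k) : ℝ :=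
  letI : MeasurableSpace k := borel k
  haveI : BorelSpace k := ⟨rfl⟩
  open Classical in if h : c = 0 then 0 else (distribHaarChar k (Units.mk0 c h) : ℝ)

/-- The maximal compact subgroup `GL(𝔬)` of `GL(k)`. -/
def maxCompact (ι k : Type*) [Fintype ι] [DecidableEq ι] [NontriviallyNormedField k] :
    Set (GL ι k) :=
  {g | ∀ i j, ‖(g : Matrix ι ι k) i j‖ ≤ 1 ∧ ‖((g⁻¹ : GL ι k) : Matrix ι ι k) i j‖ ≤ 1}

/-- The Haar measure on `GL(k)` that gives `GL(𝔬)` volume one. -/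
def glHaar (ι k : Type*) [Fintype ι] [DecidableEq ι] [NontriviallyNormedField k]
    [LocallyCompactSpace k] : Measure (GL ι k) :=
  ((Measure.haar : Measure (GL ι k)) (maxCompact ι k))⁻¹ • Measure.haar

/-- The Haar measure on the additive group of `m × n` matrices over `k` such that the matrices with
entries in the ring of integers have volume `c`. -/
def matHaar (m n k : Type*) [Fintype m] [Fintype n] [NontriviallyNormedField k]
    [LocallyCompactSpace k] (c : ℝ≥0∞) : @Measure (Matrix m n k) (borel _) :=
  letI : MeasurableSpace (Matrix m n k) := borel _
  haveI : BorelSpace (Matrix m n k) := ⟨rfl⟩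
  (c * ((Measure.addHaar : Measure (Matrix m n k)) {w | ∀ i j, ‖w i j‖ ≤ 1})⁻¹) •
    Measure.addHaar

/-- `b` is a basis of the ring of integers of `E` over the ring of integers of `F`. -/
def IsIntegralBasis {F E : Type*} [NontriviallyNormedField F] [NontriviallyNormedField E]
    [NormedAlgebra F E] (b : Module.Basis (Fin 2) F E) : Prop :=
  ∀ z : E, ‖z‖ ≤ 1 ↔ ∀ i, ‖b.repr z i‖ ≤ 1

/-- `ρ` is the quotient measure on `S \ A` of the measure `μ` on `A` by the measure `ν` on the
subgroup `S`: `∫_A φ dμ = ∫_{S \ A} ∫_S φ(s a) dν(s) dρ(a)`. (For Haar measures on unimodular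
`A` and `S` this determines `ρ`, and the inner integral depends only on the coset of `a`.) -/
def IsQuotientMeasure {A : Type*} [Group A] [MeasurableSpace A] (μ : Measure A) (S : Subgroup A)
    (ν : Measure S) (ρ : Measure (Quotient (QuotientGroup.rightRel S))) : Prop :=
  ∀ φ : A → ℝ≥0∞, Measurable φ →
    ∫⁻ a, φ a ∂μ = ∫⁻ q, ∫⁻ s : S, φ ((s : A) * q.out) ∂ν ∂ρ

/-- The space `𝒮(X)` for a nonarchimedean `X`: locally constant, compactly supported functions. -/
def IsSchwartz {X : Type*} [TopologicalSpace X] (f : X → ℂ) : Prop :=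
  IsLocallyConstant f ∧ HasCompactSupport f

/-! ## Characters -/

/-- The quadratic character `η` of `Fˣ` attached to `E/F`: `1` on norms from `Eˣ`, and `-1`
elsewhere. -/
def etaChar (F E : Type*) [Field F] [Field E] [Algebra F E] (c : Fˣ) : ℂ :=
  open Classical in if ∃ z : E, Algebra.norm F z = (c : F) then 1 else -1

/-- `χ_{H'}(h₁, h₂) = χ(det (h₁ h̄₂))`. -/
def chiH {F E : Type*} [Field F] [Field E] [Algebra F E] (σ : E ≃ₐ[F] E) (χ : Eˣ →* ℂˣ)
    {ι : Type*} [Fintype ι] [DecidableEq ι] (h : GL ι E × GL ι E) : ℂ :=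
  χ (Matrix.GeneralLinearGroup.det (h.1 * conjGL σ h.2))

/-- `(χη)(g) = χ(det g) η(det g)` for `g ∈ GL(F)`. -/
def chiEta (F : Type*) {E : Type*} [Field F] [Field E] [Algebra F E] (χ : Eˣ →* ℂˣ)
    {ι : Type*} [Fintype ι] [DecidableEq ι] (g : GL ι F) : ℂ :=
  χ (Matrix.GeneralLinearGroup.det (extGL F E g)) *
    etaChar F E (Matrix.GeneralLinearGroup.det g)

/-- `(χη̃)⁻¹(x) = (χ(det x) η̃(det x))⁻¹` for `x ∈ GL(E)`. -/
def chiEtaTildeInv {E : Type*} [Field E] (χ ηt : Eˣ →* ℂˣ)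
    {ι : Type*} [Fintype ι] [DecidableEq ι] (x : GL ι E) : ℂ :=
  ((χ (Matrix.GeneralLinearGroup.det x) : ℂ) * (ηt (Matrix.GeneralLinearGroup.det x) : ℂ))⁻¹

/-! ## Orbital integrals -/

/-- The stabilizer of `x` for the action `x ↦ (i h)⁻¹ x (j h'')` of `A × B`. -/
def biStab {A B X : Type*} [Group A] [Group B] [Group X] (i : A →* X) (j : B →* X) (x : X) :
    Subgroup (A × B) where
  carrier := {p | (i p.1)⁻¹ * x * j p.2 = x}
  one_mem' := by simp
  mul_mem' {p q} hp hq := by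
    simp only [Set.mem_ofPred_eq, mul_assoc, inv_mul_eq_iff_eq_mul] at hp hq ⊢
    simp only [Prod.fst_mul, Prod.snd_mul, map_mul]
    rw [← mul_assoc, hp, mul_assoc, hq, mul_assoc]
  inv_mem' {p} hp := by
    simp only [Set.mem_ofPred_eq, mul_assoc, inv_mul_eq_iff_eq_mul] at hp ⊢
    simp only [Prod.fst_inv, Prod.snd_inv, map_inv]
    rw [mul_inv_eq_iff_eq_mul, mul_assoc, hp, inv_mul_cancel_left]

section Orbital

variable (F : Type*) {E : Type*} [NontriviallyNormedField F] [NontriviallyNormedField E]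
  [NormedAlgebra F E] (σ : E ≃ₐ[F] E) (χ ηt : Eˣ →* ℂˣ)

/-- `(H' × H'')_x`, for `x ∈ G'(F) = GL_{2n}(E)`. -/
abbrev stabG {ι : Type*} [Fintype ι] [DecidableEq ι] (x : GL (ι ⊕ ι) E) :
    Subgroup ((GL ι E × GL ι E) × GL (ι ⊕ ι) F) :=
  biStab diagGL (extGL F E) x

/-- The Haar measure `dh dh''` on `H'(F) × H''(F)`. -/
def haarG (E ι : Type*) [NontriviallyNormedField E] [Fintype ι] [DecidableEq ι]
    [LocallyCompactSpace F] [LocallyCompactSpace E] :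
    Measure ((GL ι E × GL ι E) × GL (ι ⊕ ι) F) :=
  ((glHaar ι E).prod (glHaar ι E)).prod (glHaar (ι ⊕ ι) F)

/-- The integrand `f'(h⁻¹ x h'') χ_{H'}(h) (χη)⁻¹(h'')`. -/
def integrandG {ι : Type*} [Fintype ι] [DecidableEq ι] (x : GL (ι ⊕ ι) E)
    (f : GL (ι ⊕ ι) E → ℂ) (p : (GL ι E × GL ι E) × GL (ι ⊕ ι) F) : ℂ :=
  f ((diagGL p.1)⁻¹ * x * extGL F E p.2) * chiH σ χ p.1 * (chiEta F χ p.2)⁻¹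

/-- `O^{G'}(x, f')`, where `ρ` is the measure on `(H' × H'')_x \ (H' × H'')`. The integrand is a
function of the coset when `x` is regular semisimple. -/
def orbitalG {ι : Type*} [Fintype ι] [DecidableEq ι] (x : GL (ι ⊕ ι) E)
    (ρ : Measure (Quotient (QuotientGroup.rightRel (stabG F x)))) (f : GL (ι ⊕ ι) E → ℂ) : ℂ :=
  chiEtaTildeInv χ ηt x * ∫ q, integrandG F σ χ x f q.out ∂ρ

section L

variable {a b : Type*} [Fintype a] [DecidableEq a] [Fintype b] [DecidableEq b]

/-- The inclusion of `H' ∩ L = (M × M)(E)` in `L(E)`. -/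
def inclHL (E a b : Type*) [NontriviallyNormedField E] [Fintype a] [DecidableEq a] [Fintype b]
    [DecidableEq b] :
    (GL a E × GL a E) × (GL b E × GL b E) →* GL (a ⊕ a) E × GL (b ⊕ b) E :=
  MonoidHom.prodMap diagGL diagGL

/-- The inclusion of `L(F)` in `L(E)`. -/
def inclLF (E a b : Type*) [NontriviallyNormedField E] [NormedAlgebra F E] [Fintype a]
    [DecidableEq a] [Fintype b] [DecidableEq b] :
    GL (a ⊕ a) F × GL (b ⊕ b) F →* GL (a ⊕ a) E × GL (b ⊕ b) E :=
  MonoidHom.prodMap (extGL F E) (extGL F E)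

/-- The inclusion of `H' ∩ L` in `H'`. -/
def embH (E a b : Type*) [NontriviallyNormedField E] [Fintype a] [DecidableEq a] [Fintype b]
    [DecidableEq b] :
    (GL a E × GL a E) × (GL b E × GL b E) →* GL (a ⊕ b) E × GL (a ⊕ b) E where
  toFun m := (diagGL (m.1.1, m.2.1), diagGL (m.1.2, m.2.2))
  map_one' := Prod.ext (map_one diagGL) (map_one diagGL)
  map_mul' m m' := Prod.ext (map_mul diagGL (m.1.1, m.2.1) (m'.1.1, m'.2.1))
    (map_mul diagGL (m.1.2, m.2.2) (m'.1.2, m'.2.2))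

/-- The stabilizer `((H' ∩ L)(F) × L(F))_x`, for `x ∈ L(E)`. -/
abbrev stabL (x : GL (a ⊕ a) E × GL (b ⊕ b) E) :
    Subgroup (((GL a E × GL a E) × (GL b E × GL b E)) × (GL (a ⊕ a) F × GL (b ⊕ b) F)) :=
  biStab (inclHL E a b) (inclLF F E a b) x

/-- The Haar measure `dm dm''` on `(H' ∩ L)(F) × L(F)`. -/
def haarL (E a b : Type*) [NontriviallyNormedField E] [Fintype a] [DecidableEq a] [Fintype b]
    [DecidableEq b] [LocallyCompactSpace F] [LocallyCompactSpace E] :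
    Measure (((GL a E × GL a E) × (GL b E × GL b E)) × (GL (a ⊕ a) F × GL (b ⊕ b) F)) :=
  (((glHaar a E).prod (glHaar a E)).prod ((glHaar b E).prod (glHaar b E))).prod
    ((glHaar (a ⊕ a) F).prod (glHaar (b ⊕ b) F))

/-- The integrand `f(m⁻¹ x m'') χ_{H'}(m) (χη)⁻¹(m'')`, for a function `f` on `L(E)`. -/
def integrandL (x : GL (a ⊕ a) E × GL (b ⊕ b) E) (f : GL (a ⊕ a) E × GL (b ⊕ b) E → ℂ)
    (p : ((GL a E × GL a E) × (GL b E × GL b E)) × (GL (a ⊕ a) F × GL (b ⊕ b) F)) : ℂ :=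
  f ((inclHL E a b p.1)⁻¹ * x * inclLF F E a b p.2) * chiH σ χ (embH E a b p.1) *
    (chiEta F χ (levi p.2))⁻¹

/-- `O^L(x, f)`, where `ρ` is the measure on
`((H' ∩ L) × L(F))_x \ ((H' ∩ L) × L(F))`. -/
def orbitalL (x : GL (a ⊕ a) E × GL (b ⊕ b) E)
    (ρ : Measure (Quotient (QuotientGroup.rightRel (stabL F x))))
    (f : GL (a ⊕ a) E × GL (b ⊕ b) E → ℂ) : ℂ :=
  chiEtaTildeInv χ ηt (levi x) * ∫ q, integrandL F σ χ x f q.out ∂ρ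

theorem levi_inclHL (m : (GL a E × GL a E) × (GL b E × GL b E)) :
    levi (inclHL E a b m) = diagGL (embH E a b m) := by
  refine Units.ext ?_
  ext i j
  rcases i with (i | i) | (i | i) <;> rcases j with (j | j) | (j | j) <;> rfl

theorem levi_inclLF (m : GL (a ⊕ a) F × GL (b ⊕ b) F) :
    levi (inclLF F E a b m) = extGL F E (levi m) := by
  refine Units.ext ?_
  ext i j
  rcases i with (i | i) | (i | i) <;> rcases j with (j | j) | (j | j) <;>
    first | rfl | exact (map_zero (algebraMap F E)).symm

/-- The inclusion of the stabilizer of `x` in `(H' ∩ L) × L(F)` in the one in `H' × H''`. -/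
def stabIncl (x : GL (a ⊕ a) E × GL (b ⊕ b) E) : stabL F x →* stabG F (levi x) :=
  ((MonoidHom.prodMap (embH E a b) levi).comp (stabL F x).subtype).codRestrict
    (stabG F (levi x)) (fun p => by
      have hp : (inclHL E a b p.1.1)⁻¹ * x * inclLF F E a b p.1.2 = x := p.2
      change (diagGL (embH E a b p.1.1))⁻¹ * levi x * extGL F E (levi p.1.2) = levi x
      rw [← levi_inclHL, ← levi_inclLF, ← map_inv, ← map_mul, ← map_mul, hp])

/-! ## Parabolic descent -/

/-- `f'_K(g) = ∫_{K_{H'}} ∫_{K_{H''}} f'(k₁⁻¹ g k₂) χ_{H'}(k₁) (χη)⁻¹(k₂) dk₁ dk₂`, with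
`K_{H'} = GL_n(𝔬_E) × GL_n(𝔬_E)` and `K_{H''} = GL_{2n}(𝔬_F)` of volume one. -/
def avgK [LocallyCompactSpace F] [LocallyCompactSpace E] {ι : Type*} [Fintype ι] [DecidableEq ι]
    (f : GL (ι ⊕ ι) E → ℂ) (g : GL (ι ⊕ ι) E) : ℂ :=
  ∫ k₁ in maxCompact ι E ×ˢ maxCompact ι E, ∫ k₂ in maxCompact (ι ⊕ ι) F,
    f ((diagGL k₁)⁻¹ * g * extGL F E k₂) * chiH σ χ k₁ * (chiEta F χ k₂)⁻¹
      ∂(glHaar (ι ⊕ ι) F) ∂((glHaar ι E).prod (glHaar ι E))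

/-- The modulus character `δ_{Q(E)}` on `L(E)`: the module of `u ↦ x₁ u x₂⁻¹` on
`2n₁ × 2n₂` matrices over `E`. -/
def modQ [LocallyCompactSpace E] (x : GL (a ⊕ a) E × GL (b ⊕ b) E) : ℝ :=
  normAbs E ((x.1 : Matrix (a ⊕ a) (a ⊕ a) E).det) ^ (2 * Fintype.card b) /
    normAbs E ((x.2 : Matrix (b ⊕ b) (b ⊕ b) E).det) ^ (2 * Fintype.card a)

/-- The parabolic descent `f'^Q(x) = δ_{Q(E)}(x)^{-1/2} ∫_{U(E)} f'_K(w x) dw`, where `dw` gives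
the integral points of `U(E)` volume `c`. -/
def descent [LocallyCompactSpace F] [LocallyCompactSpace E] (c : ℝ≥0∞)
    (f : GL ((a ⊕ b) ⊕ (a ⊕ b)) E → ℂ) (x : GL (a ⊕ a) E × GL (b ⊕ b) E) : ℂ :=
  letI : MeasurableSpace (Matrix (a ⊕ a) (b ⊕ b) E) := borel _
  ((modQ x ^ (-(1 / 2) : ℝ) : ℝ) : ℂ) *
    ∫ w, avgK F σ χ f (unip w * levi x) ∂(matHaar (a ⊕ a) (b ⊕ b) E c)

end L

end Orbital

end

end ParabolicDescent

open MeasureTheory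
open scoped ENNReal TensorProduct

namespace ParabolicDescent

noncomputable section

/-! ## Stabilizers of `s'(α)` -/

section Intertwiner

variable {B : Type*} [CommRing B] (τ : B →+* B) (hτ : ∀ b, τ (τ b) = b)
  {ι : Type*} [Fintype ι] [DecidableEq ι] (α : Matrix ι ι B)

/-! By the Iwasawa decomposition, an element of `H' × H''` is a product `m v k` with `m` in the Levi
part, `v` unipotent and `k` in the maximal compact subgroup. Put `y = m⁻¹ x m''`. The argument of
`f'` then becomes `k⁻¹ w y k''`, where `w` in `U(E)` has coordinate `y₁ u y₂⁻¹ - diag(P, Q)`. Here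
`P, Q` over `E` are the coordinates of the unipotent part in `H'`, and `u` over `F` is that in
`H''`. Integration over `k` turns `f'` into `f'_K`, so everything rests on the Jacobian of the
`F`-linear map `(P, Q, u) ↦ w` onto `U(E)`.

The Jacobian. Since `xᵢ x̄ᵢ⁻¹ = s'(αᵢ)`, one has `xᵢ = [1, 0; -ᾱᵢ, 1] [tᵢ; t̄ᵢ]`, with `tᵢ` the
upper rows of `xᵢ`. For rational `u` the matrix `[t₁; t̄₁] u [t₂; t̄₂]⁻¹` has the form `[A, B; B̄,
Ā]`. Translations by `P` and `Q` absorb the diagonal blocks of `w`, its upper right block is `B`,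
and its lower left block is `T(A)` plus a function of `B`, where `T(A) = Ā ᾱ₂ - ᾱ₁ A`
(`conj_unipotent_eq`). Passing from `u` to `(A, B)` produces the discriminant and `δ_Q^{-1/2}`; the
operator `T` contributes `|det T|_F⁻¹` (`lintegral_unipotent_base`, `lintegral_unipotent`). The
square of `det T` is the square of the resultant of the characteristic polynomials of `α₁ᾱ₁` and
`α₂ᾱ₂` (`det_twistedSylvester_sq`), whence the factor `|λ'|_F`.

Regularity. The stabilizer of `s'(α)` in `H'` is the unit group of the algebra of all `g` with `gα =
αḡ`. A torus contains no additive group, so this algebra has no nonzero element of square zero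
(`eq_zero_of_sq_zero_of_intertwines`). Applied to `diag(α₁, α₂)`, this makes intertwiners block
diagonal, so that the stabilizers in `H' × H''` and in its Levi part coincide
(`stabIncl_surjective`), and it makes `T` injective. Counting elements of order two in a torus of
rank `n` shows that `α` is invertible (`isUnit_of_stabIsTorus`); this is used to compare `det T`
with the resultant, and to see that the character in the integrand is trivial on the stabilizer.

Convergence. The rational points of the geometric orbit form one rational orbit
(`exists_rational_of_geometric`), and Zariski closed sets are closed for the topology of the local
field. Hence the orbit of `x` is closed, the orbit map is open onto it, and the integrand lives on
finitely many double cosets of the stabilizer and the maximal compact subgroup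
(`integrable_integrandG`).

Quotients. Integrals over `S \ A` become integrals over `A` by means of a weight `θ` whose integral
over each `S`-orbit is one (`exists_weight`). Translates of a weight restrict to weights on the Levi
part, which is what allows descent (`integral_quotient_descent`). -/

/-- The matrix `[α, 1; 1 - α τ(α), -τ(α)]` over a commutative ring with an involution `τ`. -/
def symmMatrix : Matrix (ι ⊕ ι) (ι ⊕ ι) B :=
  Matrix.fromBlocks α 1 (1 - α * α.map τ) (-α.map τ)

include hτ in
omit [Fintype ι] [DecidableEq ι] in
theorem map_map_involution {κ : Type*} (M : Matrix ι κ B) : (M.map τ).map τ = M := by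
  ext i j; simp [hτ]

-- The upper right block of the equation says `g = τ(k)` and the upper left one says `g α = α τ(g)`.
-- The two lower blocks then follow, because `α` and `τ(α)` commute. Stabilizers of `s'(α)` thus
-- become unit groups of a twisted centralizer, over any base ring.
include hτ in
theorem intertwines_symmMatrix_iff (hα : α * α.map τ = α.map τ * α) (g k : Matrix ι ι B) :
    Matrix.fromBlocks g 0 0 k * symmMatrix τ α =
        symmMatrix τ α * (Matrix.fromBlocks g 0 0 k).map τ ↔
      k = g.map τ ∧ g * α = α * g.map τ := by
  have hgg := map_map_involution τ hτ g
  have hαα := map_map_involution τ hτ α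
  simp only [symmMatrix, Matrix.fromBlocks_map, Matrix.fromBlocks_multiply, Matrix.fromBlocks_inj]
  constructor
  · rintro ⟨h1, h2, h3, h4⟩
    simp at h1 h2
    exact ⟨by rw [h2, map_map_involution τ hτ], h1⟩
  · rintro ⟨rfl, h⟩
    have h' : g.map τ * α.map τ = α.map τ * g := by
      have := congrArg (fun M => M.map τ) h
      simp only [Matrix.map_mul, hgg] at this
      exact this
    have h3 : g.map τ * (α * α.map τ) = α * α.map τ * g.map τ := by
      rw [hα, ← mul_assoc, h', mul_assoc, h, mul_assoc]
    refine ⟨by simpa using h, by simp [hgg], ?_, ?_⟩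
    · simp [mul_sub, sub_mul, h3]
    · simp [hgg, h']

end Intertwiner

/-! ### Points of the stabilizer of `s'(α)` over `F`-algebras -/

section Stabilizer

variable {F E : Type*} [Field F] [Field E] [Algebra F E] {ι : Type*} [Fintype ι] [DecidableEq ι]
  (σ : E ≃ₐ[F] E)

/-- The involution `1 ⊗ σ` of `R ⊗ E`. -/
def conjRing (R : Type*) [CommRing R] [Algebra F R] : R ⊗[F] E →+* R ⊗[F] E :=
  (Algebra.TensorProduct.map (AlgHom.id F R) (σ : E →ₐ[F] E) : R ⊗[F] E →+* R ⊗[F] E)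

/-- The inclusion of `E` in `R ⊗ E`. -/
def inclRing (F : Type*) {E : Type*} [Field F] [Field E] [Algebra F E] (R : Type*) [CommRing R]
    [Algebra F R] : E →+* R ⊗[F] E :=
  (Algebra.TensorProduct.includeRight : E →ₐ[F] R ⊗[F] E).toRingHom

@[simp] theorem conjRing_tmul (R : Type*) [CommRing R] [Algebra F R] (r : R) (z : E) :
    conjRing σ R (r ⊗ₜ z) = r ⊗ₜ σ z := by
  simp [conjRing]

@[simp] theorem inclRing_apply (R : Type*) [CommRing R] [Algebra F R] (z : E) :
    inclRing F R z = 1 ⊗ₜ z := rfl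

theorem conjRing_conjRing (hσ : ∀ z, σ (σ z) = z) (R : Type*) [CommRing R] [Algebra F R]
    (b : R ⊗[F] E) : conjRing σ R (conjRing σ R b) = b := by
  induction b using TensorProduct.induction_on with
  | zero => simp
  | tmul r z => simp [hσ]
  | add x y hx hy => simp [hx, hy]

omit [Fintype ι] [DecidableEq ι] in
theorem map_inclRing_map_conj {κ : Type*} (R : Type*) [CommRing R] [Algebra F R]
    (M : Matrix ι κ E) :
    (M.map (inclRing F R)).map (conjRing σ R) = (M.map σ).map (inclRing F R) := by
  ext i j; simp

theorem sPrime_map_inclRing (R : Type*) [CommRing R] [Algebra F R] (α : Matrix ι ι E) :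
    (sPrime σ α).map (inclRing F R) = symmMatrix (conjRing σ R) (α.map (inclRing F R)) := by
  simp only [sPrime, symmMatrix, Matrix.fromBlocks_map, map_inclRing_map_conj]
  congr 1
  · exact Matrix.map_one _ (map_zero _) (map_one _)
  · rw [← Matrix.map_mul]
    ext i j
    by_cases h : i = j <;> simp [-Matrix.map_mul, h, Matrix.one_apply, TensorProduct.tmul_sub, TensorProduct.tmul_neg,
      ← Algebra.TensorProduct.one_def]
  · ext i j; simp [TensorProduct.tmul_neg]

theorem mem_stabTwisted_iff {s : GL (ι ⊕ ι) E} (R : Type*) [CommRing R] [Algebra F R]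
    (h : GL ι (R ⊗[F] E) × GL ι (R ⊗[F] E)) :
    h ∈ stabTwisted σ s R ↔
      (Matrix.fromBlocks h.1.val 0 0 h.2.val : Matrix (ι ⊕ ι) (ι ⊕ ι) (R ⊗[F] E)) *
          s.val.map (inclRing F R) =
        s.val.map (inclRing F R) *
          (Matrix.fromBlocks h.1.val 0 0 h.2.val).map (conjRing σ R) := by
  change _ = _ ↔ _
  rw [mul_inv_eq_iff_eq_mul, Units.ext_iff]
  rfl

/-- The upper left block of `s s̄ = 1` reads `α ᾱ + (1 - ᾱ α) = 1`. -/
theorem comm_of_symm {s : GL (ι ⊕ ι) E} {α : Matrix ι ι E} (hσ : ∀ z, σ (σ z) = z)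
    (hs : s.val = sPrime σ α) (h1 : s * conjGL σ s = 1) : α * α.map σ = α.map σ * α := by
  have h := congrArg Units.val h1
  have h2 : (conjGL σ s).val = (sPrime σ α).map σ := by
    rw [← hs]; rfl
  rw [Units.val_mul, h2, hs] at h
  simp only [sPrime, Matrix.fromBlocks_map, Matrix.fromBlocks_multiply, Units.val_one,
    ← Matrix.fromBlocks_one, Matrix.fromBlocks_inj] at h
  have h11 := h.1
  have h3 : (1 - α * α.map σ).map σ = 1 - α.map σ * α := by
    ext i j
    have : ∀ i j, σ ((α * α.map σ) i j) = (α.map σ * α) i j := by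
      intro i j; simp [Matrix.mul_apply, hσ]
    simp only [Matrix.map_apply, Matrix.sub_apply, map_sub, this]
    by_cases h : i = j <;> simp [h, Matrix.one_apply]
  rw [h3, one_mul] at h11
  have : α * α.map σ - α.map σ * α = 0 := by
    rw [← sub_eq_zero] at h11; rw [← h11]; abel
  exact sub_eq_zero.mp this

theorem mem_stabTwisted_sPrime_iff (hσ : ∀ z, σ (σ z) = z) {s : GL (ι ⊕ ι) E} {α : Matrix ι ι E}
    (hs : s.val = sPrime σ α) (hα : α * α.map σ = α.map σ * α)
    (R : Type*) [CommRing R] [Algebra F R] (h : GL ι (R ⊗[F] E) × GL ι (R ⊗[F] E)) :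
    h ∈ stabTwisted σ s R ↔ h.2.val = h.1.val.map (conjRing σ R) ∧
      h.1.val * α.map (inclRing F R) = α.map (inclRing F R) * h.1.val.map (conjRing σ R) := by
  rw [mem_stabTwisted_iff, hs, sPrime_map_inclRing, intertwines_symmMatrix_iff]
  · exact conjRing_conjRing σ hσ R
  · rw [map_inclRing_map_conj, ← Matrix.map_mul, hα, Matrix.map_mul]

/-- The element of the stabilizer of `s'(α)` with first component `g`. -/
def stabMk (hσ : ∀ z, σ (σ z) = z) {s : GL (ι ⊕ ι) E} {α : Matrix ι ι E}
    (hs : s.val = sPrime σ α) (hα : α * α.map σ = α.map σ * α)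
    (R : Type*) [CommRing R] [Algebra F R] (g : GL ι (R ⊗[F] E))
    (hg : g.val * α.map (inclRing F R) = α.map (inclRing F R) * g.val.map (conjRing σ R)) :
    stabTwisted σ s R :=
  ⟨(g, Matrix.GeneralLinearGroup.map (conjRing σ R) g),
    (mem_stabTwisted_sPrime_iff σ hσ hs hα R _).2 ⟨rfl, hg⟩⟩

end Stabilizer

/-! ### Absence of unipotent elements in a torus -/

section Torus

/-- The unipotent matrix `1 + c X`, for a matrix `X` of square zero. -/
def unipOfSqZero {B ι : Type*} [CommRing B] [Fintype ι] [DecidableEq ι] (c : B) (X : Matrix ι ι B)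
    (hX : X * X = 0) : GL ι B where
  val := 1 + c • X
  inv := 1 - c • X
  val_inv := by simp [mul_sub, add_mul, hX]
  inv_val := by simp [sub_mul, mul_add, hX]

theorem unipOfSqZero_intertwines {B ι : Type*} [CommRing B] [Fintype ι] [DecidableEq ι]
    (τ : B →+* B) {c : B} (hc : τ c = c) {X α : Matrix ι ι B} (hX : X * X = 0)
    (hXα : X * α = α * X.map τ) :
    (unipOfSqZero c X hX).val * α = α * (unipOfSqZero c X hX).val.map τ := by
  have h1 : (unipOfSqZero c X hX).val.map τ = 1 + c • X.map τ := by
    ext i j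
    by_cases h : i = j <;> simp [unipOfSqZero, h, hc, Matrix.one_apply]
  rw [h1]
  simp [unipOfSqZero, add_mul, mul_add, hXα]

universe u v w

variable {F : Type u} {E : Type v} [Field F] [Field E] [Algebra F E] {ι : Type w} [Fintype ι]
  [DecidableEq ι] (σ : E ≃ₐ[F] E)

/-- When the stabilizer is a torus, it contains no unipotent one-parameter subgroup. -/
theorem eq_zero_of_sq_zero_of_intertwines (hσ : ∀ z, σ (σ z) = z) {s : GL (ι ⊕ ι) E}
    {α : Matrix ι ι E} (hs : s.val = sPrime σ α) (hα : α * α.map σ = α.map σ * α)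
    (ht : StabIsTorus σ s) {X : Matrix ι ι E} (hX : X * X = 0) (hXα : X * α = α * X.map σ) :
    X = 0 := by
  obtain ⟨φ, hφ⟩ := ht
  have hX' : X.map (inclRing F (Polynomial (AlgebraicClosure F))) *
      X.map (inclRing F (Polynomial (AlgebraicClosure F))) = 0 := by
    rw [← Matrix.map_mul, hX]; ext; simp
  -- The one-parameter subgroup `1 + TX`, viewed as a single point of the stabilizer over the
  -- polynomial ring `Ω[T]`.
  have hg := unipOfSqZero_intertwines (conjRing σ (Polynomial (AlgebraicClosure F)))
    (c := Polynomial.X ⊗ₜ 1) (by simp) (α := α.map (inclRing F _)) hX' (by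
      rw [map_inclRing_map_conj, ← Matrix.map_mul, ← Matrix.map_mul, hXα])
  set g := unipOfSqZero ((Polynomial.X : Polynomial (AlgebraicClosure F)) ⊗ₜ[F] (1 : E)) _ hX'
    with hgdef
  let p := stabMk σ hσ hs hα _ g hg
  let t := (φ (Polynomial (AlgebraicClosure F))).symm p
  let f0 : Polynomial (AlgebraicClosure F) →ₐ[AlgebraicClosure F] AlgebraicClosure F :=
    Polynomial.aeval 0
  let f1 : Polynomial (AlgebraicClosure F) →ₐ[AlgebraicClosure F] AlgebraicClosure F :=
    Polynomial.aeval 1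
  -- Units of `Ω[T]` are constants, so the torus coordinates of `1 + TX` agree at `T = 0` and `T =
  -- 1`. Naturality of `φ` then gives `1 = 1 + X` over `Ω ⊗ E`.
  have hf : (fun i => Units.map (f0 : _ →* AlgebraicClosure F) (t i)) =
      fun i => Units.map (f1 : _ →* AlgebraicClosure F) (t i) := by
    funext i
    obtain ⟨d, -, hd⟩ := Polynomial.isUnit_iff.1 (t i).isUnit
    ext
    simp only [Units.coe_map, MonoidHom.coe_coe, ← hd, f0, f1, Polynomial.aeval_C]
  have h0 := hφ _ _ f0 t
  have h1 := hφ _ _ f1 t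
  simp only at h0 h1
  rw [hf, h1] at h0
  have h2 := congrArg (fun q => (q.1 : GL ι (AlgebraicClosure F ⊗[F] E)).val) h0
  simp only [t, MulEquiv.apply_symm_apply, p, stabMk] at h2
  ext i j
  have h3 := congrFun (congrFun h2 i) j
  have e0 : f0 Polynomial.X = 0 := Polynomial.aeval_X _
  have e1 : f1 Polynomial.X = 1 := Polynomial.aeval_X _
  have : (1 : AlgebraicClosure F) ⊗ₜ[F] X i j = 0 := by
    by_cases hij : i = j <;>
    simpa [hgdef, unipOfSqZero, Matrix.GeneralLinearGroup.map_apply, hij, Matrix.one_apply, e0, e1]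
      using h3
  exact Algebra.TensorProduct.includeRight_injective
    (FaithfulSMul.algebraMap_injective F (AlgebraicClosure F)) (by simpa using this)

end Torus

/-! ## Rational stabilizers -/

section Rational

variable {F E : Type*} [Field F] [Field E] [Algebra F E] {ι : Type*} [Fintype ι] [DecidableEq ι]
  (σ : E ≃ₐ[F] E)

theorem conjGL_extGL (g : GL ι F) : conjGL σ (extGL F E g) = extGL F E g := by
  ext i j
  simp [conjGL, extGL, Matrix.GeneralLinearGroup.map_apply]

theorem extGL_injective : Function.Injective (extGL F E : GL ι F →* GL ι E) := by
  intro g h hgh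
  ext i j
  have := congrArg (fun k : GL ι E => k.val i j) hgh
  exact (algebraMap F E).injective this

theorem toBC_injective (R : Type*) [CommRing R] [Nontrivial R] [Algebra F R] :
    Function.Injective (toBC F R : GL ι E →* GL ι (R ⊗[F] E)) := by
  intro g h hgh
  ext i j
  have := congrArg (fun k : GL ι (R ⊗[F] E) => k.val i j) hgh
  exact Algebra.TensorProduct.includeRight_injective
    (FaithfulSMul.algebraMap_injective F R) this

theorem diagGL_injective {κ R : Type*} [Fintype κ] [DecidableEq κ] [CommRing R] :
    Function.Injective (diagGL : GL ι R × GL κ R →* GL (ι ⊕ κ) R) := by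
  intro g h hgh
  have h1 : Matrix.fromBlocks g.1.val 0 0 g.2.val = Matrix.fromBlocks h.1.val 0 0 h.2.val :=
    congrArg Units.val hgh
  rw [Matrix.fromBlocks_inj] at h1
  exact Prod.ext (Units.ext h1.1) (Units.ext h1.2.2.2)

/-- If `p` fixes `x` then its first component stabilizes `x x̄⁻¹` under twisted conjugation. -/
theorem diagGL_mul_toSymm_of_mem {F E : Type*} [NontriviallyNormedField F]
    [NontriviallyNormedField E] [NormedAlgebra F E] (σ : E ≃ₐ[F] E)
    {x : GL (ι ⊕ ι) E} {p : (GL ι E × GL ι E) × GL (ι ⊕ ι) F}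
    (hp : p ∈ stabG F x) :
    diagGL p.1 * toSymm σ x = toSymm σ x * conjGL σ (diagGL p.1) := by
  have h1 : (diagGL p.1)⁻¹ * x * extGL F E p.2 = x := hp
  have h2 : x * extGL F E p.2 = diagGL p.1 * x := by
    rw [mul_assoc, inv_mul_eq_iff_eq_mul] at h1; exact h1
  have h3 := congrArg (conjGL σ) h2
  rw [map_mul, map_mul, conjGL_extGL] at h3
  have h4 : extGL F E p.2 = x⁻¹ * (diagGL p.1 * x) := by rw [← h2]; group
  rw [h4] at h3
  unfold toSymm
  have h5 : conjGL σ (diagGL p.1) =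
      conjGL σ x * (x⁻¹ * (diagGL p.1 * x)) * (conjGL σ x)⁻¹ := by rw [h3]; group
  rw [h5]; group

theorem diagGL_toBC (F : Type*) [Field F] [Algebra F E] (R : Type*) [CommRing R] [Algebra F R]
    (h : GL ι E × GL ι E) : diagGL (toBC F R h.1, toBC F R h.2) = toBC F R (diagGL h) := by
  ext i j
  rcases i with i | i <;> rcases j with j | j <;>
    simp [diagGL, toBC, Matrix.GeneralLinearGroup.map_apply]

theorem conjBC_toBC (R : Type*) [CommRing R] [Algebra F R] (g : GL ι E) :
    conjBC σ R (toBC F R g) = toBC F R (conjGL σ g) := by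
  ext i j
  simp [conjBC, conjGL, toBC, Matrix.GeneralLinearGroup.map_apply]

theorem toBC_mem_stabTwisted {s : GL (ι ⊕ ι) E} {h : GL ι E × GL ι E}
    (hs : diagGL h * s = s * conjGL σ (diagGL h)) (R : Type*) [CommRing R] [Algebra F R] :
    (toBC F R h.1, toBC F R h.2) ∈ stabTwisted σ s R := by
  change _ = _
  rw [diagGL_toBC, conjBC_toBC, ← map_mul, ← map_inv, ← map_mul, hs]
  simp

theorem intertwines_of_diagGL_mul (hσ : ∀ z, σ (σ z) = z) {s : GL (ι ⊕ ι) E} {α : Matrix ι ι E}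
    (hs : s.val = sPrime σ α) (hα : α * α.map σ = α.map σ * α) {h : GL ι E × GL ι E}
    (hh : diagGL h * s = s * conjGL σ (diagGL h)) :
    h.2.val = h.1.val.map σ ∧ h.1.val * α = α * h.1.val.map σ := by
  refine (intertwines_symmMatrix_iff (σ : E →+* E) hσ α hα _ _).1 ?_
  have h1 := congrArg Units.val hh
  rw [Units.val_mul, Units.val_mul, hs] at h1
  exact h1

end Rational

section RationalTorus

universe u v w

variable {F : Type u} {E : Type v} [NontriviallyNormedField F] [NontriviallyNormedField E]
  [NormedAlgebra F E] {ι : Type w} [Fintype ι] [DecidableEq ι] (σ : E ≃ₐ[F] E)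

/-- The `H'`-component embeds into the `Ω`-points of the torus, and the `H''`-component is
determined by it as `x⁻¹ h x`. Commutativity is used later to make a left Haar measure on the
stabilizer right invariant. -/
theorem stabG_mul_comm {x : GL (ι ⊕ ι) E} (ht : StabIsTorus σ (toSymm σ x))
    (p q : (GL ι E × GL ι E) × GL (ι ⊕ ι) F) (hp : p ∈ stabG F x) (hq : q ∈ stabG F x) :
    p * q = q * p := by
  obtain ⟨φ, -⟩ := ht
  have hcomm : ∀ a b : stabTwisted σ (toSymm σ x) (AlgebraicClosure F), a * b = b * a := by
    intro a b
    apply (φ (AlgebraicClosure F)).symm.injective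
    rw [map_mul, map_mul, mul_comm]
  have h1 := hcomm
    ⟨_, toBC_mem_stabTwisted σ (diagGL_mul_toSymm_of_mem σ hp) (AlgebraicClosure F)⟩
    ⟨_, toBC_mem_stabTwisted σ (diagGL_mul_toSymm_of_mem σ hq) (AlgebraicClosure F)⟩
  have h2 := congrArg Subtype.val h1
  have h3 : p.1 * q.1 = q.1 * p.1 := by
    have h4 := Prod.ext_iff.1 h2
    refine Prod.ext ?_ ?_
    · apply toBC_injective (F := F) (AlgebraicClosure F)
      rw [Prod.fst_mul, Prod.fst_mul, map_mul, map_mul]; exact h4.1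
    · apply toBC_injective (F := F) (AlgebraicClosure F)
      rw [Prod.snd_mul, Prod.snd_mul, map_mul, map_mul]; exact h4.2
  refine Prod.ext h3 ?_
  apply extGL_injective (E := E)
  have e : ∀ r ∈ stabG F x, extGL F E r.2 = x⁻¹ * diagGL r.1 * x := fun r hr => by
    have h1 : (diagGL r.1)⁻¹ * x * extGL F E r.2 = x := hr
    rw [mul_assoc, inv_mul_eq_iff_eq_mul] at h1
    rw [mul_assoc, ← h1]; group
  rw [e _ (mul_mem hp hq), e _ (mul_mem hq hp), Prod.fst_mul, Prod.fst_mul, h3]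

end RationalTorus

/-! ## Invertibility of `α` -/

section Split

variable {F E Ω : Type*} [Field F] [Field E] [Algebra F E] [Field Ω] [Algebra F Ω]
  (σ : E ≃ₐ[F] E) (τ : E →ₐ[F] Ω)

/-- The homomorphism `ω ⊗ z ↦ ω τ(z)`. -/
def splitHom : Ω ⊗[F] E →+* Ω :=
  (Algebra.TensorProduct.productMap (AlgHom.id F Ω) τ).toRingHom

@[simp] theorem splitHom_tmul (ω : Ω) (z : E) : splitHom τ (ω ⊗ₜ z) = ω * τ z := by
  simp [splitHom]

variable [CharZero F]

/-- As `E = F ⊕ Fz`, every element is `ω₀ ⊗ 1 + ω₁ ⊗ z`, and it is sent to `(ω₀ + ω₁ τ(z), ω₀ - ω₁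
τ(z))`. This is invertible because `2` and `τ(z)` are nonzero. Under the resulting isomorphism `Ω ⊗
E ≃ Ω × Ω` the conjugation is the swap. -/
theorem bijective_splitHom_prod {z : E} (hz : σ z = -z) (hz0 : z ≠ 0)
    (hspan : ∀ y : E, ∃ c d : F, y = algebraMap F E c + d • z) :
    Function.Bijective
      ((splitHom τ).prod ((splitHom τ).comp (conjRing σ Ω)) : Ω ⊗[F] E →+* Ω × Ω) := by
  have hτz : τ z ≠ 0 := by simpa using hz0
  have h2 : (2 : Ω) ≠ 0 := by
    have : CharZero Ω := charZero_of_injective_algebraMap (algebraMap F Ω).injective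
    exact two_ne_zero
  have hform : ∀ b : Ω ⊗[F] E, ∃ ω₀ ω₁ : Ω, b = ω₀ ⊗ₜ 1 + ω₁ ⊗ₜ z := by
    intro b
    induction b using TensorProduct.induction_on with
    | zero => exact ⟨0, 0, by simp⟩
    | tmul r y =>
      obtain ⟨c, d, rfl⟩ := hspan y
      refine ⟨c • r, d • r, ?_⟩
      rw [TensorProduct.tmul_add, Algebra.algebraMap_eq_smul_one, TensorProduct.tmul_smul,
        TensorProduct.tmul_smul, TensorProduct.smul_tmul', TensorProduct.smul_tmul']
    | add x y hx hy =>
      obtain ⟨a, b, rfl⟩ := hx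
      obtain ⟨c, d, rfl⟩ := hy
      exact ⟨a + c, b + d, by rw [TensorProduct.add_tmul, TensorProduct.add_tmul]; abel⟩
  constructor
  · rw [injective_iff_map_eq_zero]
    intro b hb
    obtain ⟨ω₀, ω₁, rfl⟩ := hform b
    have e1 := congrArg Prod.fst hb
    have e2 := congrArg Prod.snd hb
    simp [hz] at e1 e2
    have h0 : 2 * ω₀ = 0 := by linear_combination e1 + e2
    have h1 : 2 * (ω₁ * τ z) = 0 := by linear_combination e1 - e2
    have h0' : ω₀ = 0 := by simpa [h2] using h0
    have h1' : ω₁ = 0 := by simpa [h2, hz0] using h1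
    simp [h0', h1']
  · rintro ⟨u, v⟩
    refine ⟨((u + v) / 2) ⊗ₜ 1 + ((u - v) / 2 / τ z) ⊗ₜ z, Prod.ext ?_ ?_⟩
    · simp; field_simp; ring
    · simp [hz]; field_simp; ring

end Split

/-! ### Elements of order two -/

section Torsion

/-- A commuting pair with a line in the kernel has many elements of order two in its stabilizer. -/
theorem exists_torsion_injection {Ω : Type*} [Field Ω] [CharZero Ω] {ι : Type*} [Fintype ι]
    [DecidableEq ι] (a b e P : Matrix ι ι Ω) (hab : a * b = b * a) (hae : a * e = 0)
    (hea : e * a = 0) (hbe : b * e = 0) (heb : e * b = 0) (hee : e * e = e) (he0 : e ≠ 0)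
    (ha : IsUnit (a + e)) (hb : IsUnit (b + e)) (hP : IsUnit P) (r : ι → Ω)
    (hPr : a * b * P = P * Matrix.diagonal r) :
    ∃ j : Option (ι → Bool) → Matrix ι ι Ω × Matrix ι ι Ω, Function.Injective j ∧
      ∀ i, (j i).1 * (j i).1 = 1 ∧ (j i).2 * (j i).2 = 1 ∧ (j i).1 * a = a * (j i).2 ∧
        (j i).2 * b = b * (j i).1 := by
  obtain ⟨A, hA⟩ := ha
  obtain ⟨P, rfl⟩ := hP
  -- the idempotent is diagonal in the basis of eigenvectors
  have hu : IsUnit (a * b + e) := by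
    have : a * b + e = (a + e) * (b + e) := by simp [mul_add, add_mul, hae, heb, hee]
    rw [this]; exact (hA ▸ A.isUnit).mul hb
  let e' := P⁻¹.val * e * P.val
  have heP : e * P.val = P.val * e' := by simp [e', mul_assoc]
  have hdiag1 : Matrix.diagonal r * e' = 0 := by
    have : P.val * (Matrix.diagonal r * e') = 0 := by
      rw [← mul_assoc, ← hPr, mul_assoc, ← heP, ← mul_assoc, mul_assoc a b e, hbe, mul_zero,
        zero_mul]
    simpa using this
  have hdiag2 : e' * Matrix.diagonal r = 0 := by
    have : P.val * (e' * Matrix.diagonal r) = 0 := by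
      rw [← mul_assoc, ← heP, mul_assoc, ← hPr, ← mul_assoc, ← mul_assoc, hea, zero_mul, zero_mul]
    simpa using this
  have hu' : IsUnit (Matrix.diagonal r + e') := by
    have : Matrix.diagonal r + e' = P⁻¹.val * (a * b + e) * P.val := by
      rw [mul_add, add_mul, mul_assoc, hPr]; simp [e']
    rw [this]; exact (P⁻¹.isUnit.mul hu).mul P.isUnit
  have he' : e' * (e' - 1) = 0 := by
    have : e' * e' = e' := by
      have : e' * e' = P⁻¹.val * (e * (P.val * P⁻¹.val) * e) * P.val := by
        simp only [e', mul_assoc]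
      rw [this]; simp [hee, e']
    rw [mul_sub, this, mul_one, sub_self]
  -- An off-diagonal entry `e' i j ≠ 0` forces `r j = 0`. The `j`-th basis vector is then killed by
  -- `(diag r + e')(e' - 1)`; since the first factor is invertible, `e'` fixes that vector, contrary
  -- to `e' i j ≠ 0`. So the sign matrices commute with `e'` even when eigenvalues repeat.
  have hcomm : ∀ d : ι → Ω, Matrix.diagonal d * e' = e' * Matrix.diagonal d := by
    intro d
    ext i j
    rw [Matrix.diagonal_mul, Matrix.mul_diagonal]
    by_cases hij : i = j
    · rw [hij, mul_comm]
    have h1 : r i * e' i j = 0 := by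
      have := congrFun (congrFun hdiag1 i) j; rwa [Matrix.diagonal_mul] at this
    have h2 : e' i j * r j = 0 := by
      have := congrFun (congrFun hdiag2 i) j; rwa [Matrix.mul_diagonal] at this
    by_cases h0 : e' i j = 0
    · rw [h0]; ring
    -- otherwise both eigenvalues vanish, and `e'` is the identity on this part
    exfalso
    have hrj : r j = 0 := by simpa [h0] using h2
    have h3 : (Matrix.diagonal r + e') * (e' - 1) = -Matrix.diagonal r := by
      rw [add_mul, he', mul_sub, hdiag1]; simp
    have h4 : ((Matrix.diagonal r + e') * (e' - 1)).mulVec (Pi.single j 1) = 0 := by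
      rw [h3]; ext k; by_cases hk : k = j <;> simp [Matrix.diagonal, hk, hrj]
    rw [← Matrix.mulVec_mulVec] at h4
    obtain ⟨U, hU⟩ := hu'
    have h5 : (e' - 1).mulVec (Pi.single j 1) = 0 := by
      have := congrArg (fun v => U⁻¹.val.mulVec v) h4
      simpa [← hU] using this
    have h6 := congrFun h5 i
    simp [Matrix.one_apply, hij] at h6
    exact h0 h6
  let s : (ι → Bool) → ι → Ω := fun ε i => if ε i then 1 else -1
  have hs : ∀ ε, Matrix.diagonal (s ε) * Matrix.diagonal (s ε) = 1 := fun ε => by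
    rw [Matrix.diagonal_mul_diagonal, ← Matrix.diagonal_one]
    congr 1; funext i; by_cases h : ε i <;> simp [s, h]
  let g : (ι → Bool) → Matrix ι ι Ω := fun ε => P.val * Matrix.diagonal (s ε) * P⁻¹.val
  have hg2 : ∀ ε, g ε * g ε = 1 := fun ε => by
    have : g ε * g ε = P.val * (Matrix.diagonal (s ε) * (P⁻¹.val * P.val) *
      Matrix.diagonal (s ε)) * P⁻¹.val := by simp only [g, mul_assoc]
    rw [this]; simp [hs]
  have hge : ∀ ε, g ε * e = e * g ε := fun ε => by
    have h1 : e = P.val * e' * P⁻¹.val := by rw [← heP]; simp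
    have h2 : g ε * e = P.val * (Matrix.diagonal (s ε) * (P⁻¹.val * P.val) * e') * P⁻¹.val := by
      nth_rw 1 [h1]; simp only [g, mul_assoc]
    have h3 : e * g ε = P.val * (e' * (P⁻¹.val * P.val) * Matrix.diagonal (s ε)) * P⁻¹.val := by
      nth_rw 1 [h1]; simp only [g, mul_assoc]
    rw [h2, h3]; simp [hcomm]
  have hgc : ∀ ε, g ε * (a * b) = a * b * g ε := fun ε => by
    have h1 : a * b = P.val * Matrix.diagonal r * P⁻¹.val := by rw [← hPr]; simp
    have h2 : g ε * (a * b) =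
        P.val * (Matrix.diagonal (s ε) * (P⁻¹.val * P.val) * Matrix.diagonal r) * P⁻¹.val := by
      rw [h1]; simp only [g, mul_assoc]
    have h3 : a * b * g ε =
        P.val * (Matrix.diagonal r * (P⁻¹.val * P.val) * Matrix.diagonal (s ε)) * P⁻¹.val := by
      rw [h1]; simp only [g, mul_assoc]
    rw [h2, h3]; simp [mul_comm]
  have hAe : A.val * e = e := by rw [hA, add_mul, hae, hee, zero_add]
  have heA : e * A.val = e := by rw [hA, mul_add, hea, hee, zero_add]
  have hA'e : A⁻¹.val * e = e := by
    nth_rw 1 [← hAe]; rw [← mul_assoc]; simp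
  have heA' : e * A⁻¹.val = e := by
    nth_rw 1 [← heA]; rw [mul_assoc]; simp
  -- The partner of `g` is its conjugate by `A = a + e`. Since `g` commutes with `e` and with `a b`,
  -- this yields both intertwining relations although `a` itself is singular.
  let g' : (ι → Bool) → Matrix ι ι Ω := fun ε => A⁻¹.val * g ε * A.val
  have hg'2 : ∀ ε, g' ε * g' ε = 1 := fun ε => by
    have : g' ε * g' ε = A⁻¹.val * (g ε * (A.val * A⁻¹.val) * g ε) * A.val := by
      simp only [g', mul_assoc]
    rw [this]; simp [hg2]
  have hg'e : ∀ ε, g' ε * e = e * g ε := fun ε => by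
    simp only [g']
    rw [mul_assoc, hAe, mul_assoc, hge, ← mul_assoc, hA'e]
  have heg' : ∀ ε, e * g' ε = e * g ε := fun ε => by
    simp only [g']
    rw [← mul_assoc, ← mul_assoc, heA', ← hge, mul_assoc, heA]
  have hAg' : ∀ ε, A.val * g' ε = g ε * A.val := fun ε => by
    simp [g', ← mul_assoc]
  have hga : ∀ ε, g ε * a = a * g' ε := fun ε => by
    have h1 : a = A.val - e := by rw [hA]; abel
    rw [h1, mul_sub, sub_mul, hAg', heg', hge]
  have hAb : A.val * b = a * b := by rw [hA, add_mul, heb, add_zero]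
  have hAb' : b * A.val = a * b := by rw [hA, mul_add, hbe, add_zero, hab]
  have hgb : ∀ ε, g' ε * b = b * g ε := fun ε => by
    have h1 : A.val * (g' ε * b) = A.val * (b * g ε) := by
      rw [← mul_assoc, hAg', mul_assoc, hAb, hgc, ← mul_assoc A.val b, hAb]
    have := congrArg (fun M => A⁻¹.val * M) h1
    simpa [← mul_assoc] using this
  have h2e : (1 - 2 • e) * (1 - 2 • e) = 1 := by
    simp only [mul_sub, sub_mul, mul_one, one_mul, smul_mul_assoc, mul_smul_comm, hee]
    abel
  -- To the sign matrices one more element is added: `1 - 2e` in the first factor alone, possible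
  -- because `e` is annihilated by `a` and `b` on both sides. It is new, since in the sign family
  -- the two components are conjugate and a trivial second component forces a trivial first one.
  refine ⟨fun o => o.elim (1 - 2 • e, 1) (fun ε => (g ε, g' ε)), ?_, ?_⟩
  · have key : ∀ ε, (1 - 2 • e, (1 : Matrix ι ι Ω)) ≠ (g ε, g' ε) := by
      intro ε h
      obtain ⟨h1, h2⟩ := Prod.ext_iff.1 h
      simp only at h1 h2
      have h3 : g ε = 1 := by
        have : g ε = A.val * g' ε * A⁻¹.val := by rw [hAg', mul_assoc]; simp
        rw [this, ← h2]; simp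
      rw [h3] at h1
      have h4 : 2 • e = 0 := by
        have := sub_eq_self.1 h1; exact this
      apply he0
      ext i j
      have := congrFun (congrFun h4 i) j
      simpa using this
    rintro (_ | ε) (_ | ε') h
    · rfl
    · exact absurd h (key ε')
    · exact absurd h.symm (key ε)
    · have h1 : g ε = g ε' := (Prod.ext_iff.1 h).1
      have h2 : Matrix.diagonal (s ε) = Matrix.diagonal (s ε') := by
        have := congrArg (fun M => P⁻¹.val * M * P.val) h1
        simpa [g, ← mul_assoc] using this
      have h3 := Matrix.diagonal_injective h2
      congr 1
      funext i
      have h4 := congrFun h3 i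
      have h5 : (1 : Ω) ≠ -1 := by norm_num
      cases h6 : ε i <;> cases h7 : ε' i <;> simp only [s, h6, h7] at h4 ⊢ <;>
        simp only [Bool.false_eq_true, if_true, if_false] at h4
      · exact absurd h4.symm h5
      · exact absurd h4 h5
  · rintro (_ | ε)
    · refine ⟨h2e, by simp, ?_, ?_⟩
      · change (1 - 2 • e) * a = a * 1
        rw [sub_mul, smul_mul_assoc, hea]; simp
      · change 1 * b = b * (1 - 2 • e)
        rw [mul_sub, mul_smul_comm, hbe]; simp
    · exact ⟨hg2 ε, hg'2 ε, hga ε, hgb ε⟩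

end Torsion

/-! ### The kernel of a singular `α` -/

section KernelProjection

variable {F E : Type*} [Field F] [Field E] [Algebra F E] {ι : Type*} [Fintype ι] [DecidableEq ι]
  (σ : E ≃ₐ[F] E)

/-- If `α` is singular and there are no nilpotent intertwiners, there is a rational rank one
projection onto the kernel of `α`. -/
theorem exists_kernel_projection (hσ : ∀ z, σ (σ z) = z) {α : Matrix ι ι E}
    (hα : α * α.map σ = α.map σ * α)
    (hnil : ∀ X : Matrix ι ι E, X * X = 0 → X * α = α * X.map σ → X = 0) (hdet : α.det = 0) :
    ∃ e : Matrix ι ι E, e ≠ 0 ∧ e * e = e ∧ α * e = 0 ∧ e * α = 0 ∧ e.map σ = e ∧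
      IsUnit (α + e) := by
  obtain ⟨u, hu0, hu⟩ := Matrix.exists_mulVec_eq_zero_iff.2 hdet
  obtain ⟨w, hw0, hw⟩ := Matrix.exists_vecMul_eq_zero_iff.2 hdet
  have hσσ : ∀ v : ι → E, σ ∘ (σ ∘ v) = v := fun v => by ext i; simp [hσ]
  have hσ0 : ∀ v : ι → E, σ ∘ v = 0 → v = 0 := fun v hv => by
    rw [← hσσ v, hv]; ext; simp
  have hmv : ∀ (M : Matrix ι ι E) (v : ι → E),
      σ ∘ (M.mulVec v) = (M.map σ).mulVec (σ ∘ v) := fun M v => by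
    ext i; simp [Matrix.mulVec, dotProduct]
  have hvm : ∀ (M : Matrix ι ι E) (v : ι → E),
      σ ∘ (M.vecMul v) = (M.map σ).vecMul (σ ∘ v) := fun M v => by
    ext i; simp [Matrix.vecMul, dotProduct]
  have hαα : (α.map σ).map σ = α := map_map_involution (σ : E →+* E) hσ α
  -- kernel and cokernel pair nontrivially
  have hA : ∀ u' w' : ι → E, u' ≠ 0 → w' ≠ 0 → α.mulVec u' = 0 → α.vecMul w' = 0 →
      w' ⬝ᵥ (σ ∘ u') ≠ 0 := by
    intro u' w' hu' hw' h1 h2 h3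
    -- The rank one matrix `ū' w'` has square `(w' · ū') ū' w' = 0`. It intertwines trivially, both
    -- products in the relation being zero, so it must vanish.
    have hX : Matrix.vecMulVec (σ ∘ u') w' = 0 := by
      apply hnil
      · rw [Matrix.vecMulVec_mul_vecMulVec, h3, zero_smul, Matrix.vecMulVec_zero]
      · have e1 : (Matrix.vecMulVec (σ ∘ u') w').map σ = Matrix.vecMulVec u' (σ ∘ w') := by
          ext i j; simp [Matrix.vecMulVec_apply, hσ]
        rw [e1, Matrix.vecMulVec_mul, Matrix.mul_vecMulVec, h1, h2]
        simp
    obtain ⟨i, hi⟩ := Function.ne_iff.1 hu'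
    obtain ⟨j, hj⟩ := Function.ne_iff.1 hw'
    have := congrFun (congrFun hX i) j
    simp [Matrix.vecMulVec_apply] at this
    rcases this with h | h
    · exact hi h
    · exact hj h
  have huw := hA u w hu0 hw0 hu hw
  -- The kernel is a line: any kernel vector becomes orthogonal to `w` after subtracting a multiple
  -- of `u`, and such a kernel vector is zero by the pairing just established.
  have hB : ∀ u', α.mulVec u' = 0 → ∃ c : E, u' = c • u := by
    intro u' hu'
    refine ⟨σ ((w ⬝ᵥ (σ ∘ u')) / (w ⬝ᵥ (σ ∘ u))), ?_⟩
    by_contra hne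
    refine hA (u' - σ ((w ⬝ᵥ (σ ∘ u')) / (w ⬝ᵥ (σ ∘ u))) • u) w (sub_ne_zero.2 hne) hw0 ?_ hw ?_
    · rw [Matrix.mulVec_sub, Matrix.mulVec_smul, hu, hu']; simp
    · have e1 : σ ∘ (u' - σ ((w ⬝ᵥ (σ ∘ u')) / (w ⬝ᵥ (σ ∘ u))) • u) =
          σ ∘ u' - ((w ⬝ᵥ (σ ∘ u')) / (w ⬝ᵥ (σ ∘ u))) • (σ ∘ u) := by
        ext i; simp [hσ]
      rw [e1, dotProduct_sub, dotProduct_smul, smul_eq_mul, div_mul_cancel₀ _ huw, sub_self]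
  have hB' : ∀ w', α.vecMul w' = 0 → ∃ c : E, w' = c • w := by
    intro w' hw'
    refine ⟨(w' ⬝ᵥ (σ ∘ u)) / (w ⬝ᵥ (σ ∘ u)), ?_⟩
    by_contra hne
    refine hA u (w' - ((w' ⬝ᵥ (σ ∘ u)) / (w ⬝ᵥ (σ ∘ u))) • w) hu0 (sub_ne_zero.2 hne) hu ?_ ?_
    · rw [Matrix.sub_vecMul, Matrix.smul_vecMul, hw, hw']; simp
    · rw [sub_dotProduct, smul_dotProduct, smul_eq_mul, div_mul_cancel₀ _ huw, sub_self]
  -- the kernel is rational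
  have hu1 : (α.map σ).mulVec u = 0 := by
    obtain ⟨c, hc⟩ := hB ((α.map σ).mulVec u) (by
      rw [Matrix.mulVec_mulVec, hα, ← Matrix.mulVec_mulVec, hu, Matrix.mulVec_zero])
    -- Conjugating `ᾱ u = c u` and pairing with `w` gives `0 = c̄ (w · ū)`, since `w α = 0`; hence
    -- `c = 0`.
    have h1 := congrArg (fun v => w ⬝ᵥ (σ ∘ v)) hc
    simp only [hmv, hαα] at h1
    rw [Matrix.dotProduct_mulVec, hw, zero_dotProduct] at h1
    have e1 : σ ∘ (c • u) = σ c • (σ ∘ u) := by ext i; simp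
    rw [e1, dotProduct_smul, smul_eq_mul] at h1
    have h2 : σ c = 0 := by
      rcases mul_eq_zero.1 h1.symm with h | h
      · exact h
      · exact absurd h huw
    rw [hc, (map_eq_zero σ).1 h2, zero_smul]
  have hw1 : (α.map σ).vecMul w = 0 := by
    obtain ⟨c, hc⟩ := hB' ((α.map σ).vecMul w) (by
      rw [Matrix.vecMul_vecMul, ← hα, ← Matrix.vecMul_vecMul, hw, Matrix.zero_vecMul])
    have h1 := congrArg (fun v => v ⬝ᵥ (σ ∘ u)) hc
    rw [← Matrix.dotProduct_mulVec, ← hmv, hu, smul_dotProduct, smul_eq_mul] at h1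
    have e1 : σ ∘ (0 : ι → E) = 0 := by ext; simp
    rw [e1, dotProduct_zero] at h1
    rcases mul_eq_zero.1 h1.symm with h | h
    · rw [hc, h, zero_smul]
    · exact absurd h huw
  have hσu : α.mulVec (σ ∘ u) = 0 := by
    have := hmv (α.map σ) u
    rw [hu1, hαα] at this
    rw [← this]; ext; simp
  have hσw : α.vecMul (σ ∘ w) = 0 := by
    have := hvm (α.map σ) w
    rw [hw1, hαα] at this
    rw [← this]; ext; simp
  obtain ⟨m, hm⟩ := hB _ hσu
  obtain ⟨n, hn⟩ := hB' _ hσw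
  have hm0 : m ≠ 0 := fun h => by
    rw [h, zero_smul] at hm; exact hu0 (hσ0 u hm)
  let d := w ⬝ᵥ (σ ∘ u)
  -- The vector `ū` spans the same line as `u`. Dividing by `d = w · ū` makes the rank one matrix
  -- idempotent.
  let e : Matrix ι ι E := d⁻¹ • Matrix.vecMulVec (σ ∘ u) w
  have hee : e * e = e := by
    simp only [e, smul_mul_assoc, mul_smul_comm, Matrix.vecMulVec_mul_vecMulVec]
    rw [Matrix.vecMulVec_smul, smul_smul d⁻¹ (w ⬝ᵥ (σ ∘ u)), inv_mul_cancel₀ huw, one_smul]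
  have he0 : e ≠ 0 := by
    intro h
    have h1 : e.mulVec (σ ∘ u) = σ ∘ u := by
      simp only [e, Matrix.smul_mulVec, Matrix.vecMulVec_mulVec]
      ext i
      simp [d, mul_comm, huw]
    rw [h, Matrix.zero_mulVec] at h1
    exact hu0 (hσ0 u h1.symm)
  have hαe : α * e = 0 := by
    simp only [e, mul_smul_comm, Matrix.mul_vecMulVec, hσu]; simp
  have heα : e * α = 0 := by
    simp only [e, smul_mul_assoc, Matrix.vecMulVec_mul, hw]; simp
  obtain ⟨k, hk⟩ : ∃ k : E, e.map σ = k • e := by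
    refine ⟨(σ d)⁻¹ * n * m⁻¹ * d, ?_⟩
    ext i j
    have e1 : σ (u i) = m * u i := congrFun hm i
    have e2 : σ (w j) = n * w j := congrFun hn j
    have hd : d ≠ 0 := huw
    simp only [e, Matrix.map_apply, Matrix.smul_apply, Matrix.vecMulVec_apply, Function.comp_apply,
      smul_eq_mul, map_mul, map_inv₀, hσ]
    rw [e1, e2]
    field_simp
  -- The conjugate of `e` is a multiple `k e`. Being idempotent and nonzero, it has `k² = k ≠ 0`.
  have hk1 : e.map σ = e := by
    have h1 : e.map σ * e.map σ = e.map σ := by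
      have := congrArg (fun M : Matrix ι ι E => M.map σ) hee
      simpa [Matrix.map_mul] using this
    rw [hk, smul_mul_smul_comm, hee] at h1
    have h2 : k * k = k := by
      obtain ⟨i, hi⟩ := Function.ne_iff.1 he0
      obtain ⟨j, hj⟩ := Function.ne_iff.1 hi
      have := congrFun (congrFun h1 i) j
      simp only [Matrix.smul_apply, smul_eq_mul] at this
      exact mul_right_cancel₀ hj this
    have hk0 : k ≠ 0 := fun h => by
      rw [h, zero_smul] at hk
      apply he0
      ext i j
      have := congrFun (congrFun hk i) j
      simpa using this
    have : k = 1 := mul_left_cancel₀ hk0 (by rw [h2, mul_one])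
    rw [hk, this, one_smul]
  refine ⟨e, he0, hee, hαe, heα, hk1, ?_⟩
  rw [Matrix.isUnit_iff_isUnit_det, isUnit_iff_ne_zero]
  intro h0
  obtain ⟨v, hv0, hv⟩ := Matrix.exists_mulVec_eq_zero_iff.2 h0
  -- Multiplying `(α + e) v = 0` by `e` leaves `e v = 0`, hence `α v = 0`. Thus `v` lies on the
  -- kernel line, where `e` acts as the identity.
  have h1 : e.mulVec v = 0 := by
    have := congrArg (fun v => e.mulVec v) hv
    simpa [Matrix.mulVec_mulVec, mul_add, heα, hee] using this
  have h2 : α.mulVec v = 0 := by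
    rw [Matrix.add_mulVec, h1, add_zero] at hv; exact hv
  obtain ⟨c, hc⟩ := hB v h2
  have h3 : v = (c * m⁻¹) • (σ ∘ u) := by
    rw [hc, hm, smul_smul, mul_assoc, inv_mul_cancel₀ hm0, mul_one]
  have h4 : e.mulVec (σ ∘ u) = σ ∘ u := by
    simp only [e, Matrix.smul_mulVec, Matrix.vecMulVec_mulVec]
    ext i
    simp [d, mul_comm, huw]
  rw [h3, Matrix.mulVec_smul, h4, ← h3] at h1
  exact hv0 h1

end KernelProjection

/-! ### Diagonalization by a squarefree annihilating polynomial -/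

section Diagonalization

/-- Over an algebraically closed field, a matrix annihilated by a squarefree polynomial is
diagonalizable. -/
theorem exists_diagonalization {Ω : Type*} [Field Ω] [IsAlgClosed Ω] {ι : Type*} [Fintype ι]
    [DecidableEq ι] (c : Matrix ι ι Ω) {p : Polynomial Ω} (hp : Squarefree p)
    (hc : Polynomial.aeval c p = 0) :
    ∃ (P : Matrix ι ι Ω) (r : ι → Ω), IsUnit P ∧ c * P = P * Matrix.diagonal r := by
  classical
  let f : Module.End Ω (ι → Ω) := Matrix.toLinAlgEquiv' c
  have hf : Polynomial.aeval f p = 0 := by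
    have : f = (Matrix.toLinAlgEquiv' : Matrix ι ι Ω ≃ₐ[Ω] _).toAlgHom c := rfl
    rw [this, Polynomial.aeval_algHom_apply, hc, map_zero]
  have hss : f.IsSemisimple := Module.End.isSemisimple_of_squarefree_aeval_eq_zero hp hf
  have htop := hss.iSup_eigenspace_eq_top
  have hint : DirectSum.IsInternal f.eigenspace :=
    DirectSum.isInternal_submodule_of_iSupIndep_of_iSup_eq_top f.eigenspaces_iSupIndep htop
  let B := hint.collectedBasis (fun μ => Module.finBasis Ω (f.eigenspace μ))
  have : Fintype _ := FiniteDimensional.fintypeBasisIndex B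
  have hcard : Fintype.card _ = Fintype.card ι :=
    (Module.finrank_eq_card_basis B).symm.trans (by simp)
  let B' := B.reindex (Fintype.equivOfCardEq hcard)
  have hB' : ∀ i, ∃ μ : Ω, f (B' i) = μ • B' i := by
    intro i
    refine ⟨((Fintype.equivOfCardEq hcard).symm i).1, ?_⟩
    have := hint.collectedBasis_mem (fun μ => Module.finBasis Ω (f.eigenspace μ))
      ((Fintype.equivOfCardEq hcard).symm i)
    rw [Module.End.mem_eigenspace_iff] at this
    simpa [B', B] using this
  choose r hr using hB'
  refine ⟨Matrix.of fun i j => B' j i, r, ?_, ?_⟩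
  · have : Matrix.of (fun i j => B' j i) = (Pi.basisFun Ω ι).toMatrix B' := by
      ext i j; simp [Module.Basis.toMatrix_apply]
    rw [this]
    exact (Matrix.isUnit_iff_isUnit_det _).2
      ((Pi.basisFun Ω ι).isUnit_det B' |> fun h => by rwa [Module.Basis.det_apply] at h)
  · ext i j
    rw [Matrix.mul_diagonal]
    have := congrFun (hr j) i
    simpa [f, Matrix.mulVec, dotProduct, Matrix.mul_apply, mul_comm] using this

end Diagonalization

/-! ### Rationality over `F`, and invertibility of `α` -/

section Invertible

universe u v w

variable {F : Type u} {E : Type v} [Field F] [Field E] [Algebra F E] {ι : Type w} [Fintype ι]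
  [DecidableEq ι] (σ : E ≃ₐ[F] E)

theorem exists_algebraMap_of_fixed [CharZero F] {z : E} (hz : σ z = -z) (hz0 : z ≠ 0)
    (hspan : ∀ y : E, ∃ c d : F, y = algebraMap F E c + d • z) {y : E} (hy : σ y = y) :
    ∃ c : F, algebraMap F E c = y := by
  obtain ⟨c, d, rfl⟩ := hspan y
  have : CharZero E := charZero_of_injective_algebraMap (algebraMap F E).injective
  have h1 : σ (d • z) = -(d • z) := by
    rw [Algebra.smul_def, map_mul, AlgEquiv.commutes, hz, mul_neg]
  rw [map_add, AlgEquiv.commutes, h1, add_right_inj] at hy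
  have h2 : (2 : E) * (d • z) = 0 := by linear_combination -hy
  have h3 : d • z = 0 := by simpa using h2
  exact ⟨c, by rw [h3, add_zero]⟩

theorem exists_map_algebraMap_of_fixed [CharZero F] {z : E} (hz : σ z = -z) (hz0 : z ≠ 0)
    (hspan : ∀ y : E, ∃ c d : F, y = algebraMap F E c + d • z) {κ κ' : Type*} {M : Matrix κ κ' E}
    (hM : M.map σ = M) : ∃ N : Matrix κ κ' F, N.map (algebraMap F E) = M := by
  have h : ∀ i j, ∃ c : F, algebraMap F E c = M i j := fun i j =>
    exists_algebraMap_of_fixed σ hz hz0 hspan (congrFun (congrFun hM i) j)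
  choose N hN using h
  exact ⟨Matrix.of N, by ext i j; simp [hN]⟩

/-- If the minimal polynomial is `x² y`, then `(x y)(γ)` has square zero and so vanishes. The
minimal polynomial `x · x y` then divides `x y`, which makes `x` a unit. -/
theorem squarefree_minpoly_of_no_nilpotent {γ : Matrix ι ι F}
    (h : ∀ p : Polynomial F, Polynomial.aeval γ p * Polynomial.aeval γ p = 0 →
      Polynomial.aeval γ p = 0) : Squarefree (minpoly F γ) := by
  intro x hx
  obtain ⟨y, hy⟩ := hx
  have h1 : Polynomial.aeval γ (x * y) = 0 := by
    apply h
    rw [← map_mul, show x * y * (x * y) = minpoly F γ * y by rw [hy]; ring, map_mul,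
      minpoly.aeval, zero_mul]
  have h2 := minpoly.dvd F γ h1
  have hint : IsIntegral F γ := Algebra.IsIntegral.isIntegral γ
  have hne := minpoly.ne_zero hint
  rw [hy] at h2 hne
  have hxy : x * y ≠ 0 := fun h => hne (by rw [mul_assoc, h, mul_zero])
  obtain ⟨q, hq⟩ := h2
  have : x * q = 1 := by
    apply mul_left_cancel₀ hxy
    rw [mul_one]; nth_rw 2 [hq]; ring
  exact IsUnit.of_mul_eq_one _ this

/-- A pair of matrices over `Ω`, as a matrix over `Ω ⊗ E ≃ Ω × Ω`. -/
def pairMatrix {B Ω κ : Type*} [CommRing B] [Field Ω] (s : B ≃+* Ω × Ω)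
    (p : Matrix κ κ Ω × Matrix κ κ Ω) : Matrix κ κ B :=
  Matrix.of fun i j => s.symm (p.1 i j, p.2 i j)

theorem pairMatrix_injective {B Ω κ : Type*} [CommRing B] [Field Ω] (s : B ≃+* Ω × Ω) :
    Function.Injective (pairMatrix s : Matrix κ κ Ω × Matrix κ κ Ω → Matrix κ κ B) := by
  intro p q h
  have h1 : ∀ i j, (p.1 i j, p.2 i j) = (q.1 i j, q.2 i j) := fun i j =>
    s.symm.injective (congrFun (congrFun h i) j)
  refine Prod.ext ?_ ?_ <;> ext i j
  · exact (Prod.ext_iff.1 (h1 i j)).1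
  · exact (Prod.ext_iff.1 (h1 i j)).2

theorem pairMatrix_mul {B Ω κ : Type*} [CommRing B] [Field Ω] [Fintype κ] (s : B ≃+* Ω × Ω)
    (p q : Matrix κ κ Ω × Matrix κ κ Ω) :
    pairMatrix s p * pairMatrix s q = pairMatrix s (p * q) := by
  ext i j
  apply s.injective
  simp only [pairMatrix, Matrix.mul_apply, Matrix.of_apply, map_sum, map_mul,
    RingEquiv.apply_symm_apply]
  refine Prod.ext ?_ ?_
  · simp [Prod.fst_sum, Matrix.mul_apply]
  · simp [Prod.snd_sum, Matrix.mul_apply]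

theorem pairMatrix_one {B Ω κ : Type*} [CommRing B] [Field Ω] [Fintype κ] [DecidableEq κ]
    (s : B ≃+* Ω × Ω) : pairMatrix s (1, 1) = (1 : Matrix κ κ B) := by
  ext i j
  apply s.injective
  by_cases h : i = j <;> simp [pairMatrix, h, Matrix.one_apply, Prod.one_eq_mk, Prod.zero_eq_mk]

/-- When the stabilizer of `s'(α)` is a torus of dimension `n`, the matrix `α` is invertible. -/
theorem isUnit_of_stabIsTorus [CharZero F] [FiniteDimensional F E] (hσ : ∀ z, σ (σ z) = z)
    {z : E} (hz : σ z = -z) (hz0 : z ≠ 0)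
    (hspan : ∀ y : E, ∃ c d : F, y = algebraMap F E c + d • z) {s : GL (ι ⊕ ι) E}
    {α : Matrix ι ι E} (hs : s.val = sPrime σ α) (hα : α * α.map σ = α.map σ * α)
    (ht : StabIsTorus σ s) : IsUnit α := by
  rw [Matrix.isUnit_iff_isUnit_det, isUnit_iff_ne_zero]
  intro hdet
  have hnil : ∀ X : Matrix ι ι E, X * X = 0 → X * α = α * X.map σ → X = 0 :=
    fun X hX hXα => eq_zero_of_sq_zero_of_intertwines σ hσ hs hα ht hX hXα
  obtain ⟨e, he0, hee, hαe, heα, hσe, hu⟩ := exists_kernel_projection σ hσ hα hnil hdet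
  have hαα : (α.map σ).map σ = α := map_map_involution (σ : E →+* E) hσ α
  have hσαe : α.map σ * e = 0 := by
    have := congrArg (fun M : Matrix ι ι E => M.map σ) hαe
    simp only [Matrix.map_mul, hσe] at this
    rw [this]; ext; simp
  have hσeα : e * α.map σ = 0 := by
    have := congrArg (fun M : Matrix ι ι E => M.map σ) heα
    simp only [Matrix.map_mul, hσe] at this
    rw [this]; ext; simp
  have hβ : (α * α.map σ).map σ = α * α.map σ := by rw [Matrix.map_mul, hαα, hα]
  obtain ⟨γ, hγ⟩ := exists_map_algebraMap_of_fixed σ hz hz0 hspan hβ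
  -- A polynomial in `γ`, read over `E`, is fixed by conjugation and commutes with `α`. It is
  -- therefore an intertwiner, and one of square zero must vanish.
  have hsq : Squarefree (minpoly F γ) := by
    apply squarefree_minpoly_of_no_nilpotent
    intro p hp
    have hmap : ∀ q : Polynomial F, (Polynomial.aeval γ q).map (algebraMap F E) =
        Polynomial.aeval (α * α.map σ) q := fun q => by
      rw [← hγ]
      exact (Polynomial.aeval_algHom_apply (Algebra.ofId F E).mapMatrix γ q).symm
    have h1 : (Polynomial.aeval γ p).map (algebraMap F E) = 0 := by
      apply hnil
      · rw [← Matrix.map_mul, hp]; ext; simp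
      · have h2 : ((Polynomial.aeval γ p).map (algebraMap F E)).map σ =
            (Polynomial.aeval γ p).map (algebraMap F E) := by ext i j; simp
        rw [h2, hmap]
        have hc : Commute α (α * α.map σ) := by
          change α * (α * α.map σ) = α * α.map σ * α
          rw [mul_assoc, ← hα]
        have h3 : Polynomial.aeval (α * α.map σ) p ∈ Subalgebra.centralizer F {α} :=
          Algebra.adjoin_le (S := Subalgebra.centralizer F {α}) (by
            simpa [Set.mem_centralizer_iff] using hc.eq)
            (Polynomial.aeval_mem_adjoin_singleton F _)
        exact ((Subalgebra.mem_centralizer_iff F).1 h3 α rfl).symm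
    ext i j
    have := congrFun (congrFun h1 i) j
    simpa using this
  let τ : E →ₐ[F] AlgebraicClosure F := IsAlgClosed.lift
  have hsep : Squarefree ((minpoly F γ).map (algebraMap F (AlgebraicClosure F))) := by
    have := PerfectField.separable_iff_squarefree.2 hsq
    exact (this.map (f := algebraMap F (AlgebraicClosure F))).squarefree
  have hγ0 : Polynomial.aeval (γ.map (algebraMap F (AlgebraicClosure F)))
      ((minpoly F γ).map (algebraMap F (AlgebraicClosure F))) = 0 := by
    rw [Polynomial.aeval_map_algebraMap]
    have := Polynomial.aeval_algHom_apply (Algebra.ofId F (AlgebraicClosure F)).mapMatrix γ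
      (minpoly F γ)
    rw [minpoly.aeval, map_zero] at this
    exact this
  obtain ⟨P, r, hP, hPr⟩ := exists_diagonalization _ hsep hγ0
  have hmapτ : α.map τ * (α.map σ).map τ = γ.map (algebraMap F (AlgebraicClosure F)) := by
    rw [← Matrix.map_mul, ← hγ]
    ext i j; simp
  have hz1 : ∀ M N : Matrix ι ι E, M * N = 0 → M.map τ * N.map τ = 0 := fun M N h => by
    rw [← Matrix.map_mul, h]; ext; simp
  obtain ⟨j, hj, hj'⟩ := exists_torsion_injection (α.map τ) ((α.map σ).map τ) (e.map τ) P
    (by rw [← Matrix.map_mul, hα, Matrix.map_mul]) (hz1 _ _ hαe) (hz1 _ _ heα) (hz1 _ _ hσαe)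
    (hz1 _ _ hσeα) (by rw [← Matrix.map_mul, hee])
    (fun h => he0 (by
      ext i k
      have := congrFun (congrFun h i) k
      simpa using this))
    (by
      have := hu.map (τ.mapMatrix (m := ι))
      rw [map_add] at this
      exact this)
    (by
      have := hu.map ((σ : E →ₐ[F] E).mapMatrix (m := ι))
      have := this.map (τ.mapMatrix (m := ι))
      rw [map_add, map_add] at this
      have e1 : (σ : E →ₐ[F] E).mapMatrix e = e := hσe
      rw [e1] at this
      exact this)
    hP r (by rw [hmapτ, hPr])
  obtain ⟨φ, -⟩ := ht
  -- Over `Ω ⊗ E ≃ Ω × Ω` an intertwiner of `α` is a pair `(g, g')` with `g α = α g'` and `g' ᾱ = ᾱ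
  -- g`, which is the setting of `exists_torsion_injection`.
  let S : AlgebraicClosure F ⊗[F] E ≃+* AlgebraicClosure F × AlgebraicClosure F :=
    RingEquiv.ofBijective _ (bijective_splitHom_prod σ τ hz hz0 hspan)
  have hS : ∀ b, S b = (splitHom τ b, splitHom τ (conjRing σ _ b)) := fun b => rfl
  have hswap : ∀ p : Matrix ι ι (AlgebraicClosure F) × Matrix ι ι (AlgebraicClosure F),
      (pairMatrix S p).map (conjRing σ _) = pairMatrix S p.swap := fun p => by
    ext i k
    apply S.injective
    have h1 := hS (S.symm (p.1 i k, p.2 i k))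
    rw [RingEquiv.apply_symm_apply] at h1
    simp only [pairMatrix, Matrix.map_apply, Matrix.of_apply, RingEquiv.apply_symm_apply,
      Prod.fst_swap, Prod.snd_swap]
    rw [hS, conjRing_conjRing σ hσ]
    exact Prod.ext (Prod.ext_iff.1 h1).2.symm (Prod.ext_iff.1 h1).1.symm
  have hαpair : α.map (inclRing F (AlgebraicClosure F)) =
      pairMatrix S (α.map τ, (α.map σ).map τ) := by
    ext i k
    apply S.injective
    simp only [pairMatrix, Matrix.of_apply, RingEquiv.apply_symm_apply]
    rw [hS]
    simp
  let g : Option (ι → Bool) → GL ι (AlgebraicClosure F ⊗[F] E) := fun i =>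
    { val := pairMatrix S (j i)
      inv := pairMatrix S (j i)
      val_inv := by
        rw [pairMatrix_mul, ← pairMatrix_one S]
        exact congrArg _ (Prod.ext (hj' i).1 (hj' i).2.1)
      inv_val := by
        rw [pairMatrix_mul, ← pairMatrix_one S]
        exact congrArg _ (Prod.ext (hj' i).1 (hj' i).2.1) }
  have hg : ∀ i, (g i).val * α.map (inclRing F _) =
      α.map (inclRing F _) * (g i).val.map (conjRing σ _) := fun i => by
    simp only [g]
    rw [hswap, hαpair, pairMatrix_mul, pairMatrix_mul]
    exact congrArg _ (Prod.ext (hj' i).2.2.1 (hj' i).2.2.2)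
  let t : Option (ι → Bool) → ι → (AlgebraicClosure F)ˣ := fun i =>
    (φ (AlgebraicClosure F)).symm (stabMk σ hσ hs hα _ (g i) (hg i))
  have hginj : Function.Injective g := fun i k h =>
    hj (pairMatrix_injective S (congrArg Units.val h))
  have htinj : Function.Injective t := fun i k h => by
    have h1 := (φ (AlgebraicClosure F)).symm.injective h
    have h2 := congrArg (fun q => q.1.1) h1
    exact hginj h2
  have ht2 : ∀ i k, t i k = 1 ∨ t i k = -1 := fun i k => by
    have h1 : t i * t i = 1 := by
      simp only [t]
      rw [← map_mul, MulEquiv.map_eq_one_iff]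
      have hgg : g i * g i = 1 := Units.ext (g i).val_inv
      refine Subtype.ext (Prod.ext hgg ?_)
      change Matrix.GeneralLinearGroup.map _ (g i) * Matrix.GeneralLinearGroup.map _ (g i) = 1
      rw [← map_mul, hgg, map_one]
    have h2 : (t i k : AlgebraicClosure F) * t i k = 1 := by
      rw [← Units.val_mul]
      exact congrArg Units.val (congrFun h1 k)
    rcases mul_self_eq_one_iff.1 h2 with h | h
    · exact Or.inl (Units.ext h)
    · exact Or.inr (Units.ext (by simpa using h))
  -- An element of order at most two has torus coordinates `±1`, leaving at most `2ⁿ` of them. The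
  -- family at hand has `2ⁿ + 1` members.
  have hfin : Function.Injective fun i : Option (ι → Bool) =>
      (fun k => by classical exact decide (t i k = 1) : ι → Bool) := by
    intro i i' h
    apply htinj
    funext k
    have h1 := congrFun h k
    simp only [decide_eq_decide] at h1
    rcases ht2 i k with h2 | h2
    · rw [h2, h1.1 h2]
    · rcases ht2 i' k with h3 | h3
      · rw [h3, h1.2 h3]
      · rw [h2, h3]
  have := Fintype.card_le_of_injective _ hfin
  rw [Fintype.card_option] at this
  omega

end Invertible

/-! ## Block matrices and the Levi subgroup -/

section Levi

variable {a b R : Type*} [Fintype a] [DecidableEq a] [Fintype b] [DecidableEq b] [CommRing R]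

theorem levi_val (m : GL (a ⊕ a) R × GL (b ⊕ b) R) :
    (levi m).val = Matrix.fromBlocks
      (Matrix.fromBlocks m.1.val.toBlocks₁₁ 0 0 m.2.val.toBlocks₁₁)
      (Matrix.fromBlocks m.1.val.toBlocks₁₂ 0 0 m.2.val.toBlocks₁₂)
      (Matrix.fromBlocks m.1.val.toBlocks₂₁ 0 0 m.2.val.toBlocks₂₁)
      (Matrix.fromBlocks m.1.val.toBlocks₂₂ 0 0 m.2.val.toBlocks₂₂) := by
  ext i j
  rcases i with (i | i) | (i | i) <;> rcases j with (j | j) | (j | j) <;> rfl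

theorem levi_injective :
    Function.Injective (levi : GL (a ⊕ a) R × GL (b ⊕ b) R →* GL ((a ⊕ b) ⊕ (a ⊕ b)) R) := by
  intro m m' h
  apply diagGL_injective
  ext i j
  have := congrArg (fun g : GL ((a ⊕ b) ⊕ (a ⊕ b)) R =>
    g.val (Equiv.sumSumSumComm a a b b i) (Equiv.sumSumSumComm a a b b j)) h
  rcases i with (i | i) | (i | i) <;> rcases j with (j | j) | (j | j) <;> exact this

theorem exists_diagGL_of_blocks_eq_zero {κ κ' k : Type*} [Fintype κ] [DecidableEq κ] [Fintype κ']
    [DecidableEq κ'] [Field k] (g : GL (κ ⊕ κ') k) (h12 : g.val.toBlocks₁₂ = 0)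
    (h21 : g.val.toBlocks₂₁ = 0) : ∃ m : GL κ k × GL κ' k, diagGL m = g := by
  have hg : g.val = Matrix.fromBlocks g.val.toBlocks₁₁ 0 0 g.val.toBlocks₂₂ := by
    conv_lhs => rw [← Matrix.fromBlocks_toBlocks g.val, h12, h21]
  have hdet : IsUnit g.val.det := (Matrix.isUnit_iff_isUnit_det _).1 g.isUnit
  rw [hg, Matrix.det_fromBlocks_zero₂₁, IsUnit.mul_iff] at hdet
  refine ⟨(Matrix.GeneralLinearGroup.mk'' _ hdet.1, Matrix.GeneralLinearGroup.mk'' _ hdet.2),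
    Units.ext hg.symm⟩

end Levi

/-! ### Conjugation and intertwiners on the Levi subgroup -/

section LeviGalois

variable {F E : Type*} [Field F] [Field E] [Algebra F E] (σ : E ≃ₐ[F] E)
  {a b : Type*} [Fintype a] [DecidableEq a] [Fintype b] [DecidableEq b]

theorem conjGL_levi (m : GL (a ⊕ a) E × GL (b ⊕ b) E) :
    conjGL σ (levi m) = levi (conjGL σ m.1, conjGL σ m.2) := by
  ext i j
  rcases i with (i | i) | (i | i) <;> rcases j with (j | j) | (j | j) <;>
    first | rfl | exact map_zero σ

theorem toSymm_levi (x : GL (a ⊕ a) E × GL (b ⊕ b) E) :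
    toSymm σ (levi x) = levi (toSymm σ x.1, toSymm σ x.2) := by
  unfold toSymm
  rw [conjGL_levi, ← map_inv, ← map_mul]; rfl

/-- This puts `levi x` into the form `s'(α)` with `α = diag(α₁, α₂)`, so that the results on a
single `α` apply to it. -/
theorem levi_val_sPrime {s : GL (a ⊕ a) E × GL (b ⊕ b) E} {α₁ : Matrix a a E} {α₂ : Matrix b b E}
    (h1 : s.1.val = sPrime σ α₁) (h2 : s.2.val = sPrime σ α₂) :
    (levi s).val = sPrime σ (Matrix.fromBlocks α₁ 0 0 α₂) := by
  have h0 : (Matrix.fromBlocks α₁ 0 0 α₂).map σ =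
      Matrix.fromBlocks (α₁.map σ) 0 0 (α₂.map σ) := by
    rw [Matrix.fromBlocks_map]; congr 1 <;> ext <;> simp
  rw [levi_val, h1, h2]
  unfold sPrime
  rw [h0, Matrix.fromBlocks_multiply]
  simp only [Matrix.toBlocks_fromBlocks₁₁, Matrix.toBlocks_fromBlocks₁₂,
    Matrix.toBlocks_fromBlocks₂₁, Matrix.toBlocks_fromBlocks₂₂, Matrix.fromBlocks_neg]
  congr 1
  · exact Matrix.fromBlocks_one
  · rw [← Matrix.fromBlocks_one]
    ext (i | i) (j | j) <;> simp [Matrix.one_apply]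
  · simp

theorem exists_extGL_of_conjGL_eq [CharZero F] {z : E} (hz : σ z = -z) (hz0 : z ≠ 0)
    (hspan : ∀ y : E, ∃ c d : F, y = algebraMap F E c + d • z) {κ : Type*} [Fintype κ]
    [DecidableEq κ] {g : GL κ E} (hg : conjGL σ g = g) : ∃ g' : GL κ F, extGL F E g' = g := by
  obtain ⟨N, hN⟩ := exists_map_algebraMap_of_fixed σ hz hz0 hspan (M := g.val)
    (congrArg Units.val hg)
  have hdet : IsUnit N.det := by
    rw [isUnit_iff_ne_zero]
    intro h
    have h1 : IsUnit g.val.det := (Matrix.isUnit_iff_isUnit_det _).1 g.isUnit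
    rw [← hN, ← RingHom.mapMatrix_apply, ← RingHom.map_det, h, map_zero] at h1
    exact not_isUnit_zero h1
  exact ⟨Matrix.GeneralLinearGroup.mk'' N hdet, Units.ext hN⟩

/-- In the absence of nilpotent intertwiners, intertwiners of `diag(α₁, α₂)` are block diagonal. -/
theorem blocks_eq_zero_of_intertwines {α₁ : Matrix a a E} {α₂ : Matrix b b E}
    (hnil : ∀ X : Matrix (a ⊕ b) (a ⊕ b) E, X * X = 0 →
      X * Matrix.fromBlocks α₁ 0 0 α₂ = Matrix.fromBlocks α₁ 0 0 α₂ * X.map σ → X = 0) :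
    (∀ Y : Matrix a b E, Y * α₂ = α₁ * Y.map σ → Y = 0) ∧
      ∀ Y : Matrix b a E, Y * α₁ = α₂ * Y.map σ → Y = 0 := by
  constructor
  · intro Y hY
    -- A matrix with a single off-diagonal block has square zero, so an intertwiner of that shape
    -- vanishes.
    have h := hnil (Matrix.fromBlocks 0 Y 0 0) (by simp [Matrix.fromBlocks_multiply]) (by
      rw [Matrix.fromBlocks_map, Matrix.fromBlocks_multiply, Matrix.fromBlocks_multiply]
      congr 1 <;> simp [hY])
    rw [← Matrix.fromBlocks_zero, Matrix.fromBlocks_inj] at h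
    exact h.2.1
  · intro Y hY
    have h := hnil (Matrix.fromBlocks 0 0 Y 0) (by simp [Matrix.fromBlocks_multiply]) (by
      rw [Matrix.fromBlocks_map, Matrix.fromBlocks_multiply, Matrix.fromBlocks_multiply]
      congr 1 <;> simp [hY])
    rw [← Matrix.fromBlocks_zero, Matrix.fromBlocks_inj] at h
    exact h.2.2.1

end LeviGalois

/-! ### Equality of the two stabilizers -/

section StabilizersCoincide

variable {F E : Type*} [NontriviallyNormedField F] [NontriviallyNormedField E]
  [NormedAlgebra F E] [CharZero F] (σ : E ≃ₐ[F] E)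
  {a b : Type*} [Fintype a] [DecidableEq a] [Fintype b] [DecidableEq b]

/-- The stabilizers of `x` in `H' × H''` and in its Levi subgroup coincide. -/
theorem stabIncl_surjective (hσ : ∀ z, σ (σ z) = z) {z : E} (hz : σ z = -z) (hz0 : z ≠ 0)
    (hspan : ∀ y : E, ∃ c d : F, y = algebraMap F E c + d • z)
    {x : GL (a ⊕ a) E × GL (b ⊕ b) E} {α₁ : Matrix a a E} {α₂ : Matrix b b E}
    (hs : (toSymm σ (levi x)).val = sPrime σ (Matrix.fromBlocks α₁ 0 0 α₂))
    (hα : Matrix.fromBlocks α₁ 0 0 α₂ * (Matrix.fromBlocks α₁ 0 0 α₂).map σ =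
      (Matrix.fromBlocks α₁ 0 0 α₂).map σ * Matrix.fromBlocks α₁ 0 0 α₂)
    (hnil : ∀ X : Matrix (a ⊕ b) (a ⊕ b) E, X * X = 0 →
      X * Matrix.fromBlocks α₁ 0 0 α₂ = Matrix.fromBlocks α₁ 0 0 α₂ * X.map σ → X = 0) :
    Function.Surjective (stabIncl F x) := by
  rintro ⟨p, hp⟩
  obtain ⟨h12, h21⟩ := blocks_eq_zero_of_intertwines σ hnil
  obtain ⟨hp2, hp1⟩ := intertwines_of_diagGL_mul σ hσ hs hα (diagGL_mul_toSymm_of_mem σ hp)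
  have hdiag : p.1.1.val.toBlocks₁₂ = 0 ∧ p.1.1.val.toBlocks₂₁ = 0 := by
    have h1 := hp1
    conv at h1 => rw [← Matrix.fromBlocks_toBlocks p.1.1.val]
    rw [Matrix.fromBlocks_map, Matrix.fromBlocks_multiply, Matrix.fromBlocks_multiply,
      Matrix.fromBlocks_inj] at h1
    exact ⟨h12 _ (by simpa using h1.2.1), h21 _ (by simpa using h1.2.2.1)⟩
  obtain ⟨m1, hm1⟩ := exists_diagGL_of_blocks_eq_zero p.1.1 hdiag.1 hdiag.2
  obtain ⟨m2, hm2⟩ := exists_diagGL_of_blocks_eq_zero p.1.2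
    (by
      rw [hp2]; ext i j
      exact (congrArg σ (congrFun (congrFun hdiag.1 i) j)).trans (map_zero σ))
    (by
      rw [hp2]; ext i j
      exact (congrArg σ (congrFun (congrFun hdiag.2 i) j)).trans (map_zero σ))
  let m : (GL a E × GL a E) × (GL b E × GL b E) := ((m1.1, m2.1), (m1.2, m2.2))
  have hm : embH E a b m = p.1 := Prod.ext hm1 hm2
  have hx : (diagGL p.1)⁻¹ * levi x * extGL F E p.2 = levi x := hp
  -- With the `H'`-component already in the Levi subgroup, the `H''`-component is `x⁻¹ m x`. It lies
  -- in `L(E)` and is fixed by conjugation, hence comes from `L(F)`.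
  let y := x⁻¹ * inclHL E a b m * x
  have hy : levi y = extGL F E p.2 := by
    simp only [y]
    rw [map_mul, map_mul, map_inv, levi_inclHL, hm]
    rw [mul_assoc, inv_mul_eq_iff_eq_mul] at hx
    rw [mul_assoc, ← hx]; group
  have hyσ : levi (conjGL σ y.1, conjGL σ y.2) = levi y := by
    rw [← conjGL_levi, hy, conjGL_extGL]
  have hyσ' := levi_injective hyσ
  obtain ⟨k1, hk1⟩ := exists_extGL_of_conjGL_eq σ hz hz0 hspan (Prod.ext_iff.1 hyσ').1
  obtain ⟨k2, hk2⟩ := exists_extGL_of_conjGL_eq σ hz hz0 hspan (Prod.ext_iff.1 hyσ').2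
  have hk : inclLF F E a b (k1, k2) = y := Prod.ext hk1 hk2
  have hk' : levi (k1, k2) = p.2 := by
    apply extGL_injective (E := E)
    rw [← levi_inclLF, hk, hy]
  refine ⟨⟨(m, (k1, k2)), ?_⟩, Subtype.ext (Prod.ext hm hk')⟩
  change (inclHL E a b m)⁻¹ * x * inclLF F E a b (k1, k2) = x
  rw [hk]; simp only [y]; group

end StabilizersCoincide

/-! ## Determinants of Sylvester operators -/

section Sylvester

variable {a b : Type*} [Fintype a] [DecidableEq a] [Fintype b] [DecidableEq b]

/-- The resultant of two characteristic polynomials, as the determinant of `χ_B(A)`. -/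
def sylvesterDet {k : Type*} [CommRing k] (A : Matrix a a k) (B : Matrix b b k) : k :=
  (Polynomial.aeval A B.charpoly).det

theorem sylvesterDet_map {k k' : Type*} [CommRing k] [CommRing k'] (f : k →+* k')
    (A : Matrix a a k) (B : Matrix b b k) :
    sylvesterDet (A.map f) (B.map f) = f (sylvesterDet A B) := by
  unfold sylvesterDet
  rw [RingHom.map_det, Matrix.charpoly_map]
  congr 1
  rw [Polynomial.aeval_def, Polynomial.eval₂_map, Polynomial.aeval_def, Polynomial.hom_eval₂]
  congr 1
  ext c : 1
  ext i j
  by_cases h : i = j <;> simp [h, Matrix.algebraMap_matrix_apply]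

/-- The map `p ↦ det p(A)` is multiplicative. Splitting the characteristic polynomial of `B` into
factors `X - s` reduces the claim to `det(A - s) = ∏ (r - s)`. -/
theorem sylvesterDet_eq_prod {k : Type*} [Field k] [IsAlgClosed k] (A : Matrix a a k)
    (B : Matrix b b k) :
    sylvesterDet A B =
      ((A.charpoly.roots ×ˢ B.charpoly.roots).map fun p => p.1 - p.2).prod := by
  have hB : B.charpoly = (B.charpoly.roots.map fun s => Polynomial.X - Polynomial.C s).prod :=
    (IsAlgClosed.splits B.charpoly).eq_prod_roots_of_monic B.charpoly_monic
  have hA := (IsAlgClosed.splits A.charpoly).eq_prod_roots_of_monic A.charpoly_monic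
  let φ : Polynomial k →* k := Matrix.detMonoidHom.comp (Polynomial.aeval (R := k) A : Polynomial k →* Matrix a a k)
  have h1 : sylvesterDet A B = φ B.charpoly := rfl
  have h2 : ∀ s : k, φ (Polynomial.X - Polynomial.C s) =
      (A.charpoly.roots.map fun r => r - s).prod := fun s => by
    have e1 : φ (Polynomial.X - Polynomial.C s) = (A - Matrix.scalar a s).det := by
      simp [φ]; rfl
    have e2 : A.charpoly.eval s = (Matrix.scalar a s - A).det := Matrix.eval_charpoly A s
    have e3 : A.charpoly.roots.card = Fintype.card a := by
      rw [← (IsAlgClosed.splits A.charpoly).natDegree_eq_card_roots, A.charpoly_natDegree_eq_dim]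
    rw [e1, ← neg_sub, Matrix.det_neg, ← e2]
    conv_lhs => rw [hA]
    rw [Polynomial.eval_multiset_prod, Multiset.map_map, ← e3, ← Multiset.card_map
      (fun r => Polynomial.eval s (Polynomial.X - Polynomial.C r)), ]
    rw [show (Polynomial.eval s ∘ fun r => Polynomial.X - Polynomial.C r) =
      fun r => Polynomial.eval s (Polynomial.X - Polynomial.C r) from rfl, ← Multiset.prod_map_neg,
      Multiset.map_map]
    congr 1
    apply Multiset.map_congr rfl
    intro r _; simp
  rw [h1, hB, map_multiset_prod, Multiset.map_map, ← hB]
  rw [show (⇑φ ∘ fun s => Polynomial.X - Polynomial.C s) =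
    fun s => (A.charpoly.roots.map fun r => r - s).prod from funext h2]
  rw [Multiset.prod_map_prod_map]
  change _ = (Multiset.map _ (Multiset.product _ _)).prod
  simp [Multiset.product, Multiset.map_bind, Multiset.prod_bind]

/-- The determinant form of the resultant shows that `λ'`, defined through eigenvalues in an
algebraic closure, lies in the field of the matrix entries. -/
theorem lambdaPrime_eq {k : Type*} [Field k] (A : Matrix a a k) (B : Matrix b b k) :
    lambdaPrime A B = algebraMap k (AlgebraicClosure k) (sylvesterDet A B)⁻¹ := by
  rw [map_inv₀, ← sylvesterDet_map, sylvesterDet_eq_prod]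
  unfold lambdaPrime
  rw [← Matrix.charpoly_map, ← Matrix.charpoly_map, ← Multiset.prod_map_inv', Multiset.map_map]
  rfl

/-- The operator `X ↦ A X - X B`. -/
def sylvesterMap {k : Type*} [CommRing k] (A : Matrix a a k) (B : Matrix b b k) :
    Matrix a b k →ₗ[k] Matrix a b k where
  toFun X := A * X - X * B
  map_add' X Y := by rw [Matrix.mul_add, Matrix.add_mul]; abel
  map_smul' c X := by simp [smul_sub]

/-- In coordinates the operator is the characteristic matrix of `Bᵀ` with the variable replaced by
`A`. Its blocks are commuting polynomials in `A`, so the determinant can be taken first over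
polynomials and then over the base ring (`Matrix.det_det`). -/
theorem det_sylvesterMap {k : Type*} [CommRing k] (A : Matrix a a k) (B : Matrix b b k) :
    LinearMap.det (sylvesterMap A B) = sylvesterDet A B := by
  have h := Matrix.det_det (M := Matrix.charmatrix B.transpose)
    (f := (Polynomial.aeval A : Polynomial k →ₐ[k] Matrix a a k).toRingHom)
  have h1 : (Matrix.charmatrix B.transpose).det = B.charpoly := Matrix.charpoly_transpose B
  rw [h1] at h
  refine Eq.trans ?_ h.symm
  let e : Matrix a b k ≃ₗ[k] (b × a → k) :=
    { toFun := fun X p => X p.2 p.1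
      invFun := fun v => Matrix.of fun i j => v (j, i)
      map_add' := fun _ _ => rfl
      map_smul' := fun _ _ => rfl
      left_inv := fun _ => rfl
      right_inv := fun _ => rfl }
  rw [← LinearMap.det_conj _ e, ← LinearMap.det_toLin']
  congr 1
  refine LinearMap.ext fun v => funext fun p => ?_
  obtain ⟨j, i⟩ := p
  have hM : ∀ l m, (Matrix.comp b b a a k (B.transpose.charmatrix.map
      (Polynomial.aeval A : Polynomial k →ₐ[k] Matrix a a k).toRingHom)) (j, i) (l, m) =
      (if j = l then A i m else 0) - (if i = m then B l j else 0) := fun l m => by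
    by_cases hjl : j = l
    · subst hjl
      by_cases him : i = m <;>
        simp [Matrix.charmatrix_apply_eq, Matrix.algebraMap_matrix_apply, him]
    · by_cases him : i = m <;>
        simp [Matrix.charmatrix_apply_ne _ _ _ (Ne.symm hjl), Matrix.algebraMap_matrix_apply, him, hjl]
  simp only [LinearMap.comp_apply, LinearEquiv.coe_coe, Matrix.toLin'_apply, Matrix.mulVec,
    dotProduct, Fintype.sum_prod_type, hM, sub_mul, Finset.sum_sub_distrib]
  change ∑ m, A i m * v (j, m) - ∑ l, v (l, i) * B l j = _
  congr 1
  · rw [Finset.sum_comm]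
    apply Finset.sum_congr rfl
    intro m _
    simp
  · apply Finset.sum_congr rfl
    intro m _
    simp [mul_comm]

end Sylvester

/-! ### The twisted Sylvester operator -/

section TwistedSylvester

variable {F E : Type*} [Field F] [Field E] [Algebra F E] (σ : E ≃ₐ[F] E)
  {a b : Type*} [Fintype a] [DecidableEq a] [Fintype b] [DecidableEq b]

/-- The semilinear operator `X ↦ X̄ C + A X`. -/
def twistedSylvester (A : Matrix a a E) (C : Matrix b b E) : Matrix a b E →ₗ[F] Matrix a b E where
  toFun X := X.map σ * C + A * X
  map_add' X Y := by
    rw [Matrix.map_add _ (map_add σ), Matrix.add_mul, Matrix.mul_add]; abel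
  map_smul' c X := by
    have : (c • X).map σ = c • X.map σ := by
      ext i j; simp [Algebra.smul_def]
    rw [this]; simp

theorem twistedSylvester_apply (A : Matrix a a E) (C : Matrix b b E) (X : Matrix a b E) :
    twistedSylvester σ A C X = X.map σ * C + A * X := rfl

/-- The `F`-linear operator of right multiplication. -/
def mulRightOp (F : Type*) {E : Type*} [Field F] [Field E] [Algebra F E] {a b : Type*}
    [Fintype a] [Fintype b] (C : Matrix b b E) : Matrix a b E →ₗ[F] Matrix a b E where
  toFun X := X * C
  map_add' X Y := Matrix.add_mul X Y C
  map_smul' c X := by simp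

/-- The `F`-linear operator `X ↦ z X̄`. -/
def smulConjOp (z : E) : Matrix a b E →ₗ[F] Matrix a b E where
  toFun X := z • X.map σ
  map_add' X Y := by rw [Matrix.map_add _ (map_add σ), smul_add]
  map_smul' c X := by
    ext i j; simp [Algebra.smul_def]; ring

theorem linearMap_det_ne_zero_of_comp_eq {k V : Type*} [Field k] [AddCommGroup V] [Module k V]
    {f g : V →ₗ[k] V} (h : f ∘ₗ g = LinearMap.id) : LinearMap.det f ≠ 0 := by
  intro h0
  have := congrArg LinearMap.det h
  rw [LinearMap.det_comp, h0, zero_mul, LinearMap.det_id] at this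
  exact zero_ne_one this

/-- Let `T₁ X = X̄ ᾱ₂ - ᾱ₁ X`, `T₂ X = X̄ ᾱ₂ + α₁ X` and `T₃ X = X̄ α₂ + α₁ X`. Right multiplication
by the invertible `α₂` conjugates `T₂` to `T₃`, and `X ↦ z X̄` conjugates `T₁` to `-T₃`, so all
three have the same determinant. On the other hand `T₁ T₂` is minus the Sylvester operator of `α₁ᾱ₁`
and `α₂ᾱ₂`. Only squares are compared, which is enough for absolute values. -/
theorem det_twistedSylvester_sq (hσ : ∀ z, σ (σ z) = z) (hdeg : Module.finrank F E = 2)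
    {z : E} (hz : σ z = -z) (hz0 : z ≠ 0) {α₁ : Matrix a a E} {α₂ : Matrix b b E}
    (hα₁ : α₁ * α₁.map σ = α₁.map σ * α₁) (hα₂ : α₂ * α₂.map σ = α₂.map σ * α₂)
    (hu : IsUnit α₂) {γ₁ : Matrix a a F} {γ₂ : Matrix b b F}
    (hγ₁ : γ₁.map (algebraMap F E) = α₁ * α₁.map σ)
    (hγ₂ : γ₂.map (algebraMap F E) = α₂ * α₂.map σ) :
    LinearMap.det (twistedSylvester σ (-α₁.map σ) (α₂.map σ) : Matrix a b E →ₗ[F] Matrix a b E)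
      ^ 2 = sylvesterDet γ₁ γ₂ ^ 2 := by
  have : FiniteDimensional F E := Module.finite_of_finrank_pos (by omega)
  have hm2 : (α₂.map σ).map σ = α₂ := by ext i j; simp [hσ]
  let T₁ : Matrix a b E →ₗ[F] Matrix a b E := twistedSylvester σ (-α₁.map σ) (α₂.map σ)
  let T₂ : Matrix a b E →ₗ[F] Matrix a b E := twistedSylvester σ α₁ (α₂.map σ)
  let T₃ : Matrix a b E →ₗ[F] Matrix a b E := twistedSylvester σ α₁ α₂
  let R : Matrix a b E →ₗ[F] Matrix a b E := mulRightOp F α₂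
  let Q : Matrix a b E →ₗ[F] Matrix a b E := smulConjOp σ z
  have hfin : Module.finrank F (Matrix a b E) = 2 * (Fintype.card a * Fintype.card b) := by
    rw [Module.finrank_matrix, hdeg, mul_comm]
  have hR : LinearMap.det R ≠ 0 := by
    obtain ⟨u, rfl⟩ := hu
    apply linearMap_det_ne_zero_of_comp_eq (g := mulRightOp F (u⁻¹.val))
    ext1 X
    change X * u⁻¹.val * u.val = X
    rw [Matrix.mul_assoc]; simp
  have hQ : LinearMap.det Q ≠ 0 := by
    apply linearMap_det_ne_zero_of_comp_eq (g := smulConjOp σ (-z⁻¹))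
    ext1 X
    change z • ((-z⁻¹) • X.map σ).map σ = X
    ext i j
    simp [hσ, hz, hz0]
  have e1 : T₃ ∘ₗ R = R ∘ₗ T₂ := by
    ext1 X
    change (X * α₂).map σ * α₂ + α₁ * (X * α₂) = (X.map σ * α₂.map σ + α₁ * X) * α₂
    rw [Matrix.map_mul, Matrix.add_mul, Matrix.mul_assoc, Matrix.mul_assoc]
  have e2 : T₃ ∘ₗ Q = -(Q ∘ₗ T₁) := by
    ext1 X
    change (z • X.map σ).map σ * α₂ + α₁ * (z • X.map σ) =
      -(z • (X.map σ * α₂.map σ + -α₁.map σ * X).map σ)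
    have h1 : (z • X.map σ).map σ = -(z • X) := by ext i j; simp [hz, hσ]
    have h2 : (X.map σ * α₂.map σ + -α₁.map σ * X).map σ = X * α₂ - α₁ * X.map σ := by
      rw [Matrix.map_add _ (map_add σ), Matrix.map_mul, Matrix.map_mul, hm2,
        show (X.map σ).map σ = X by ext i j; simp [hσ],
        show (-α₁.map σ).map σ = -α₁ by ext i j; simp [hσ], Matrix.neg_mul, sub_eq_add_neg]
    rw [h1, h2]
    rw [smul_sub, Matrix.mul_smul, Matrix.neg_mul, Matrix.smul_mul]
    abel
  have d1 : LinearMap.det T₃ = LinearMap.det T₂ := by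
    have := congrArg LinearMap.det e1
    rw [LinearMap.det_comp, LinearMap.det_comp, mul_comm] at this
    exact mul_left_cancel₀ hR this
  -- The sign in `e2` is harmless, the space having even dimension over `F`.
  have d2 : LinearMap.det T₃ = LinearMap.det T₁ := by
    have := congrArg LinearMap.det e2
    rw [← neg_one_smul F, LinearMap.det_smul, hfin, pow_mul, neg_one_sq, one_pow, one_mul,
      LinearMap.det_comp, LinearMap.det_comp, mul_comm] at this
    exact mul_left_cancel₀ hQ this
  have e3 : T₁ ∘ₗ T₂ = ((-1 : E) • sylvesterMap (α₁ * α₁.map σ) (α₂ * α₂.map σ)).restrictScalars F := by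
    ext1 X
    change (X.map σ * α₂.map σ + α₁ * X).map σ * α₂.map σ +
      -α₁.map σ * (X.map σ * α₂.map σ + α₁ * X) =
      (-1 : E) • (α₁ * α₁.map σ * X - X * (α₂ * α₂.map σ))
    rw [Matrix.map_add _ (map_add σ), Matrix.map_mul, Matrix.map_mul, hm2,
      show (X.map σ).map σ = X by ext i j; simp [hσ], hα₁]
    simp only [Matrix.add_mul, Matrix.mul_add, Matrix.mul_assoc, Matrix.neg_mul]
    rw [neg_one_smul]
    abel
  -- The determinant over `F` of an `E`-linear operator is the norm of its determinant over `E`.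
  -- That determinant comes from `F` here, so its norm is its square.
  have d3 := congrArg LinearMap.det e3
  rw [LinearMap.det_comp, LinearMap.det_restrictScalars, LinearMap.det_smul, det_sylvesterMap,
    ← d1, d2, ← hγ₁, ← hγ₂, sylvesterDet_map, ← map_one (algebraMap F E), ← map_neg, ← map_pow,
    ← map_mul (algebraMap F E), Algebra.norm_algebraMap, hdeg, mul_pow, ← pow_mul, mul_comm _ 2, pow_mul, neg_one_sq,
    one_pow, one_mul, ← pow_two] at d3
  exact d3

end TwistedSylvester

/-! ## Quadratic extensions -/

section Quadratic

variable {F E : Type*} [Field F] [Field E] [Algebra F E] (σ : E ≃ₐ[F] E)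

theorem involutive_of_finrank_eq_two (hdeg : Module.finrank F E = 2) (z : E) : σ (σ z) = z := by
  have : FiniteDimensional F E := Module.finite_of_finrank_pos (by omega)
  have h1 : orderOf σ ≤ 2 := by
    refine (orderOf_le_card (x := σ)).trans ?_
    rw [Nat.card_eq_fintype_card, ← hdeg]
    exact AlgEquiv.card_le
  have h2 : σ ^ 2 = 1 := by
    have h3 : 0 < orderOf σ := orderOf_pos σ
    have h4 : orderOf σ ∣ 2 := by
      interval_cases h : orderOf σ <;> norm_num
    exact orderOf_dvd_iff_pow_eq_one.1 h4
  have := congrArg (fun τ : E ≃ₐ[F] E => τ z) h2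
  simpa [pow_two] using this

/-- For `y` with `ȳ ≠ y` the element `z = y - ȳ` is anti-invariant and independent of `1`, so `E = F
⊕ Fz`. -/
theorem exists_imaginary [CharZero F] (hdeg : Module.finrank F E = 2)
    (hσ : σ ≠ AlgEquiv.refl) : ∃ z : E, σ z = -z ∧ z ≠ 0 ∧
      ∀ y : E, ∃ c d : F, y = algebraMap F E c + d • z := by
  have hinv := involutive_of_finrank_eq_two σ hdeg
  have hfd : FiniteDimensional F E := Module.finite_of_finrank_pos (by omega)
  have : CharZero E := charZero_of_injective_algebraMap (algebraMap F E).injective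
  obtain ⟨y, hy⟩ : ∃ y, σ y ≠ y := by
    by_contra h
    push Not at h
    exact hσ (AlgEquiv.ext h)
  have hz : σ (y - σ y) = -(y - σ y) := by rw [map_sub, hinv]; ring
  have hz0 : y - σ y ≠ 0 := fun h => hy (sub_eq_zero.1 h).symm
  refine ⟨y - σ y, hz, hz0, ?_⟩
  have hli : LinearIndependent F ![(1 : E), y - σ y] := by
    rw [LinearIndependent.pair_iff]
    intro s t hst
    have h1 := congrArg σ hst
    rw [map_add, Algebra.smul_def, Algebra.smul_def, map_mul, map_mul, AlgEquiv.commutes,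
      AlgEquiv.commutes, hz, map_one, map_zero] at h1
    rw [Algebra.smul_def, Algebra.smul_def] at hst
    have h2 : 2 * algebraMap F E s = 0 := by linear_combination hst + h1
    have h3 : 2 * (algebraMap F E t * (y - σ y)) = 0 := by linear_combination hst - h1
    simp [hz0] at h2 h3
    exact ⟨h2, h3⟩
  have htop := hli.span_eq_top_of_card_eq_finrank (by simp [hdeg])
  intro w
  have hw : w ∈ Submodule.span F (Set.range ![(1 : E), y - σ y]) := htop ▸ Submodule.mem_top
  rw [Matrix.range_cons, Matrix.range_cons, Matrix.range_empty, Set.union_empty,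
    Set.singleton_union, Submodule.mem_span_pair] at hw
  obtain ⟨c, d, rfl⟩ := hw
  exact ⟨c, d, by rw [Algebra.smul_def c, mul_one]⟩

end Quadratic

section Norms

variable {F E : Type*} [NontriviallyNormedField F] [NontriviallyNormedField E]
  [NormedAlgebra F E]

/-- A norm is ultrametric as soon as natural numbers have norm at most one, and these have the same
norm in `F` and in `E`. -/
theorem isUltrametricDist_extension (F E : Type*) [NontriviallyNormedField F]
    [NontriviallyNormedField E] [NormedAlgebra F E] [IsUltrametricDist F] : IsUltrametricDist E := by
  apply IsUltrametricDist.isUltrametricDist_of_forall_norm_natCast_le_one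
  intro n
  rw [← map_natCast (algebraMap F E), norm_algebraMap']
  exact IsUltrametricDist.norm_natCast_le_one F n

end Norms

/-! ## The module of a linear map -/

section Module

theorem properSpace_of_locallyCompact (k : Type*) [NontriviallyNormedField k]
    [LocallyCompactSpace k] : ProperSpace k := ProperSpace.of_locallyCompactSpace k

attribute [local instance] properSpace_of_locallyCompact

variable {k : Type*} [NontriviallyNormedField k] [LocallyCompactSpace k]

theorem normAbs_zero : normAbs k 0 = 0 := by simp [normAbs]

theorem normAbs_pos {c : k} (hc : c ≠ 0) : 0 < normAbs k c := by
  simp only [normAbs, hc, dite_false]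
  exact_mod_cast distribHaarChar_pos

theorem normAbs_nonneg (c : k) : 0 ≤ normAbs k c := by
  by_cases hc : c = 0
  · rw [hc, normAbs_zero]
  · exact (normAbs_pos hc).le

theorem normAbs_mul (c d : k) : normAbs k (c * d) = normAbs k c * normAbs k d := by
  by_cases hc : c = 0
  · simp [hc, normAbs_zero]
  by_cases hd : d = 0
  · simp [hd, normAbs_zero]
  simp only [normAbs, hc, hd, mul_eq_zero, or_self, dite_false]
  rw [← NNReal.coe_mul, ← map_mul]
  congr 2
  ext; simp

theorem normAbs_one : normAbs k 1 = 1 := by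
  have h := normAbs_mul (1 : k) 1
  rw [mul_one] at h
  have := normAbs_pos (one_ne_zero (α := k))
  nlinarith [mul_left_cancel₀ this.ne' (h.symm.trans (mul_one _).symm)]

/-- The normalized absolute value as a homomorphism. -/
def normAbsHom (k : Type*) [NontriviallyNormedField k] [LocallyCompactSpace k] : k →*₀ ℝ where
  toFun := normAbs k
  map_zero' := normAbs_zero
  map_one' := normAbs_one
  map_mul' := normAbs_mul

theorem normAbs_pow (c : k) (n : ℕ) : normAbs k (c ^ n) = normAbs k c ^ n :=
  map_pow (normAbsHom k) c n

theorem normAbs_inv (c : k) : normAbs k c⁻¹ = (normAbs k c)⁻¹ := map_inv₀ (normAbsHom k) c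

theorem normAbs_prod {ι : Type*} (s : Finset ι) (f : ι → k) :
    normAbs k (∏ i ∈ s, f i) = ∏ i ∈ s, normAbs k (f i) := map_prod (normAbsHom k) f s

theorem normAbs_eq_of_sq_eq {c d : k} (h : c ^ 2 = d ^ 2) : normAbs k c = normAbs k d := by
  have h1 := congrArg (normAbs k) h
  rw [normAbs_pow, normAbs_pow] at h1
  exact (pow_left_inj₀ (normAbs_nonneg c) (normAbs_nonneg d) two_ne_zero).1 h1

open scoped Pointwise in
theorem measure_mul_preimage [MeasurableSpace k] [BorelSpace k] (ν : Measure k)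
    [ν.IsAddHaarMeasure] {c : k} (hc : c ≠ 0) (s : Set k) :
    ENNReal.ofReal (normAbs k c) * ν ((fun x => c * x) ⁻¹' s) = ν s := by
  have h := distribHaarChar_mul ν (Units.mk0 c hc) ((fun x => c * x) ⁻¹' s)
  have h1 : Units.mk0 c hc • ((fun x => c * x) ⁻¹' s) = s := by
    ext x
    rw [Set.mem_smul_set_iff_inv_smul_mem]
    simp [Units.smul_def, hc]
  rw [h1] at h
  rw [← h]
  congr 1
  simp [normAbs, hc]

/-- Multiplication by such a `c` preserves the closed unit ball, whose volume is finite and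
positive. -/
theorem normAbs_eq_one_of_norm_eq_one {c : k} (hc : ‖c‖ = 1) : normAbs k c = 1 := by
  borelize k
  have hc0 : c ≠ 0 := fun h => by simp [h] at hc
  let ν : Measure k := Measure.addHaar
  have h := measure_mul_preimage ν hc0 (Metric.closedBall 0 1)
  have h1 : (fun x => c * x) ⁻¹' (Metric.closedBall 0 1) = Metric.closedBall (0 : k) 1 := by
    ext x; simp [hc]
  rw [h1] at h
  have h2 : ν (Metric.closedBall 0 1) ≠ 0 := (Metric.measure_closedBall_pos ν 0 one_pos).ne'
  have h3 : ν (Metric.closedBall 0 1) ≠ ∞ := (isCompact_closedBall 0 1).measure_lt_top.ne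
  have h4 : ENNReal.ofReal (normAbs k c) = 1 := by
    rw [← ENNReal.mul_left_inj h2 h3, h, one_mul]
  simpa using h4

open Matrix in
-- Reduction to diagonal matrices and transvections. A diagonal matrix scales each coordinate, and a
-- transvection translates one coordinate by a function of the others, so that integrating this
-- coordinate first removes it.
theorem map_toLin'_pi_haar [MeasurableSpace k] [BorelSpace k] {ι : Type*} [Fintype ι] [DecidableEq ι] (ν : Measure k)
    [ν.IsAddHaarMeasure] {M : Matrix ι ι k} (hM : M.det ≠ 0) :
    (Measure.pi fun _ : ι => ν).map (toLin' M) =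
      ENNReal.ofReal (normAbs k M.det)⁻¹ • Measure.pi fun _ : ι => ν := by
  have hmeas : ∀ N : Matrix ι ι k, Measurable (toLin' N) := fun N =>
    (LinearMap.continuous_of_finiteDimensional (toLin' N)).measurable
  apply diagonal_transvection_induction_of_det_ne_zero _ M hM
  · intro D hD
    have hD' := hD
    rw [det_diagonal] at hD'
    have key : ENNReal.ofReal (normAbs k (det (diagonal D))) •
        (Measure.pi fun _ : ι => ν).map (toLin' (diagonal D)) = Measure.pi fun _ : ι => ν := by
      refine (Measure.pi_eq fun s hs => ?_).symm
      simp only [det_diagonal, Measure.coe_smul, smul_eq_mul, Pi.smul_apply]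
      rw [Measure.map_apply (hmeas _) (MeasurableSet.univ_pi hs)]
      have h1 : (toLin' (diagonal D) ⁻¹' Set.pi Set.univ fun i : ι => s i) =
          Set.pi Set.univ fun i : ι => (fun x => D i * x) ⁻¹' s i := by
        ext f
        simp only [LinearMap.coe_proj, smul_eq_mul, LinearMap.smul_apply, Set.mem_univ_pi,
          Set.mem_preimage, LinearMap.pi_apply, diagonal_toLin']
      rw [h1, Measure.pi_pi, normAbs_prod, ENNReal.ofReal_prod_of_nonneg fun i _ => normAbs_nonneg _,
        ← Finset.prod_mul_distrib]
      exact Finset.prod_congr rfl fun i _ =>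
        measure_mul_preimage ν (Finset.prod_ne_zero_iff.1 hD' i (Finset.mem_univ i)) (s i)
    conv_rhs => rw [← key]
    rw [smul_smul, ← ENNReal.ofReal_mul (inv_nonneg.2 (normAbs_nonneg _)),
      inv_mul_cancel₀ (normAbs_pos hD).ne', ENNReal.ofReal_one, one_smul]
  · intro t
    rw [Matrix.TransvectionStruct.det, normAbs_one, inv_one, ENNReal.ofReal_one, one_smul]
    refine (Measure.pi_eq fun s hs ↦ ?_).symm
    have h2s : MeasurableSet (Set.univ.pi s) := .pi Set.countable_univ fun i _ ↦ hs i
    rw [← Measure.pi_pi (fun _ : ι => ν)]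
    simp_rw [← lintegral_indicator_one h2s]
    rw [lintegral_map (measurable_one.indicator h2s) (hmeas _)]
    refine lintegral_eq_of_lmarginal_eq {t.i} ((measurable_one.indicator h2s).comp (hmeas _))
      (measurable_one.indicator h2s) ?_
    simp_rw [lmarginal_singleton]
    ext x
    cases t with | mk t_i t_j t_hij t_c =>
    simp [transvection, single_mulVec, t_hij.symm, ← Function.update_add,
      lintegral_add_right_eq_self fun xᵢ ↦
        Set.indicator (Set.univ.pi s) 1 (Function.update x t_i xᵢ)]
  · intro A B _ _ IHA IHB
    rw [toLin'_mul, det_mul, LinearMap.coe_comp, ← Measure.map_map (hmeas _) (hmeas _), IHB,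
      Measure.map_smul, IHA, smul_smul,
      ← ENNReal.ofReal_mul (inv_nonneg.2 (normAbs_nonneg _)), normAbs_mul, mul_comm, mul_inv]

/-- A linear automorphism scales Haar measures by the normalized absolute value of its
determinant. -/
theorem map_linearMap_haar {V : Type*} [AddCommGroup V] [Module k V] [TopologicalSpace V]
    [IsTopologicalAddGroup V] [ContinuousSMul k V] [T2Space V] [FiniteDimensional k V]
    [MeasurableSpace V] [BorelSpace V] (μ : Measure V) [μ.IsAddHaarMeasure] (T : V →ₗ[k] V)
    (hT : LinearMap.det T ≠ 0) :
    μ.map T = ENNReal.ofReal (normAbs k (LinearMap.det T))⁻¹ • μ := by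
  borelize k
  let B := Module.finBasis k V
  let e : V ≃L[k] (Fin (Module.finrank k V) → k) := B.equivFun.toContinuousLinearEquiv
  have : LocallyCompactSpace V := e.toHomeomorph.isClosedEmbedding.locallyCompactSpace
  let ν : Measure k := Measure.addHaar
  let π : Measure (Fin (Module.finrank k V) → k) := Measure.pi fun _ => ν
  have hH : (μ.map e).IsAddHaarMeasure := e.isAddHaarMeasure_map μ
  obtain ⟨c, hc⟩ : ∃ c : NNReal, μ.map e = c • π := ⟨_, Measure.isAddLeftInvariant_eq_smul _ _⟩
  let M := LinearMap.toMatrix B B T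
  have hM : M.det = LinearMap.det T := LinearMap.det_toMatrix B T
  have h1 := map_toLin'_pi_haar ν (M := M) (by rw [hM]; exact hT)
  have hTm : Measurable T := (LinearMap.continuous_of_finiteDimensional T).measurable
  have hMm : Measurable (Matrix.toLin' M) :=
    (LinearMap.continuous_of_finiteDimensional (Matrix.toLin' M)).measurable
  have hem : Measurable e := e.continuous.measurable
  have hsm : Measurable e.symm := e.symm.continuous.measurable
  have hcomm : ∀ v, e (T v) = Matrix.toLin' M (e v) := fun v => by
    simp [e, M, LinearMap.toMatrix_mulVec_repr, Matrix.toLin'_apply]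
  have h2 : (μ.map T).map e = ENNReal.ofReal (normAbs k (LinearMap.det T))⁻¹ • μ.map e := by
    rw [Measure.map_map hem hTm, show e ∘ T = Matrix.toLin' M ∘ e from funext hcomm,
      ← Measure.map_map hMm hem, hc, Measure.map_smul, h1, hM, smul_comm]
  have h3 := congrArg (Measure.map e.symm) h2
  rw [Measure.map_map hsm hem, Measure.map_smul, Measure.map_map hsm hem] at h3
  have : (e.symm : _ → V) ∘ e = id := funext fun v => e.symm_apply_apply v
  rwa [this, Measure.map_id, Measure.map_id] at h3

end Module

/-! ## Haar measures on spaces of matrices -/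

/-- The Borel σ-algebra on a space of matrices. -/
@[reducible] def matrixBorel (m n k : Type*) [TopologicalSpace k] : MeasurableSpace (Matrix m n k) :=
  borel _

theorem matrixBorel_borelSpace (m n k : Type*) [TopologicalSpace k] :
    @BorelSpace (Matrix m n k) _ (matrixBorel m n k) :=
  @BorelSpace.mk _ _ (matrixBorel m n k) rfl

theorem matrix_secondCountable (m n k : Type*) [Countable m] [Countable n] [TopologicalSpace k]
    [SecondCountableTopology k] : SecondCountableTopology (Matrix m n k) :=
  inferInstanceAs (SecondCountableTopology (m → n → k))

section MatrixHaar

attribute [local instance] properSpace_of_locallyCompact matrixBorel matrixBorel_borelSpace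
  matrix_secondCountable

variable {k : Type*} [NontriviallyNormedField k] [LocallyCompactSpace k]
  {m n : Type*} [Fintype m] [Fintype n]

/-- The matrices with entries of norm at most one. -/
def unitCube (m n k : Type*) [NontriviallyNormedField k] : Set (Matrix m n k) :=
  {w | ∀ i j, ‖w i j‖ ≤ 1}

theorem unitCube_eq_pi :
    unitCube m n k = Set.pi Set.univ fun _ => Set.pi Set.univ fun _ => Metric.closedBall 0 1 := by
  ext w
  constructor
  · intro h i _ j _
    simpa using h i j
  · intro h i j
    simpa using h i trivial j trivial

theorem isCompact_unitCube : IsCompact (unitCube m n k) := by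
  rw [unitCube_eq_pi]
  exact isCompact_univ_pi fun _ => isCompact_univ_pi fun _ => isCompact_closedBall 0 1

theorem unitCube_mem_nhds : unitCube m n k ∈ nhds (0 : Matrix m n k) := by
  rw [unitCube_eq_pi]
  exact set_pi_mem_nhds Set.finite_univ fun _ _ => set_pi_mem_nhds Set.finite_univ fun _ _ =>
    Metric.closedBall_mem_nhds 0 one_pos

theorem measure_unitCube_pos (μ : Measure (Matrix m n k)) [μ.IsAddHaarMeasure] :
    μ (unitCube m n k) ≠ 0 :=
  (Measure.measure_pos_of_mem_nhds μ unitCube_mem_nhds).ne'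

theorem measure_unitCube_lt_top (μ : Measure (Matrix m n k)) [μ.IsAddHaarMeasure] :
    μ (unitCube m n k) ≠ ∞ :=
  isCompact_unitCube.measure_lt_top.ne

theorem matHaar_unitCube : matHaar m n k 1 (unitCube m n k) = 1 := by
  rw [matHaar, Measure.smul_apply, one_mul, smul_eq_mul]
  exact ENNReal.inv_mul_cancel (measure_unitCube_pos _) (measure_unitCube_lt_top _)

theorem matHaar_isAddHaar : (matHaar m n k 1).IsAddHaarMeasure := by
  rw [matHaar, one_mul]
  exact Measure.IsAddHaarMeasure.smul _
    (ENNReal.inv_ne_zero.2 (measure_unitCube_lt_top (Measure.addHaar : Measure (Matrix m n k))))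
    (ENNReal.inv_ne_top.2 (measure_unitCube_pos (Measure.addHaar : Measure (Matrix m n k))))

theorem matHaar_eq_smul (c : ℝ≥0∞) : matHaar m n k c = c • matHaar m n k 1 := by
  rw [matHaar, matHaar, one_mul, mul_smul]

attribute [local instance] matHaar_isAddHaar

/-- A homeomorphic isomorphism that matches sets of finite positive volume matches
Haar measures. -/
theorem map_haar_eq_of_measure_eq {V W : Type*} [AddCommGroup V] [TopologicalSpace V]
    [IsTopologicalAddGroup V] [MeasurableSpace V] [BorelSpace V] [AddCommGroup W]
    [TopologicalSpace W] [IsTopologicalAddGroup W] [LocallyCompactSpace W]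
    [SecondCountableTopology W] [MeasurableSpace W] [BorelSpace W] (e : V ≃+ W)
    (he : Continuous e) (hes : Continuous e.symm) (μ : Measure V) [μ.IsAddHaarMeasure]
    (ν : Measure W) [ν.IsAddHaarMeasure] (K : Set W) (hK : MeasurableSet K) (h0 : ν K ≠ 0)
    (h1 : ν K ≠ ∞) (h : μ (e ⁻¹' K) = ν K) : μ.map e = ν := by
  have hH : (μ.map e).IsAddHaarMeasure := e.isAddHaarMeasure_map μ he hes
  obtain ⟨c, hc⟩ : ∃ c : NNReal, μ.map e = c • ν := ⟨_, Measure.isAddLeftInvariant_eq_smul _ _⟩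
  have h2 := congrArg (fun ξ => ξ K) hc
  simp only [Measure.map_apply he.measurable hK, h, Measure.smul_apply] at h2
  have h3 : (c : ℝ≥0∞) = 1 := by
    rw [← ENNReal.mul_left_inj h0 h1, one_mul]
    exact h2.symm
  rw [hc, ENNReal.coe_eq_one.1 h3, one_smul]

/-- The operator `X ↦ A X C`. -/
def mulMulOp {k : Type*} [CommRing k] (A : Matrix m m k) (C : Matrix n n k) :
    Matrix m n k →ₗ[k] Matrix m n k where
  toFun X := A * X * C
  map_add' X Y := by rw [Matrix.mul_add, Matrix.add_mul]
  map_smul' c X := by simp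

theorem det_mulMulOp [DecidableEq m] [DecidableEq n] {k : Type*} [CommRing k] (A : Matrix m m k)
    (C : Matrix n n k) :
    LinearMap.det (mulMulOp A C) = A.det ^ Fintype.card n * C.det ^ Fintype.card m := by
  rw [← Matrix.det_transpose C, ← Matrix.det_kronecker, ← LinearMap.det_toLin']
  let e : Matrix m n k ≃ₗ[k] (m × n → k) :=
    { toFun := fun X p => X p.1 p.2
      invFun := fun v => Matrix.of fun i j => v (i, j)
      map_add' := fun _ _ => rfl
      map_smul' := fun _ _ => rfl
      left_inv := fun _ => rfl
      right_inv := fun _ => rfl }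
  rw [← LinearMap.det_conj _ e]
  congr 1
  refine LinearMap.ext fun v => funext fun p => ?_
  obtain ⟨i, j⟩ := p
  simp only [LinearMap.comp_apply, LinearEquiv.coe_coe, Matrix.toLin'_apply, Matrix.mulVec,
    dotProduct, Fintype.sum_prod_type, Matrix.kroneckerMap_apply, Matrix.transpose_apply]
  change ∑ q, (∑ p, A i p * v (p, q)) * C q j = _
  simp only [Finset.sum_mul]
  rw [Finset.sum_comm]
  exact Finset.sum_congr rfl fun _ _ => Finset.sum_congr rfl fun _ _ => by ring

theorem lintegral_mulMul [DecidableEq m] [DecidableEq n] (μ : Measure (Matrix m n k))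
    [μ.IsAddHaarMeasure] {A : Matrix m m k} {C : Matrix n n k} (hA : A.det ≠ 0) (hC : C.det ≠ 0)
    {Φ : Matrix m n k → ℝ≥0∞} (hΦ : Measurable Φ) :
    ∫⁻ X, Φ (A * X * C) ∂μ =
      ENNReal.ofReal (normAbs k A.det ^ Fintype.card n * normAbs k C.det ^ Fintype.card m)⁻¹ *
        ∫⁻ X, Φ X ∂μ := by
  have hdet : LinearMap.det (mulMulOp A C) ≠ 0 := by
    rw [det_mulMulOp]
    exact mul_ne_zero (pow_ne_zero _ hA) (pow_ne_zero _ hC)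
  have hm : Measurable (mulMulOp A C) :=
    (LinearMap.continuous_of_finiteDimensional (mulMulOp A C)).measurable
  have h := map_linearMap_haar μ (mulMulOp A C) hdet
  have h1 := congrArg (fun ξ => ∫⁻ X, Φ X ∂ξ) h
  simp only [lintegral_map hΦ hm, lintegral_smul_measure] at h1
  rw [det_mulMulOp, normAbs_mul, normAbs_pow, normAbs_pow] at h1
  exact h1

/-- Multiplication by `c` on `E` is `F`-linear of determinant `c²`. Its effect on the volume of the
unit ball is computed once over `E` and once over `F`. -/
theorem normAbs_algebraMap {F E : Type*} [NontriviallyNormedField F] [LocallyCompactSpace F]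
    [NontriviallyNormedField E] [LocallyCompactSpace E] [NormedAlgebra F E]
    (hdeg : Module.finrank F E = 2) (c : F) :
    normAbs E (algebraMap F E c) = normAbs F c ^ 2 := by
  by_cases hc : c = 0
  · simp [hc, normAbs_zero]
  have : FiniteDimensional F E := Module.finite_of_finrank_pos (by omega)
  borelize E
  let ν : Measure E := Measure.addHaar
  let B : Set E := Metric.closedBall 0 1
  let T : E →ₗ[F] E := c • LinearMap.id
  have hdet : LinearMap.det T = c ^ 2 := by
    rw [LinearMap.det_smul, hdeg, LinearMap.det_id, mul_one]
  have hc' : algebraMap F E c ≠ 0 := by simpa using hc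
  have hT : (T : E → E) = fun x => algebraMap F E c * x := by
    ext x; simp [T, Algebra.smul_def]
  have h1 := map_linearMap_haar ν T (by rw [hdet]; exact pow_ne_zero _ hc)
  have h2 := measure_mul_preimage ν hc' B
  have h3 := congrArg (fun ξ => ξ B) h1
  simp only [Measure.smul_apply, smul_eq_mul] at h3
  rw [Measure.map_apply (LinearMap.continuous_of_finiteDimensional T).measurable
    Metric.isClosed_closedBall.measurableSet, hT, hdet, normAbs_pow] at h3
  rw [h3, ← mul_assoc, ← ENNReal.ofReal_mul (normAbs_nonneg _)] at h2
  have hB0 : ν B ≠ 0 := (Metric.measure_closedBall_pos ν 0 one_pos).ne'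
  have hB1 : ν B ≠ ∞ := (isCompact_closedBall 0 1).measure_lt_top.ne
  have h4 : ENNReal.ofReal (normAbs E (algebraMap F E c) * (normAbs F c ^ 2)⁻¹) = 1 := by
    rw [← ENNReal.mul_left_inj hB0 hB1, h2, one_mul]
  rw [ENNReal.ofReal_eq_one] at h4
  have := (normAbs_pos hc).ne'
  field_simp at h4
  exact h4

end MatrixHaar

/-! ## Discriminants -/

section Discriminant

variable {F E : Type*} [Field F] [Field E] [Algebra F E] [CharZero F] (σ : E ≃ₐ[F] E)

theorem algebraMap_trace (hdeg : Module.finrank F E = 2) (hσ : σ ≠ AlgEquiv.refl) (y : E) :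
    algebraMap F E (Algebra.trace F E y) = y + σ y := by
  obtain ⟨z, hz, -, hspan⟩ := exists_imaginary σ hdeg hσ
  have hz0 : Algebra.trace F E z = 0 := by
    have h := Algebra.trace_eq_of_algEquiv σ z
    rw [hz, map_neg] at h
    exact self_eq_neg.1 h.symm
  obtain ⟨c, d, rfl⟩ := hspan y
  have h1 : algebraMap F E (Algebra.trace F E (algebraMap F E c + d • z)) =
      2 * algebraMap F E c := by
    rw [map_add, Algebra.trace_algebraMap, map_smul, hz0, hdeg, smul_zero, add_zero,
      nsmul_eq_mul, map_mul, map_natCast, Nat.cast_ofNat]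
  have h2 : σ (algebraMap F E c + d • z) = algebraMap F E c - d • z := by
    rw [map_add, AlgEquiv.commutes, map_smul, hz, smul_neg, sub_eq_add_neg]
  rw [h1, h2]
  ring

/-- The determinant `ω₀ ω̄₁ - ω₁ ω̄₀`. -/
def basisDet (bE : Module.Basis (Fin 2) F E) : E := bE 0 * σ (bE 1) - bE 1 * σ (bE 0)

theorem basisDet_sq (hdeg : Module.finrank F E = 2) (hσ : σ ≠ AlgEquiv.refl)
    (bE : Module.Basis (Fin 2) F E) :
    algebraMap F E (Algebra.discr F bE) = basisDet σ bE ^ 2 := by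
  rw [Algebra.discr_def, Matrix.det_fin_two]
  simp only [Algebra.traceMatrix_apply, Algebra.traceForm_apply, map_sub, map_mul,
    algebraMap_trace σ hdeg hσ, basisDet]
  ring

theorem det_scalarBlocks {k a : Type*} [Field k] [Fintype a] [DecidableEq a] {p : k} (hp : p ≠ 0)
    (q r s : k) : (Matrix.fromBlocks (p • (1 : Matrix a a k)) (q • (1 : Matrix a a k))
      (r • (1 : Matrix a a k)) (s • (1 : Matrix a a k))).det
      = (p * s - q * r) ^ Fintype.card a := by
  let P : Matrix a a k := p • 1
  letI : Invertible P := ⟨p⁻¹ • 1, by simp [P, hp], by simp [P, hp]⟩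
  have h := Matrix.det_fromBlocks₁₁ P (q • (1 : Matrix a a k)) (r • (1 : Matrix a a k))
    (s • (1 : Matrix a a k))
  have hinv : ⅟P = p⁻¹ • 1 := rfl
  rw [h, hinv]
  have : s • (1 : Matrix a a k) - r • (1 : Matrix a a k) * p⁻¹ • (1 : Matrix a a k) *
      q • (1 : Matrix a a k) = (s - r * p⁻¹ * q) • (1 : Matrix a a k) := by
    simp [sub_smul, smul_smul]
    congr 1; ring
  rw [this]
  simp only [P, Matrix.det_smul, Matrix.det_one, mul_one]
  rw [← mul_pow]
  congr 1
  field_simp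

end Discriminant

/-! ### Haar measure in the coordinates of an integral basis -/

section Jacobian

attribute [local instance] properSpace_of_locallyCompact matrixBorel matrixBorel_borelSpace
  matrix_secondCountable matHaar_isAddHaar

section Blocks

variable {k : Type*} [NontriviallyNormedField k] [LocallyCompactSpace k]
  {m n a b : Type*} [Fintype m] [Fintype n] [Fintype a] [Fintype b]

theorem map_fromCols :
    ((matHaar m a k 1).prod (matHaar m b k 1)).map (fun p => Matrix.fromCols p.1 p.2) =
      matHaar m (a ⊕ b) k 1 := by
  let e : Matrix m a k × Matrix m b k ≃+ Matrix m (a ⊕ b) k :=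
    { toFun := fun p => Matrix.fromCols p.1 p.2
      invFun := fun X => (X.toCols₁, X.toCols₂)
      left_inv := fun p => by simp
      right_inv := fun X => by simp
      map_add' := fun p q => by ext i (j | j) <;> rfl }
  have := Measure.prod.instIsAddHaarMeasure (matHaar m a k 1) (matHaar m b k 1)
  refine map_haar_eq_of_measure_eq e ?_ ?_ _ _ (unitCube m (a ⊕ b) k)
    isCompact_unitCube.measurableSet (measure_unitCube_pos _) (measure_unitCube_lt_top _) ?_
  · refine continuous_matrix fun i j => ?_
    rcases j with j | j
    · exact (continuous_fst.matrix_elem i j)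
    · exact (continuous_snd.matrix_elem i j)
  · exact Continuous.prodMk (continuous_matrix fun i j => continuous_id.matrix_elem i (Sum.inl j))
      (continuous_matrix fun i j => continuous_id.matrix_elem i (Sum.inr j))
  · have : e ⁻¹' unitCube m (a ⊕ b) k = unitCube m a k ×ˢ unitCube m b k := by
      ext p
      simp [unitCube, e, forall_and]
    rw [this, Measure.prod_prod, matHaar_unitCube, matHaar_unitCube, matHaar_unitCube, one_mul]

theorem map_fromRows :
    ((matHaar a n k 1).prod (matHaar b n k 1)).map (fun p => Matrix.fromRows p.1 p.2) =
      matHaar (a ⊕ b) n k 1 := by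
  let e : Matrix a n k × Matrix b n k ≃+ Matrix (a ⊕ b) n k :=
    { toFun := fun p => Matrix.fromRows p.1 p.2
      invFun := fun X => (X.toRows₁, X.toRows₂)
      left_inv := fun p => by simp
      right_inv := fun X => by simp
      map_add' := fun p q => by ext (j | j) i <;> rfl }
  have := Measure.prod.instIsAddHaarMeasure (matHaar a n k 1) (matHaar b n k 1)
  refine map_haar_eq_of_measure_eq e ?_ ?_ _ _ (unitCube (a ⊕ b) n k)
    isCompact_unitCube.measurableSet (measure_unitCube_pos _) (measure_unitCube_lt_top _) ?_
  · refine continuous_matrix fun j i => ?_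
    rcases j with j | j
    · exact (continuous_fst.matrix_elem j i)
    · exact (continuous_snd.matrix_elem j i)
  · exact Continuous.prodMk (continuous_matrix fun i j => continuous_id.matrix_elem (Sum.inl i) j)
      (continuous_matrix fun i j => continuous_id.matrix_elem (Sum.inr i) j)
  · have : e ⁻¹' unitCube (a ⊕ b) n k = unitCube a n k ×ˢ unitCube b n k := by
      ext p
      simp [unitCube, e]
    rw [this, Measure.prod_prod, matHaar_unitCube, matHaar_unitCube, matHaar_unitCube, one_mul]

theorem measurable_fromCols :
    Measurable fun p : Matrix m a k × Matrix m b k => Matrix.fromCols p.1 p.2 := by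
  refine Continuous.measurable (continuous_matrix fun i j => ?_)
  rcases j with j | j
  · exact (continuous_fst.matrix_elem i j)
  · exact (continuous_snd.matrix_elem i j)

theorem measurable_fromRows :
    Measurable fun p : Matrix a n k × Matrix b n k => Matrix.fromRows p.1 p.2 := by
  refine Continuous.measurable (continuous_matrix fun j i => ?_)
  rcases j with j | j
  · exact (continuous_fst.matrix_elem j i)
  · exact (continuous_snd.matrix_elem j i)

theorem lintegral_fromCols {Φ : Matrix m (a ⊕ b) k → ℝ≥0∞} (hΦ : Measurable Φ) :
    ∫⁻ X, Φ X ∂matHaar m (a ⊕ b) k 1 =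
      ∫⁻ A, ∫⁻ B, Φ (Matrix.fromCols A B) ∂matHaar m b k 1 ∂matHaar m a k 1 := by
  rw [← map_fromCols, lintegral_map hΦ measurable_fromCols,
    lintegral_prod (fun p : Matrix m a k × Matrix m b k => Φ (Matrix.fromCols p.1 p.2))
      (hΦ.comp measurable_fromCols).aemeasurable]

theorem lintegral_fromRows {Φ : Matrix (a ⊕ b) n k → ℝ≥0∞} (hΦ : Measurable Φ) :
    ∫⁻ X, Φ X ∂matHaar (a ⊕ b) n k 1 =
      ∫⁻ A, ∫⁻ B, Φ (Matrix.fromRows A B) ∂matHaar b n k 1 ∂matHaar a n k 1 := by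
  rw [← map_fromRows, lintegral_map hΦ measurable_fromRows,
    lintegral_prod (fun p : Matrix a n k × Matrix b n k => Φ (Matrix.fromRows p.1 p.2))
      (hΦ.comp measurable_fromRows).aemeasurable]

end Blocks

variable {F E : Type*} [NontriviallyNormedField F] [LocallyCompactSpace F]
  [NontriviallyNormedField E] [LocallyCompactSpace E] [NormedAlgebra F E]
  {a n : Type*} [Fintype a] [Fintype n]

/-- The matrix over `E` whose coordinates with respect to a basis are the two row blocks. -/
def combineRows (bE : Module.Basis (Fin 2) F E) : Matrix (a ⊕ a) n F ≃ₗ[F] Matrix a n E where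
  toFun v := Matrix.of fun i j => v (Sum.inl i) j • bE 0 + v (Sum.inr i) j • bE 1
  invFun X := Matrix.fromRows (Matrix.of fun i j => bE.repr (X i j) 0)
    (Matrix.of fun i j => bE.repr (X i j) 1)
  map_add' v w := by ext i j; simp [add_smul]; ring
  map_smul' c v := by ext i j; simp [mul_smul]
  left_inv v := by ext (i | i) j <;> simp
  right_inv X := by
    ext i j
    have := bE.sum_repr (X i j)
    rw [Fin.sum_univ_two] at this
    simpa using this

theorem combineRows_apply (bE : Module.Basis (Fin 2) F E) (v : Matrix (a ⊕ a) n F) (i : a) (j : n) :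
    combineRows bE v i j = v (Sum.inl i) j • bE 0 + v (Sum.inr i) j • bE 1 := rfl

theorem combineRows_mul {m : Type*} [Fintype m] (bE : Module.Basis (Fin 2) F E)
    (v : Matrix (a ⊕ a) n F) (u : Matrix n m F) :
    combineRows bE (v * u) = combineRows bE v * u.map (algebraMap F E) := by
  ext i j
  simp only [combineRows_apply, Matrix.mul_apply, Matrix.map_apply, Finset.sum_smul, add_mul,
    Finset.sum_add_distrib, Algebra.smul_def, map_sum, map_mul, Finset.sum_mul]
  congr 1 <;> exact Finset.sum_congr rfl fun _ _ => by ring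

theorem continuous_combineRows (bE : Module.Basis (Fin 2) F E) :
    Continuous (combineRows bE : Matrix (a ⊕ a) n F → Matrix a n E) := by
  refine continuous_matrix fun i j => Continuous.add ?_ ?_
  · exact (continuous_id.matrix_elem (Sum.inl i) j).smul continuous_const
  · exact (continuous_id.matrix_elem (Sum.inr i) j).smul continuous_const

theorem continuous_combineRows_symm (hdeg : Module.finrank F E = 2)
    (bE : Module.Basis (Fin 2) F E) :
    Continuous ((combineRows bE).symm : Matrix a n E → Matrix (a ⊕ a) n F) := by
  have : FiniteDimensional F E := Module.finite_of_finrank_pos (by omega)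
  have hc : ∀ l, Continuous fun y => bE.repr y l := fun l =>
    LinearMap.continuous_of_finiteDimensional (bE.coord l)
  refine continuous_matrix fun i j => ?_
  rcases i with i | i
  · exact (hc 0).comp (continuous_id.matrix_elem i j)
  · exact (hc 1).comp (continuous_id.matrix_elem i j)

/-- By the definition of an integral basis, the coordinates identify the unit cubes over `F` and
over `E`, and both cubes have volume one. -/
theorem map_combineRows (hdeg : Module.finrank F E = 2) {bE : Module.Basis (Fin 2) F E}
    (hbE : IsIntegralBasis bE) :
    (matHaar (a ⊕ a) n F 1).map (combineRows bE) = matHaar a n E 1 := by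
  have : FiniteDimensional F E := Module.finite_of_finrank_pos (by omega)
  refine map_haar_eq_of_measure_eq (combineRows bE).toAddEquiv
    (continuous_combineRows bE) (continuous_combineRows_symm hdeg bE) _ _ (unitCube a n E)
    isCompact_unitCube.measurableSet (measure_unitCube_pos _) (measure_unitCube_lt_top _) ?_
  have h : (combineRows bE).toAddEquiv ⁻¹' unitCube a n E = unitCube (a ⊕ a) n F := by
    ext v
    simp only [unitCube, Set.mem_preimage, Set.mem_setOf_eq, Sum.forall]
    constructor
    · intro h
      have h2 : ∀ i j l, ‖bE.repr (combineRows bE v i j) l‖ ≤ 1 := fun i j => (hbE _).1 (h i j)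
      constructor
      · intro i j; simpa [combineRows_apply] using h2 i j 0
      · intro i j; simpa [combineRows_apply] using h2 i j 1
    · intro h i j
      refine (hbE _).2 fun l => ?_
      change ‖bE.repr (combineRows bE v i j) l‖ ≤ 1
      fin_cases l
      · simpa [combineRows_apply] using h.1 i j
      · simpa [combineRows_apply] using h.2 i j
  rw [h, matHaar_unitCube, matHaar_unitCube]

/-- The product of the `E`-matrix with coordinates `g` and a rational matrix `u` has coordinates `g
u`. The change of variables is thus left multiplication by `g` on matrices over `F`. -/
theorem lintegral_rowMul [DecidableEq a] [DecidableEq n] (hdeg : Module.finrank F E = 2)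
    {bE : Module.Basis (Fin 2) F E}
    (hbE : IsIntegralBasis bE) {g : Matrix (a ⊕ a) (a ⊕ a) F} (hg : g.det ≠ 0)
    {Φ : Matrix a n E → ℝ≥0∞} (hΦ : Measurable Φ) :
    ∫⁻ u, Φ (combineRows bE g * u.map (algebraMap F E)) ∂matHaar (a ⊕ a) n F 1 =
      ENNReal.ofReal (normAbs F g.det ^ Fintype.card n)⁻¹ * ∫⁻ X, Φ X ∂matHaar a n E 1 := by
  have : FiniteDimensional F E := Module.finite_of_finrank_pos (by omega)
  have hm : Measurable (combineRows bE : Matrix (a ⊕ a) n F → Matrix a n E) :=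
    (continuous_combineRows bE).measurable
  rw [← map_combineRows hdeg hbE, lintegral_map hΦ hm]
  have h := lintegral_mulMul (matHaar (a ⊕ a) n F 1) hg (C := 1) (by simp) (hΦ.comp hm)
  simp only [Matrix.mul_one, Matrix.det_one, normAbs_one, one_pow, mul_one, Function.comp_def,
    combineRows_mul] at h
  exact h

/-- If `t` has coordinates `g` in the basis `ω₀, ω₁`, then `[t; t̄] = [ω₀, ω₁; ω̄₀, ω̄₁] g`, each
`ωᵢ` standing for a scalar block. The square of `ω₀ω̄₁ - ω₁ω̄₀` is the discriminant, and the
absolute value of `E` restricts to the square of that of `F`. -/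
theorem det_conjRows [DecidableEq a] [CharZero F] (hdeg : Module.finrank F E = 2) (σ : E ≃ₐ[F] E)
    (hσ : σ ≠ AlgEquiv.refl) (bE : Module.Basis (Fin 2) F E) (g : Matrix (a ⊕ a) (a ⊕ a) F) :
    normAbs E (Matrix.fromRows (combineRows bE g) ((combineRows bE g).map σ)).det =
      normAbs F (Algebra.discr F bE) ^ Fintype.card a * normAbs F g.det ^ 2 := by
  have h1 : Matrix.fromRows (combineRows bE g) ((combineRows bE g).map σ) =
      Matrix.fromBlocks (bE 0 • (1 : Matrix a a E)) (bE 1 • (1 : Matrix a a E))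
          (σ (bE 0) • (1 : Matrix a a E)) (σ (bE 1) • (1 : Matrix a a E)) *
        g.map (algebraMap F E) := by
    rw [← Matrix.fromRows_toRows (g.map (algebraMap F E)), Matrix.fromBlocks_mul_fromRows]
    simp only [Matrix.smul_mul, Matrix.one_mul]
    ext (i | i) j
    · simp [combineRows_apply, Algebra.smul_def, mul_comm]
    · simp [combineRows_apply, Algebra.smul_def, mul_comm]
  have h2 : normAbs E (basisDet σ bE) = normAbs F (Algebra.discr F bE) := by
    have h3 := congrArg (normAbs E) (basisDet_sq σ hdeg hσ bE)
    rw [normAbs_algebraMap hdeg, normAbs_pow] at h3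
    exact (pow_left_inj₀ (normAbs_nonneg _) (normAbs_nonneg _) two_ne_zero).1 h3.symm
  have h4 : (g.map (algebraMap F E)).det = algebraMap F E g.det :=
    ((algebraMap F E).map_det g).symm
  rw [h1, Matrix.det_mul, det_scalarBlocks (bE.ne_zero 0), h4, normAbs_mul, normAbs_pow,
    normAbs_algebraMap hdeg, ← h2, basisDet]

end Jacobian

/-! ## The Jacobian of the unipotent action -/

section Rows

variable {F E : Type*} [Field F] [Field E] [Algebra F E] (σ : E ≃ₐ[F] E)
  {a b : Type*} [Fintype a] [DecidableEq a] [Fintype b] [DecidableEq b]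

/-- The matrix `[t; t̄]`. -/
def conjRows (t : Matrix a (a ⊕ a) E) : Matrix (a ⊕ a) (a ⊕ a) E :=
  Matrix.fromRows t (t.map σ)

/-- In `x = s'(α) x̄` the upper rows say `t = α t̄ + s̄`, with `t` and `s` the upper and lower rows
of `x`. Conjugating gives `s = t̄ - ᾱ t`, so `x` is determined by its upper rows. -/
theorem val_eq_mul_conjRows (hinv : ∀ z, σ (σ z) = z) {x : GL (a ⊕ a) E} {α : Matrix a a E}
    (hα : (toSymm σ x).val = sPrime σ α) :
    x.val = Matrix.fromBlocks 1 0 (-α.map σ) 1 * conjRows σ x.val.toRows₁ := by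
  have h1 : x.val = sPrime σ α * x.val.map σ := by
    rw [← hα]
    change x.val = (toSymm σ x * conjGL σ x).val
    rw [toSymm, inv_mul_cancel_right]
  let t := x.val.toRows₁
  let s := x.val.toRows₂
  have hx : x.val = Matrix.fromRows t s := (Matrix.fromRows_toRows _).symm
  have hxm : x.val.map σ = Matrix.fromRows (t.map σ) (s.map σ) := by
    ext (i | i) j <;> rfl
  rw [hxm, sPrime, Matrix.fromBlocks_mul_fromRows, Matrix.one_mul] at h1
  have h2 : t = α * t.map σ + s.map σ := by
    have := congrArg Matrix.toRows₁ h1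
    rwa [Matrix.toRows₁_fromRows] at this
  have h3 : t.map σ = α.map σ * t + s := by
    have h4 := congrArg (fun M => M.map σ) h2
    have e1 : (t.map σ).map σ = t := by ext i j; simp [hinv]
    have e2 : (s.map σ).map σ = s := by ext i j; simp [hinv]
    rw [Matrix.map_add _ (map_add σ), Matrix.map_mul, e1, e2] at h4
    exact h4
  change x.val = Matrix.fromBlocks 1 0 (-α.map σ) 1 * Matrix.fromRows t (t.map σ)
  rw [Matrix.fromBlocks_mul_fromRows, hx, h3]
  congr 1
  · simp
  · rw [Matrix.neg_mul, Matrix.one_mul]; abel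

theorem det_eq_det_conjRows (hinv : ∀ z, σ (σ z) = z) {x : GL (a ⊕ a) E} {α : Matrix a a E}
    (hα : (toSymm σ x).val = sPrime σ α) : x.val.det = (conjRows σ x.val.toRows₁).det := by
  conv_lhs => rw [val_eq_mul_conjRows σ hinv hα]
  rw [Matrix.det_mul, Matrix.det_fromBlocks_zero₁₂]
  simp

theorem inv_val_eq_mul (hinv : ∀ z, σ (σ z) = z) {x : GL (b ⊕ b) E} {α : Matrix b b E}
    (hα : (toSymm σ x).val = sPrime σ α) :
    (x⁻¹).val = (conjRows σ x.val.toRows₁)⁻¹ * Matrix.fromBlocks 1 0 (α.map σ) 1 := by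
  have h := val_eq_mul_conjRows σ hinv hα
  have hdet : IsUnit (conjRows σ x.val.toRows₁).det := by
    rw [← det_eq_det_conjRows σ hinv hα]
    exact (Matrix.isUnit_iff_isUnit_det _).1 x.isUnit
  rw [Matrix.coe_units_inv, h, Matrix.mul_inv_rev, ← h]
  congr 1
  refine Matrix.inv_eq_right_inv ?_
  rw [Matrix.fromBlocks_multiply]
  simp

/-- Conjugation exchanges the two row blocks of `[t; t̄]`, so the coefficients `A` and `B` are
exchanged and conjugated. -/
theorem conjRows_mul_inv (hinv : ∀ z, σ (σ z) = z) {t : Matrix b (b ⊕ b) E}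
    (ht : IsUnit (conjRows σ t).det) {X : Matrix a (b ⊕ b) E} {A B : Matrix a b E}
    (h : X * (conjRows σ t)⁻¹ = Matrix.fromCols A B) :
    X.map σ * (conjRows σ t)⁻¹ = Matrix.fromCols (B.map σ) (A.map σ) := by
  have h1 : X = A * t + B * t.map σ := by
    have h2 := congrArg (fun M => M * conjRows σ t) h
    simp only [Matrix.nonsing_inv_mul_cancel_right _ _ ht] at h2
    rw [h2, conjRows, Matrix.fromCols_mul_fromRows]
  have e1 : (t.map σ).map σ = t := by ext i j; simp [hinv]
  have h3 : X.map σ = Matrix.fromCols (B.map σ) (A.map σ) * conjRows σ t := by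
    rw [h1, Matrix.map_add _ (map_add σ), Matrix.map_mul, Matrix.map_mul, e1, conjRows,
      Matrix.fromCols_mul_fromRows, add_comm]
  rw [h3, Matrix.mul_nonsing_inv_cancel_right _ _ ht]

/-- For rational `u` the middle product is `[A, B; B̄, Ā]`; the triangular factors of `x₁` and
`x₂⁻¹` then give the four blocks. In the lower left one `A` enters only through the twisted
Sylvester operator, the source of `λ'`. -/
theorem conj_unipotent_eq (hinv : ∀ z, σ (σ z) = z) {x₁ : GL (a ⊕ a) E} {x₂ : GL (b ⊕ b) E}
    {α₁ : Matrix a a E} {α₂ : Matrix b b E} (hα₁ : (toSymm σ x₁).val = sPrime σ α₁)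
    (hα₂ : (toSymm σ x₂).val = sPrime σ α₂) (u : Matrix (a ⊕ a) (b ⊕ b) F) {A B : Matrix a b E}
    (h : x₁.val.toRows₁ * u.map (algebraMap F E) * (conjRows σ x₂.val.toRows₁)⁻¹ =
      Matrix.fromCols A B) :
    x₁.val * u.map (algebraMap F E) * (x₂⁻¹).val =
      Matrix.fromBlocks (A + B * α₂.map σ) B
        (twistedSylvester σ (-α₁.map σ) (α₂.map σ) A + (B.map σ - α₁.map σ * B * α₂.map σ))
        (A.map σ - α₁.map σ * B) := by
  have hdet : IsUnit (conjRows σ x₂.val.toRows₁).det := by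
    rw [← det_eq_det_conjRows σ hinv hα₂]
    exact (Matrix.isUnit_iff_isUnit_det _).1 x₂.isUnit
  have h2 := conjRows_mul_inv σ hinv hdet h
  have hu : (u.map (algebraMap F E)).map σ = u.map (algebraMap F E) := by
    ext i j; simp
  rw [Matrix.map_mul, hu] at h2
  have h3 : conjRows σ x₁.val.toRows₁ * u.map (algebraMap F E) *
      (conjRows σ x₂.val.toRows₁)⁻¹ = Matrix.fromBlocks A B (B.map σ) (A.map σ) := by
    rw [conjRows, Matrix.fromRows_mul, Matrix.fromRows_mul, h, h2, Matrix.fromRows_fromCols_eq_fromBlocks]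
  have h4 : x₁.val * u.map (algebraMap F E) * (x₂⁻¹).val =
      (Matrix.fromBlocks 1 0 (-α₁.map σ) 1 : Matrix (a ⊕ a) (a ⊕ a) E) *
        (conjRows σ x₁.val.toRows₁ * u.map (algebraMap F E) * (conjRows σ x₂.val.toRows₁)⁻¹) *
        (Matrix.fromBlocks 1 0 (α₂.map σ) 1 : Matrix (b ⊕ b) (b ⊕ b) E) := by
    conv_lhs => rw [val_eq_mul_conjRows σ hinv hα₁, inv_val_eq_mul σ hinv hα₂]
    simp only [Matrix.mul_assoc]
  rw [h4, h3, Matrix.fromBlocks_multiply, Matrix.fromBlocks_multiply, twistedSylvester_apply]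
  congr 1
  · simp
  · simp
  · simp [Matrix.add_mul]; abel
  · simp; abel

end Rows

/-! ### The Jacobian as an identity of integrals -/

section Integral

attribute [local instance] properSpace_of_locallyCompact matrixBorel matrixBorel_borelSpace
  matrix_secondCountable matHaar_isAddHaar

variable {F E : Type*} [NontriviallyNormedField F] [LocallyCompactSpace F]
  [NontriviallyNormedField E] [LocallyCompactSpace E] [NormedAlgebra F E]
  {a b : Type*} [Fintype a] [DecidableEq a] [Fintype b] [DecidableEq b]

theorem measurable_fromBlocks {k : Type*} [NontriviallyNormedField k] [LocallyCompactSpace k] :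
    Measurable fun p : (Matrix a b k × Matrix a b k) × (Matrix a b k × Matrix a b k) =>
      Matrix.fromBlocks p.1.1 p.1.2 p.2.1 p.2.2 := by
  refine Continuous.measurable (continuous_matrix fun i j => ?_)
  rcases i with i | i <;> rcases j with j | j
  · exact (continuous_fst.comp continuous_fst).matrix_elem i j
  · exact (continuous_snd.comp continuous_fst).matrix_elem i j
  · exact (continuous_fst.comp continuous_snd).matrix_elem i j
  · exact (continuous_snd.comp continuous_snd).matrix_elem i j

theorem lintegral_fromBlocks {k : Type*} [NontriviallyNormedField k] [LocallyCompactSpace k]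
    {Φ : Matrix (a ⊕ a) (b ⊕ b) k → ℝ≥0∞} (hΦ : Measurable Φ) :
    ∫⁻ X, Φ X ∂matHaar (a ⊕ a) (b ⊕ b) k 1 =
      ∫⁻ A, ∫⁻ B, ∫⁻ C, ∫⁻ D, Φ (Matrix.fromBlocks A B C D) ∂matHaar a b k 1 ∂matHaar a b k 1
        ∂matHaar a b k 1 ∂matHaar a b k 1 := by
  rw [lintegral_fromRows hΦ]
  have h1 : ∀ P : Matrix a (b ⊕ b) k, ∫⁻ Q, Φ (Matrix.fromRows P Q) ∂matHaar a (b ⊕ b) k 1 =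
      ∫⁻ C, ∫⁻ D, Φ (Matrix.fromRows P (Matrix.fromCols C D)) ∂matHaar a b k 1
        ∂matHaar a b k 1 := fun P =>
    lintegral_fromCols (hΦ.comp (measurable_fromRows.comp measurable_prodMk_left))
  simp_rw [h1]
  rw [lintegral_fromCols]
  · simp_rw [Matrix.fromRows_fromCols_eq_fromBlocks]
  · have h2 : Measurable fun p : (Matrix a (b ⊕ b) k × Matrix a b k) × Matrix a b k =>
        Φ (Matrix.fromRows p.1.1 (Matrix.fromCols p.1.2 p.2)) :=
      hΦ.comp (measurable_fromRows.comp ((measurable_fst.comp measurable_fst).prodMk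
        (measurable_fromCols.comp ((measurable_snd.comp measurable_fst).prodMk measurable_snd))))
    exact (h2.lintegral_prod_right').lintegral_prod_right'

theorem continuous_map_algEquiv (hdeg : Module.finrank F E = 2) (σ : E ≃ₐ[F] E) :
    Continuous σ := by
  have : FiniteDimensional F E := Module.finite_of_finrank_pos (by omega)
  exact LinearMap.continuous_of_finiteDimensional (σ : E →ₗ[F] E)

/-- Integration against the sheared blocks. -/
theorem lintegral_shear (hdeg : Module.finrank F E = 2) (σ : E ≃ₐ[F] E) (α₁ : Matrix a a E)
    (α₂ : Matrix b b E)
    (hdet : LinearMap.det (twistedSylvester σ (-α₁.map σ) (α₂.map σ) :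
      Matrix a b E →ₗ[F] Matrix a b E) ≠ 0)
    {Φ : Matrix (a ⊕ a) (b ⊕ b) E → ℝ≥0∞} (hΦ : Measurable Φ) :
    ∫⁻ A, ∫⁻ B, ∫⁻ P, ∫⁻ Q, Φ (Matrix.fromBlocks (A + B * α₂.map σ) B
        (twistedSylvester σ (-α₁.map σ) (α₂.map σ) A + (B.map σ - α₁.map σ * B * α₂.map σ))
        (A.map σ - α₁.map σ * B) - Matrix.fromBlocks P 0 0 Q)
        ∂matHaar a b E 1 ∂matHaar a b E 1 ∂matHaar a b E 1 ∂matHaar a b E 1 =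
      ENNReal.ofReal (normAbs F (LinearMap.det (twistedSylvester σ (-α₁.map σ) (α₂.map σ) :
        Matrix a b E →ₗ[F] Matrix a b E)))⁻¹ *
      ∫⁻ X, Φ X ∂matHaar (a ⊕ a) (b ⊕ b) E 1 := by
  have : FiniteDimensional F E := Module.finite_of_finrank_pos (by omega)
  let μ := matHaar a b E 1
  let T : Matrix a b E →ₗ[F] Matrix a b E := twistedSylvester σ (-α₁.map σ) (α₂.map σ)
  let R : Matrix a b E → Matrix a b E := fun B => B.map σ - α₁.map σ * B * α₂.map σ
  have hTm : Measurable T := (LinearMap.continuous_of_finiteDimensional T).measurable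
  let G : Matrix a b E → Matrix a b E → ℝ≥0∞ := fun B C =>
    ∫⁻ P, ∫⁻ Q, Φ (Matrix.fromBlocks P B C Q) ∂μ ∂μ
  have hG : Measurable fun p : Matrix a b E × Matrix a b E => G p.1 p.2 := by
    have h2 : Measurable fun p : ((Matrix a b E × Matrix a b E) × Matrix a b E) × Matrix a b E =>
        Φ (Matrix.fromBlocks p.1.2 p.1.1.1 p.1.1.2 p.2) :=
      hΦ.comp (measurable_fromBlocks.comp (((measurable_snd.comp measurable_fst).prodMk
        (measurable_fst.comp (measurable_fst.comp measurable_fst))).prodMk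
        ((measurable_snd.comp (measurable_fst.comp measurable_fst)).prodMk measurable_snd)))
    exact (h2.lintegral_prod_right').lintegral_prod_right'
  have hR : Measurable R := by
    refine Continuous.measurable (continuous_matrix fun i j => ?_)
    refine Continuous.sub ((continuous_map_algEquiv hdeg σ).comp (continuous_id.matrix_elem i j)) ?_
    exact ((continuous_const.matrix_mul continuous_id).matrix_mul continuous_const).matrix_elem i j
  -- For fixed `A` and `B`, the free translations by `P` and `Q` absorb the diagonal blocks.
  have h1 : ∀ A B : Matrix a b E, ∫⁻ P, ∫⁻ Q, Φ (Matrix.fromBlocks (A + B * α₂.map σ) B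
        (T A + R B) (A.map σ - α₁.map σ * B) - Matrix.fromBlocks P 0 0 Q) ∂μ ∂μ =
        G B (T A + R B) := by
    intro A B
    have h3 : ∀ P Q : Matrix a b E, Matrix.fromBlocks (A + B * α₂.map σ) B
        (T A + R B) (A.map σ - α₁.map σ * B) - Matrix.fromBlocks P 0 0 Q =
        Matrix.fromBlocks ((A + B * α₂.map σ) - P) B (T A + R B)
          ((A.map σ - α₁.map σ * B) - Q) := by
      intro P Q
      ext (i | i) (j | j) <;> simp
    simp_rw [h3]
    have h4 : ∀ P : Matrix a b E, ∫⁻ Q, Φ (Matrix.fromBlocks ((A + B * α₂.map σ) - P) B (T A + R B)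
          ((A.map σ - α₁.map σ * B) - Q)) ∂μ = ∫⁻ Q, Φ (Matrix.fromBlocks
            ((A + B * α₂.map σ) - P) B (T A + R B) Q) ∂μ := fun P =>
      lintegral_sub_left_eq_self (fun Q => Φ (Matrix.fromBlocks ((A + B * α₂.map σ) - P) B
        (T A + R B) Q)) _
    simp_rw [h4]
    exact lintegral_sub_left_eq_self (fun P => ∫⁻ Q, Φ (Matrix.fromBlocks P B
        (T A + R B) Q) ∂μ) _
  change ∫⁻ A, ∫⁻ B, ∫⁻ P, ∫⁻ Q, Φ (Matrix.fromBlocks (A + B * α₂.map σ) B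
        (T A + R B) (A.map σ - α₁.map σ * B) - Matrix.fromBlocks P 0 0 Q) ∂μ ∂μ ∂μ ∂μ = _
  simp_rw [h1]
  have hG' : Measurable fun p : Matrix a b E × Matrix a b E => G p.2 (T p.1 + R p.2) :=
    hG.comp (measurable_snd.prodMk ((hTm.comp measurable_fst).add (hR.comp measurable_snd)))
  rw [lintegral_lintegral_swap hG'.aemeasurable]
  -- With `B` fixed, the lower left block is `T A` plus a constant: `T` scales the measure and the
  -- constant is a translation.
  have h5 : ∀ B, ∫⁻ A, G B (T A + R B) ∂μ =
      ENNReal.ofReal (normAbs F (LinearMap.det T))⁻¹ * ∫⁻ C, G B C ∂μ := by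
    intro B
    have h6 := congrArg (fun ξ => ∫⁻ C, G B (C + R B) ∂ξ) (map_linearMap_haar μ T hdet)
    have hm : Measurable fun C => G B (C + R B) :=
      hG.comp (measurable_const.prodMk (measurable_id.add measurable_const))
    simp only [lintegral_map hm hTm, lintegral_smul_measure] at h6
    rw [h6, lintegral_add_right_eq_self (fun C => G B C)]
    rfl
  simp_rw [h5]
  rw [lintegral_const_mul _ (hG.lintegral_prod_right'), lintegral_fromBlocks hΦ]
  congr 1
  have h7 : Measurable fun p : ((Matrix a b E × Matrix a b E) × Matrix a b E) × Matrix a b E =>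
      Φ (Matrix.fromBlocks p.1.1.1 p.1.1.2 p.1.2 p.2) :=
    hΦ.comp (measurable_fromBlocks.comp ((measurable_fst.comp measurable_fst).prodMk
      ((measurable_snd.comp measurable_fst).prodMk measurable_snd)))
  have h8 := h7.lintegral_prod_right' (ν := μ)
  have h9 := h8.lintegral_prod_right' (ν := μ)
  refine Eq.trans ?_ (lintegral_lintegral_swap h9.aemeasurable).symm
  refine lintegral_congr fun B => ?_
  refine lintegral_lintegral_swap (f := fun C P => ∫⁻ Q, Φ (Matrix.fromBlocks P B C Q) ∂μ) ?_
  exact (h8.comp ((measurable_snd.prodMk measurable_const).prodMk measurable_fst)).aemeasurable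

/-- The pushforward of the unipotent Haar measures at the base point. -/
theorem lintegral_unipotent_base [CharZero F] (hdeg : Module.finrank F E = 2) (σ : E ≃ₐ[F] E)
    (hσ : σ ≠ AlgEquiv.refl) {bE : Module.Basis (Fin 2) F E} (hbE : IsIntegralBasis bE)
    {x : GL (a ⊕ a) E × GL (b ⊕ b) E} {α₁ : Matrix a a E} {α₂ : Matrix b b E}
    (hα₁ : (toSymm σ x.1).val = sPrime σ α₁) (hα₂ : (toSymm σ x.2).val = sPrime σ α₂)
    (hdet : LinearMap.det (twistedSylvester σ (-α₁.map σ) (α₂.map σ) :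
      Matrix a b E →ₗ[F] Matrix a b E) ≠ 0)
    {Φ : Matrix (a ⊕ a) (b ⊕ b) E → ℝ≥0∞} (hΦ : Measurable Φ) :
    ∫⁻ u, ∫⁻ P, ∫⁻ Q, Φ (x.1.val * u.map (algebraMap F E) * (x.2⁻¹).val -
        Matrix.fromBlocks P 0 0 Q) ∂matHaar a b E 1 ∂matHaar a b E 1
        ∂matHaar (a ⊕ a) (b ⊕ b) F 1 =
      ENNReal.ofReal (normAbs F (Algebra.discr F bE) ^ (Fintype.card a * Fintype.card b) *
        normAbs E x.2.val.det ^ Fintype.card a / normAbs E x.1.val.det ^ Fintype.card b /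
        normAbs F (LinearMap.det (twistedSylvester σ (-α₁.map σ) (α₂.map σ) :
          Matrix a b E →ₗ[F] Matrix a b E))) *
      ∫⁻ X, Φ X ∂matHaar (a ⊕ a) (b ⊕ b) E 1 := by
  have hinv := involutive_of_finrank_eq_two σ hdeg
  let μ := matHaar a b E 1
  let t := x.1.val.toRows₁
  -- Coordinates over `F` of the upper rows of `x₁`. Their determinant carries both the discriminant
  -- and the factor `|det x₁|_E`.
  let g := (combineRows bE).symm t
  have hgt : combineRows bE g = t := (combineRows bE).apply_symm_apply t
  have hd1 : normAbs E x.1.val.det =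
      normAbs F (Algebra.discr F bE) ^ Fintype.card a * normAbs F g.det ^ 2 := by
    rw [det_eq_det_conjRows σ hinv hα₁, ← det_conjRows hdeg σ hσ bE g, hgt]; rfl
  have hd1' : normAbs E x.1.val.det ≠ 0 :=
    (normAbs_pos ((Matrix.isUnit_iff_isUnit_det _).1 x.1.isUnit).ne_zero).ne'
  have hd2' : normAbs E x.2.val.det ≠ 0 :=
    (normAbs_pos ((Matrix.isUnit_iff_isUnit_det _).1 x.2.isUnit).ne_zero).ne'
  have hg : g.det ≠ 0 := by
    intro h
    rw [h, normAbs_zero] at hd1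
    simp [hd1] at hd1'
  let Y := conjRows σ x.2.val.toRows₁
  have hY : Y.det = x.2.val.det := (det_eq_det_conjRows σ hinv hα₂).symm
  have hY0 : Y⁻¹.det ≠ 0 := by
    rw [Matrix.det_nonsing_inv, hY]
    exact (((Matrix.isUnit_iff_isUnit_det _).1 x.2.isUnit).ringInverse).ne_zero
  have hYn : normAbs E Y⁻¹.det = (normAbs E x.2.val.det)⁻¹ := by
    rw [Matrix.det_nonsing_inv, hY, Ring.inverse_eq_inv', normAbs_inv]
  let R : Matrix a (b ⊕ b) E → Matrix (a ⊕ a) (b ⊕ b) E := fun Z =>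
    Matrix.fromBlocks (Z.toCols₁ + Z.toCols₂ * α₂.map σ) Z.toCols₂
        (twistedSylvester σ (-α₁.map σ) (α₂.map σ) Z.toCols₁ +
          (Z.toCols₂.map σ - α₁.map σ * Z.toCols₂ * α₂.map σ))
        (Z.toCols₁.map σ - α₁.map σ * Z.toCols₂)
  have hR : Measurable R := by
    have hc1 : Continuous fun Z : Matrix a (b ⊕ b) E => Z.toCols₁ :=
      continuous_matrix fun i j => continuous_id.matrix_elem i (Sum.inl j)
    have hc2 : Continuous fun Z : Matrix a (b ⊕ b) E => Z.toCols₂ :=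
      continuous_matrix fun i j => continuous_id.matrix_elem i (Sum.inr j)
    have hs : ∀ {f : Matrix a (b ⊕ b) E → Matrix a b E}, Continuous f →
        Continuous fun Z => (f Z).map σ := fun hf =>
      continuous_matrix fun i j => (continuous_map_algEquiv hdeg σ).comp (hf.matrix_elem i j)
    refine Continuous.measurable (Continuous.matrix_fromBlocks ?_ hc2 ?_ ?_)
    · exact hc1.add (hc2.matrix_mul continuous_const)
    · simp only [twistedSylvester_apply]
      exact (((hs hc1).matrix_mul continuous_const).add (continuous_const.matrix_mul hc1)).add
        ((hs hc2).sub ((continuous_const.matrix_mul hc2).matrix_mul continuous_const))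
    · exact (hs hc1).sub (continuous_const.matrix_mul hc2)
  let H : Matrix a (b ⊕ b) E → ℝ≥0∞ := fun Z => ∫⁻ P, ∫⁻ Q, Φ (R Z - Matrix.fromBlocks P 0 0 Q) ∂μ ∂μ
  have hH : Measurable H := by
    have h2 : Measurable fun p : (Matrix a (b ⊕ b) E × Matrix a b E) × Matrix a b E =>
        Φ (R p.1.1 - Matrix.fromBlocks p.1.2 0 0 p.2) :=
      hΦ.comp ((hR.comp (measurable_fst.comp measurable_fst)).sub
        (measurable_fromBlocks.comp (((measurable_snd.comp measurable_fst).prodMk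
          measurable_const).prodMk (measurable_const.prodMk measurable_snd))))
    exact (h2.lintegral_prod_right').lintegral_prod_right'
  have h1 : ∀ u : Matrix (a ⊕ a) (b ⊕ b) F, ∫⁻ P, ∫⁻ Q, Φ (x.1.val * u.map (algebraMap F E) *
      (x.2⁻¹).val - Matrix.fromBlocks P 0 0 Q) ∂μ ∂μ =
      H (combineRows bE g * u.map (algebraMap F E) * Y⁻¹) := by
    intro u
    have := conj_unipotent_eq σ hinv hα₁ hα₂ u (A := (t * u.map (algebraMap F E) * Y⁻¹).toCols₁)
      (B := (t * u.map (algebraMap F E) * Y⁻¹).toCols₂) (Matrix.fromCols_toCols _).symm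
    rw [this, hgt]
  have hmY : Measurable fun Z : Matrix a (b ⊕ b) E => Z * Y⁻¹ :=
    (continuous_id.matrix_mul continuous_const).measurable
  change ∫⁻ u, ∫⁻ P, ∫⁻ Q, Φ (x.1.val * u.map (algebraMap F E) *
      (x.2⁻¹).val - Matrix.fromBlocks P 0 0 Q) ∂μ ∂μ ∂matHaar (a ⊕ a) (b ⊕ b) F 1 = _
  simp_rw [h1]
  refine (lintegral_rowMul hdeg hbE hg (hH.comp hmY)).trans ?_
  have h2 := lintegral_mulMul (matHaar a (b ⊕ b) E 1) (A := 1) (by simp) hY0 hH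
  simp only [Matrix.one_mul, Matrix.det_one, normAbs_one, one_pow, one_mul, hYn, inv_pow, inv_inv] at h2
  simp only [Function.comp_def]
  rw [h2, lintegral_fromCols hH]
  have h3 := lintegral_shear hdeg σ α₁ α₂ hdet hΦ
  simp only [H, R, Matrix.toCols₁_fromCols, Matrix.toCols₂_fromCols]
  rw [h3, ← mul_assoc, ← mul_assoc, ← ENNReal.ofReal_mul (by have := normAbs_nonneg g.det; positivity),
    ← ENNReal.ofReal_mul (by
      have := normAbs_nonneg g.det; have := normAbs_nonneg x.2.val.det; positivity)]
  congr 2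
  have : FiniteDimensional F E := Module.finite_of_finrank_pos (by omega)
  have hD : normAbs F (Algebra.discr F bE) ≠ 0 :=
    (normAbs_pos (Algebra.discr_not_zero_of_basis F bE)).ne'
  -- Left multiplication by `g` on `2n₁ × 2n₂` matrices contributes `|det g|_F^(-2n₂)`, which by
  -- `hd1` equals `|D|_F^(n₁n₂) |det x₁|_E^(-n₂)`.
  rw [hd1, Fintype.card_sum]
  have := (normAbs_pos hg).ne'
  have := (normAbs_pos hdet).ne'
  field_simp
  ring

theorem det_ne_zero_of_gl {k m : Type*} [Field k] [Fintype m] [DecidableEq m] (g : GL m k) :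
    g.val.det ≠ 0 :=
  ((Matrix.isUnit_iff_isUnit_det _).1 g.isUnit).ne_zero

theorem normAbs_det_pos {k m : Type*} [NontriviallyNormedField k] [LocallyCompactSpace k]
    [Fintype m] [DecidableEq m] (g : GL m k) : 0 < normAbs k g.val.det :=
  normAbs_pos (det_ne_zero_of_gl g)

theorem normAbs_det_mul {k m : Type*} [NontriviallyNormedField k] [LocallyCompactSpace k]
    [Fintype m] [DecidableEq m] (g h : GL m k) :
    normAbs k (g * h).val.det = normAbs k g.val.det * normAbs k h.val.det := by
  rw [Units.val_mul, Matrix.det_mul, normAbs_mul]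

theorem normAbs_det_inv {k m : Type*} [NontriviallyNormedField k] [LocallyCompactSpace k]
    [Fintype m] [DecidableEq m] (g : GL m k) :
    normAbs k (g⁻¹).val.det = (normAbs k g.val.det)⁻¹ := by
  rw [Matrix.coe_units_inv, Matrix.det_nonsing_inv, Ring.inverse_eq_inv', normAbs_inv]

theorem normAbs_det_diagGL {k : Type*} [NontriviallyNormedField k] [LocallyCompactSpace k]
    (p : GL a k × GL b k) : normAbs k (diagGL p).val.det =
      normAbs k p.1.val.det * normAbs k p.2.val.det := by
  change normAbs k (Matrix.fromBlocks p.1.val 0 0 p.2.val).det = _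
  rw [Matrix.det_fromBlocks_zero₁₂, normAbs_mul]

theorem normAbs_det_extGL (hdeg : Module.finrank F E = 2) (g : GL a F) :
    normAbs E (extGL F E g).val.det = normAbs F g.val.det ^ 2 := by
  have : (extGL F E g).val.det = algebraMap F E g.val.det :=
    ((algebraMap F E).map_det g.val).symm
  rw [this, normAbs_algebraMap hdeg]

theorem modQ_pos (x : GL (a ⊕ a) E × GL (b ⊕ b) E) : 0 < modQ x :=
  div_pos (pow_pos (normAbs_det_pos _) _) (pow_pos (normAbs_det_pos _) _)

/-- The exponents in the modulus character are even, so its square root is a quotient of integral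
powers. -/
theorem modQ_rpow (x : GL (a ⊕ a) E × GL (b ⊕ b) E) : modQ x ^ (-(1 / 2) : ℝ) =
    normAbs E x.2.val.det ^ Fintype.card a / normAbs E x.1.val.det ^ Fintype.card b := by
  have h1 := normAbs_det_pos x.1
  have h2 := normAbs_det_pos x.2
  have h3 : modQ x = (normAbs E x.1.val.det ^ Fintype.card b /
      normAbs E x.2.val.det ^ Fintype.card a) ^ 2 := by
    rw [modQ, div_pow, ← pow_mul, ← pow_mul, mul_comm 2, mul_comm 2]
  rw [Real.rpow_neg (modQ_pos x).le, ← Real.sqrt_eq_rpow, h3, Real.sqrt_sq (by positivity),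
    inv_div]

/-- Change of variables in a triple integral. -/
theorem lintegral_mulMul_triple (m₁ : GL a E × GL a E) (m₂ : GL b E × GL b E) (n₁ : GL (a ⊕ a) F)
    (n₂ : GL (b ⊕ b) F) {G : Matrix (a ⊕ a) (b ⊕ b) F → Matrix a b E → Matrix a b E → ℝ≥0∞}
    (hG : Measurable fun q : (Matrix (a ⊕ a) (b ⊕ b) F × Matrix a b E) × Matrix a b E =>
      G q.1.1 q.1.2 q.2) :
    ∫⁻ u, ∫⁻ P, ∫⁻ Q, G (n₁.val * u * (n₂⁻¹).val) (m₁.1.val * P * (m₂.1⁻¹).val)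
        (m₁.2.val * Q * (m₂.2⁻¹).val) ∂matHaar a b E 1 ∂matHaar a b E 1
        ∂matHaar (a ⊕ a) (b ⊕ b) F 1 =
      ENNReal.ofReal (normAbs E m₁.2.val.det ^ Fintype.card b *
        normAbs E (m₂.2⁻¹).val.det ^ Fintype.card a)⁻¹ *
      (ENNReal.ofReal (normAbs E m₁.1.val.det ^ Fintype.card b *
        normAbs E (m₂.1⁻¹).val.det ^ Fintype.card a)⁻¹ *
      (ENNReal.ofReal (normAbs F n₁.val.det ^ Fintype.card (b ⊕ b) *
        normAbs F (n₂⁻¹).val.det ^ Fintype.card (a ⊕ a))⁻¹ *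
      ∫⁻ u, ∫⁻ P, ∫⁻ Q, G u P Q ∂matHaar a b E 1 ∂matHaar a b E 1
        ∂matHaar (a ⊕ a) (b ⊕ b) F 1)) := by
  have hG1 := hG.lintegral_prod_right' (ν := matHaar a b E 1)
  have hG2 := hG1.lintegral_prod_right' (ν := matHaar a b E 1)
  have hmm : Measurable fun P : Matrix a b E => m₁.1.val * P * (m₂.1⁻¹).val :=
    ((continuous_const.matrix_mul continuous_id).matrix_mul continuous_const).measurable
  have hnn : Measurable fun u : Matrix (a ⊕ a) (b ⊕ b) F => n₁.val * u * (n₂⁻¹).val :=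
    ((continuous_const.matrix_mul continuous_id).matrix_mul continuous_const).measurable
  have s1 : ∀ u P, ∫⁻ Q, G u P (m₁.2.val * Q * (m₂.2⁻¹).val) ∂matHaar a b E 1 =
      ENNReal.ofReal (normAbs E m₁.2.val.det ^ Fintype.card b *
        normAbs E (m₂.2⁻¹).val.det ^ Fintype.card a)⁻¹ * ∫⁻ Q, G u P Q ∂matHaar a b E 1 :=
    fun u P => lintegral_mulMul (Φ := fun Q => G u P Q) (matHaar a b E 1)
      (det_ne_zero_of_gl _) (det_ne_zero_of_gl _) (hG.comp (measurable_prodMk_left (x := (u, P))))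
  have s2 : ∀ u, ∫⁻ P, ∫⁻ Q, G u (m₁.1.val * P * (m₂.1⁻¹).val) Q ∂matHaar a b E 1
      ∂matHaar a b E 1 = ENNReal.ofReal (normAbs E m₁.1.val.det ^ Fintype.card b *
        normAbs E (m₂.1⁻¹).val.det ^ Fintype.card a)⁻¹ *
        ∫⁻ P, ∫⁻ Q, G u P Q ∂matHaar a b E 1 ∂matHaar a b E 1 := fun u =>
    lintegral_mulMul (Φ := fun P => ∫⁻ Q, G u P Q ∂matHaar a b E 1) (matHaar a b E 1)
      (det_ne_zero_of_gl _) (det_ne_zero_of_gl _) (hG1.comp (measurable_prodMk_left (x := u)))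
  have s3 := lintegral_mulMul (Φ := fun u => ∫⁻ P, ∫⁻ Q, G u P Q ∂matHaar a b E 1
    ∂matHaar a b E 1) (matHaar (a ⊕ a) (b ⊕ b) F 1) (det_ne_zero_of_gl n₁)
    (det_ne_zero_of_gl n₂⁻¹) hG2
  have s5 : ∀ u : Matrix (a ⊕ a) (b ⊕ b) F, ∫⁻ P, ENNReal.ofReal (normAbs E m₁.2.val.det ^
      Fintype.card b * normAbs E (m₂.2⁻¹).val.det ^ Fintype.card a)⁻¹ *
        ∫⁻ Q, G (n₁.val * u * (n₂⁻¹).val) (m₁.1.val * P * (m₂.1⁻¹).val) Q ∂matHaar a b E 1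
          ∂matHaar a b E 1 =
      ENNReal.ofReal (normAbs E m₁.2.val.det ^
      Fintype.card b * normAbs E (m₂.2⁻¹).val.det ^ Fintype.card a)⁻¹ *
        ∫⁻ P, ∫⁻ Q, G (n₁.val * u * (n₂⁻¹).val) (m₁.1.val * P * (m₂.1⁻¹).val) Q
          ∂matHaar a b E 1 ∂matHaar a b E 1 := fun u =>
    lintegral_const_mul _ (hG1.comp (measurable_const.prodMk hmm))
  have h6 : Measurable fun u : Matrix (a ⊕ a) (b ⊕ b) F => ∫⁻ P, ∫⁻ Q,
      G (n₁.val * u * (n₂⁻¹).val) P Q ∂matHaar a b E 1 ∂matHaar a b E 1 := hG2.comp hnn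
  simp_rw [s1, s5, s2]
  rw [lintegral_const_mul _ (h6.const_mul _)]
  congr 1
  rw [← s3]
  exact lintegral_const_mul _ h6

/-- The pushforward of the unipotent Haar measures at an arbitrary point of the orbit. -/
theorem lintegral_unipotent [CharZero F] (hdeg : Module.finrank F E = 2) (σ : E ≃ₐ[F] E)
    (hσ : σ ≠ AlgEquiv.refl) {bE : Module.Basis (Fin 2) F E} (hbE : IsIntegralBasis bE)
    {x : GL (a ⊕ a) E × GL (b ⊕ b) E} {α₁ : Matrix a a E} {α₂ : Matrix b b E}
    (hα₁ : (toSymm σ x.1).val = sPrime σ α₁) (hα₂ : (toSymm σ x.2).val = sPrime σ α₂)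
    (hdet : LinearMap.det (twistedSylvester σ (-α₁.map σ) (α₂.map σ) :
      Matrix a b E →ₗ[F] Matrix a b E) ≠ 0)
    (p : ((GL a E × GL a E) × (GL b E × GL b E)) × (GL (a ⊕ a) F × GL (b ⊕ b) F))
    (y : GL (a ⊕ a) E × GL (b ⊕ b) E) (hy : y = (inclHL E a b p.1)⁻¹ * x * inclLF F E a b p.2)
    {Φ : Matrix (a ⊕ a) (b ⊕ b) E → ℝ≥0∞} (hΦ : Measurable Φ) :
    ∫⁻ u, ∫⁻ P, ∫⁻ Q, Φ (y.1.val * u.map (algebraMap F E) * (y.2⁻¹).val -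
        Matrix.fromBlocks P 0 0 Q) ∂matHaar a b E 1 ∂matHaar a b E 1
        ∂matHaar (a ⊕ a) (b ⊕ b) F 1 =
      ENNReal.ofReal (normAbs F (Algebra.discr F bE) ^ (Fintype.card a * Fintype.card b) *
        modQ y ^ (-(1 / 2) : ℝ) /
        normAbs F (LinearMap.det (twistedSylvester σ (-α₁.map σ) (α₂.map σ) :
          Matrix a b E →ₗ[F] Matrix a b E))) *
      ∫⁻ X, Φ X ∂matHaar (a ⊕ a) (b ⊕ b) E 1 := by
  obtain ⟨⟨m₁, m₂⟩, n₁, n₂⟩ := p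
  let μ := matHaar a b E 1
  let M₁ := diagGL m₁
  let M₂ := diagGL m₂
  let Ψ : Matrix (a ⊕ a) (b ⊕ b) E → ℝ≥0∞ := fun X => Φ ((M₁⁻¹).val * X * M₂.val)
  have hΨ : Measurable Ψ := hΦ.comp
    ((continuous_const.matrix_mul continuous_id).matrix_mul continuous_const).measurable
  have hy1 : y.1 = M₁⁻¹ * x.1 * extGL F E n₁ := by rw [hy]; rfl
  have hy2 : y.2 = M₂⁻¹ * x.2 * extGL F E n₂ := by rw [hy]; rfl
  have hbase := lintegral_unipotent_base hdeg σ hσ hbE hα₁ hα₂ hdet hΨ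
  -- At `y = m⁻¹ x n` the elements `m` and `n` can be moved onto the variables: `P`, `Q` and `u` are
  -- multiplied by the Levi components, and the target variable by `M₁⁻¹` and `M₂`. This reduces the
  -- claim to the base point `x`.
  have key : ∀ (u : Matrix (a ⊕ a) (b ⊕ b) F) (P Q : Matrix a b E),
      Φ (y.1.val * u.map (algebraMap F E) * (y.2⁻¹).val - Matrix.fromBlocks P 0 0 Q) =
      Ψ (x.1.val * (n₁.val * u * (n₂⁻¹).val).map (algebraMap F E) * (x.2⁻¹).val -
        Matrix.fromBlocks (m₁.1.val * P * (m₂.1⁻¹).val) 0 0 (m₁.2.val * Q * (m₂.2⁻¹).val)) := by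
    intro u P Q
    have e1 : (Matrix.fromBlocks (m₁.1.val * P * (m₂.1⁻¹).val) 0 0 (m₁.2.val * Q * (m₂.2⁻¹).val) :
        Matrix (a ⊕ a) (b ⊕ b) E) = M₁.val * Matrix.fromBlocks P 0 0 Q * (M₂⁻¹).val := by
      change _ = Matrix.fromBlocks m₁.1.val 0 0 m₁.2.val * Matrix.fromBlocks P 0 0 Q *
        Matrix.fromBlocks (m₂.1⁻¹).val 0 0 (m₂.2⁻¹).val
      simp [Matrix.fromBlocks_multiply]
    have e2 : (n₁.val * u * (n₂⁻¹).val).map (algebraMap F E) =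
        (extGL F E n₁).val * u.map (algebraMap F E) * ((extGL F E n₂)⁻¹).val := by
      rw [← map_inv, Matrix.map_mul, Matrix.map_mul]; rfl
    have e3 : ∀ Z : Matrix (a ⊕ a) (b ⊕ b) E, (M₁⁻¹).val * (M₁.val * Z * (M₂⁻¹).val) * M₂.val = Z := by
      intro Z
      simp only [Matrix.mul_assoc, Units.inv_mul, Matrix.mul_one]
      rw [← Matrix.mul_assoc, Units.inv_mul, Matrix.one_mul]
    simp only [Ψ]
    rw [Matrix.mul_sub, Matrix.sub_mul, e1, e3, e2, hy1, hy2]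
    simp only [mul_inv_rev, inv_inv, Units.val_mul, Matrix.mul_assoc]
  simp_rw [key]
  let G : Matrix (a ⊕ a) (b ⊕ b) F → Matrix a b E → Matrix a b E → ℝ≥0∞ := fun u P Q =>
    Ψ (x.1.val * u.map (algebraMap F E) * (x.2⁻¹).val - Matrix.fromBlocks P 0 0 Q)
  have hG : Measurable fun q : (Matrix (a ⊕ a) (b ⊕ b) F × Matrix a b E) × Matrix a b E =>
      G q.1.1 q.1.2 q.2 := by
    have hc : Continuous fun u : Matrix (a ⊕ a) (b ⊕ b) F => u.map (algebraMap F E) :=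
      continuous_matrix fun i j => (continuous_algebraMap F E).comp (continuous_id.matrix_elem i j)
    refine hΨ.comp (Measurable.sub ?_ (measurable_fromBlocks.comp
      (((measurable_snd.comp measurable_fst).prodMk
          measurable_const).prodMk (measurable_const.prodMk measurable_snd))))
    exact ((continuous_const.matrix_mul hc).matrix_mul continuous_const).measurable.comp
      (measurable_fst.comp measurable_fst)
  have s4 := lintegral_mulMul (Φ := Φ) (matHaar (a ⊕ a) (b ⊕ b) E 1) (det_ne_zero_of_gl M₁⁻¹)
    (det_ne_zero_of_gl M₂) hΦ
  refine (lintegral_mulMul_triple m₁ m₂ n₁ n₂ hG).trans ?_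
  simp only [G]
  rw [hbase]
  simp only [Ψ]
  rw [s4]
  have := normAbs_det_pos m₁.1
  have := normAbs_det_pos m₁.2
  have := normAbs_det_pos m₂.1
  have := normAbs_det_pos m₂.2
  have := normAbs_det_pos n₁
  have := normAbs_det_pos n₂
  have := normAbs_det_pos x.1
  have := normAbs_det_pos x.2
  have hT := normAbs_pos hdet
  have hD := normAbs_nonneg (Algebra.discr F bE)
  simp only [normAbs_det_inv]
  simp only [← mul_assoc]
  rw [← ENNReal.ofReal_mul (by positivity), ← ENNReal.ofReal_mul (by positivity),
    ← ENNReal.ofReal_mul (by positivity), ← ENNReal.ofReal_mul (by positivity)]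
  congr 2
  -- The remaining powers of determinants combine to `δ_Q(y)^{-1/2}`; determinants over `F` enter
  -- squared through the absolute value of `E`.
  rw [modQ_rpow, hy1, hy2]
  simp only [normAbs_det_mul, normAbs_det_inv, M₁, M₂, normAbs_det_diagGL, normAbs_det_extGL hdeg,
    Fintype.card_sum, mul_inv, inv_inv, inv_pow, mul_pow]
  field_simp
  ring

end Integral

/-! ## The topology of general linear groups -/

theorem gl_continuous_val {ι k : Type*} [Fintype ι] [DecidableEq ι] [CommRing k]
    [TopologicalSpace k] : Continuous fun g : GL ι k => g.val := Units.continuous_val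

theorem gl_continuous_inv_val {ι k : Type*} [Fintype ι] [DecidableEq ι] [CommRing k]
    [TopologicalSpace k] : Continuous fun g : GL ι k => (g⁻¹).val := Units.continuous_coe_inv

theorem continuous_to_gl {X ι k : Type*} [TopologicalSpace X] [Fintype ι] [DecidableEq ι]
    [CommRing k] [TopologicalSpace k] {f : X → GL ι k} (h1 : Continuous fun x => (f x).val)
    (h2 : Continuous fun x => ((f x)⁻¹).val) : Continuous f :=
  Units.continuous_iff.2 ⟨h1, h2⟩

section GLTopology

attribute [local instance] properSpace_of_locallyCompact matrix_secondCountable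

variable {ι k : Type*} [Fintype ι] [DecidableEq ι] [NontriviallyNormedField k]
  [LocallyCompactSpace k]

theorem gl_isClosedEmbedding :
    Topology.IsClosedEmbedding (Units.embedProduct (Matrix ι ι k)) :=
  Units.isClosedEmbedding_embedProduct

theorem gl_secondCountable : SecondCountableTopology (GL ι k) := by
  have : SecondCountableTopology (Matrix ι ι k)ᵐᵒᵖ :=
    MulOpposite.opHomeomorph.symm.secondCountableTopology
  exact gl_isClosedEmbedding.isEmbedding.secondCountableTopology

theorem maxCompact_eq_preimage : maxCompact ι k = Units.embedProduct (Matrix ι ι k) ⁻¹'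
    (unitCube ι ι k ×ˢ (MulOpposite.unop ⁻¹' unitCube ι ι k)) := by
  ext g
  simp only [maxCompact, unitCube, Set.mem_setOf_eq, Set.mem_preimage, Set.mem_prod,
    Units.embedProduct_apply]
  exact ⟨fun h => ⟨fun i j => (h i j).1, fun i j => (h i j).2⟩, fun h i j => ⟨h.1 i j, h.2 i j⟩⟩

theorem isCompact_maxCompact : IsCompact (maxCompact ι k) := by
  rw [maxCompact_eq_preimage]
  refine gl_isClosedEmbedding.isCompact_preimage (isCompact_unitCube.prod ?_)
  exact (MulOpposite.opHomeomorph.symm : (Matrix ι ι k)ᵐᵒᵖ ≃ₜ Matrix ι ι k).isCompact_preimage.2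
    isCompact_unitCube

theorem mem_maxCompact_iff {g : GL ι k} :
    g ∈ maxCompact ι k ↔ g.val ∈ unitCube ι ι k ∧ (g⁻¹).val ∈ unitCube ι ι k :=
  ⟨fun h => ⟨fun i j => (h i j).1, fun i j => (h i j).2⟩, fun h i j => ⟨h.1 i j, h.2 i j⟩⟩

variable [IsUltrametricDist k]

theorem isOpen_unitCube {m n : Type*} [Fintype m] [Fintype n] : IsOpen (unitCube m n k) := by
  rw [unitCube_eq_pi]
  exact isOpen_set_pi Set.finite_univ fun _ _ => isOpen_set_pi Set.finite_univ fun _ _ =>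
    IsUltrametricDist.isOpen_closedBall 0 one_ne_zero

theorem isOpen_maxCompact : IsOpen (maxCompact ι k) := by
  rw [maxCompact_eq_preimage]
  exact (isOpen_unitCube.prod (isOpen_unitCube.preimage MulOpposite.continuous_unop)).preimage
    gl_isClosedEmbedding.continuous

theorem unitCube_mul {l m n : Type*} [Fintype l] [Fintype m] [Fintype n] {A : Matrix l m k}
    {B : Matrix m n k} (hA : A ∈ unitCube l m k) (hB : B ∈ unitCube m n k) :
    A * B ∈ unitCube l n k := by
  intro i j
  rw [Matrix.mul_apply]
  refine IsUltrametricDist.norm_sum_le_of_forall_le_of_nonneg zero_le_one fun s _ => ?_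
  rw [norm_mul]
  exact mul_le_one₀ (hA i s) (norm_nonneg _) (hB s j)

theorem unitCube_neg {m n : Type*} [Fintype m] [Fintype n] {A : Matrix m n k}
    (hA : A ∈ unitCube m n k) : -A ∈ unitCube m n k := fun i j => by
  rw [Matrix.neg_apply, norm_neg]; exact hA i j

theorem one_mem_unitCube : (1 : Matrix ι ι k) ∈ unitCube ι ι k := fun i j => by
  rw [Matrix.one_apply]; split_ifs <;> simp

/-- The maximal compact subgroup. -/
def maxCompactSubgroup (ι k : Type*) [Fintype ι] [DecidableEq ι] [NontriviallyNormedField k]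
    [LocallyCompactSpace k] [IsUltrametricDist k] : Subgroup (GL ι k) where
  carrier := maxCompact ι k
  one_mem' := mem_maxCompact_iff.2 (by rw [inv_one]; exact ⟨one_mem_unitCube, one_mem_unitCube⟩)
  mul_mem' {g h} hg hh := by
    rw [mem_maxCompact_iff] at hg hh ⊢
    rw [mul_inv_rev]
    exact ⟨unitCube_mul hg.1 hh.1, unitCube_mul hh.2 hg.2⟩
  inv_mem' {g} hg := by
    rw [mem_maxCompact_iff] at hg ⊢
    rw [inv_inv]
    exact ⟨hg.2, hg.1⟩

theorem glHaar_ne : (Measure.haar : Measure (GL ι k)) (maxCompact ι k) ≠ 0 ∧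
    (Measure.haar : Measure (GL ι k)) (maxCompact ι k) ≠ ∞ := by
  exact ⟨(isOpen_maxCompact.measure_pos (Measure.haar : Measure (GL ι k))
    ⟨1, (maxCompactSubgroup ι k).one_mem⟩).ne',
    isCompact_maxCompact.measure_lt_top.ne⟩

theorem glHaar_maxCompact : glHaar ι k (maxCompact ι k) = 1 := by
  rw [glHaar, Measure.smul_apply, smul_eq_mul]
  exact ENNReal.inv_mul_cancel glHaar_ne.1 glHaar_ne.2

theorem glHaar_isHaar : (glHaar ι k).IsHaarMeasure := by
  exact Measure.IsHaarMeasure.smul _ (ENNReal.inv_ne_zero.2 glHaar_ne.2)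
    (ENNReal.inv_ne_top.2 glHaar_ne.1)

end GLTopology

/-! ## The Iwasawa decomposition -/

section Upper

variable {a b k : Type*} [Fintype a] [DecidableEq a] [Fintype b] [DecidableEq b] [CommRing k]

/-- The unipotent matrix `[1, u; 0, 1]`. -/
def upperGL (u : Matrix a b k) : GL (a ⊕ b) k where
  val := Matrix.fromBlocks 1 u 0 1
  inv := Matrix.fromBlocks 1 (-u) 0 1
  val_inv := by simp [Matrix.fromBlocks_multiply]
  inv_val := by simp [Matrix.fromBlocks_multiply]

theorem upperGL_val (u : Matrix a b k) : (upperGL u).val = Matrix.fromBlocks 1 u 0 1 := rfl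

theorem diagGL_val (p : GL a k × GL b k) :
    (diagGL p).val = Matrix.fromBlocks p.1.val 0 0 p.2.val := rfl

theorem upperGL_inv (u : Matrix a b k) : (upperGL u)⁻¹ = upperGL (-u) := Units.ext rfl

theorem upperGL_add (u v : Matrix a b k) : upperGL (u + v) = upperGL u * upperGL v := by
  refine Units.ext ?_
  simp [upperGL_val, Matrix.fromBlocks_multiply, add_comm]

theorem upperGL_mul_diagGL (u : Matrix a b k) (p : GL a k × GL b k) :
    upperGL u * diagGL p = diagGL p * upperGL ((p.1⁻¹).val * u * p.2.val) := by
  refine Units.ext ?_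
  simp [upperGL_val, diagGL_val, Matrix.fromBlocks_multiply, ← Matrix.mul_assoc]

theorem exists_upper_of_block_eq_zero {k : Type*} [Field k] {g : GL (a ⊕ b) k}
    (h : g.val.toBlocks₂₁ = 0) : ∃ p u, g = diagGL p * upperGL u := by
  have hg : g.val = Matrix.fromBlocks g.val.toBlocks₁₁ g.val.toBlocks₁₂ 0 g.val.toBlocks₂₂ := by
    conv_lhs => rw [← Matrix.fromBlocks_toBlocks g.val, h]
  have hdet : IsUnit (g.val.toBlocks₁₁.det * g.val.toBlocks₂₂.det) := by
    have h1 := (Matrix.isUnit_iff_isUnit_det _).1 g.isUnit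
    rw [hg, Matrix.det_fromBlocks_zero₂₁] at h1
    exact h1
  rw [IsUnit.mul_iff] at hdet
  obtain ⟨p, hp⟩ := (Matrix.isUnit_iff_isUnit_det _).2 hdet.1
  obtain ⟨q, hq⟩ := (Matrix.isUnit_iff_isUnit_det _).2 hdet.2
  refine ⟨(p, q), (p⁻¹).val * g.val.toBlocks₁₂, Units.ext ?_⟩
  rw [Units.val_mul, diagGL_val, upperGL_val, Matrix.fromBlocks_multiply]
  conv_lhs => rw [hg, ← hp, ← hq]
  simp only [Matrix.zero_mul, Matrix.mul_one, Matrix.mul_zero, add_zero, zero_add,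
    ← Matrix.mul_assoc, Units.mul_inv, Matrix.one_mul]

end Upper

/-! ### Dominant minors -/

section Columns

variable {b c k : Type*} [Fintype b] [DecidableEq b] [Fintype c] [DecidableEq c]

/-- The rows of `(C X)ᵀ` are combinations of columns of `C`. Multilinear expansion of the
determinant yields a combination of minors of `C`, which cannot all vanish. -/
theorem exists_minor_ne_zero [CommRing k] {C : Matrix b c k} {X : Matrix c b k}
    (h : (C * X).det ≠ 0) : ∃ e : b → c, (C.submatrix id e).det ≠ 0 := by
  by_contra hcon
  push Not at hcon
  apply h
  have h1 : (C * X).transpose = fun i => ∑ j, X j i • C.transpose j := by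
    ext i l
    simp [Matrix.mul_apply, Finset.sum_apply, mul_comm]
  rw [← Matrix.det_transpose, h1]
  change Matrix.detRowAlternating (fun i => ∑ j, X j i • C.transpose j) = 0
  rw [← AlternatingMap.coe_multilinearMap, MultilinearMap.map_sum]
  refine Finset.sum_eq_zero fun r _ => ?_
  rw [MultilinearMap.map_smul_univ]
  have h2 : (Matrix.detRowAlternating : (b → k) [⋀^b]→ₗ[k] k).toMultilinearMap
      (fun i => C.transpose (r i)) = (C.submatrix id r).transpose.det := rfl
  rw [h2, Matrix.det_transpose, hcon, smul_zero]

/-- Columns can be permuted so that the last block dominates. -/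
theorem exists_dominant_columns [NormedField k] {a : Type*} [Fintype a] [DecidableEq a]
    {C : Matrix b (a ⊕ b) k} {X : Matrix (a ⊕ b) b k} (h : C * X = 1) :
    ∃ w : Equiv.Perm (a ⊕ b), ∃ Z : Matrix b a k, (∀ i j, ‖Z i j‖ ≤ 1) ∧
      (C.submatrix id w).toCols₁ = (C.submatrix id w).toCols₂ * Z := by
  obtain ⟨e₀, he₀⟩ := exists_minor_ne_zero (C := C) (X := X) (by rw [h]; simp)
  obtain ⟨e, he⟩ := Finite.exists_max fun e : b → a ⊕ b => ‖(C.submatrix id e).det‖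
  have hdet : (C.submatrix id e).det ≠ 0 := by
    rw [← norm_pos_iff]
    exact (norm_pos_iff.2 he₀).trans_le (he e₀)
  have hinj : Function.Injective e := by
    intro i j hij
    by_contra hne
    exact hdet (Matrix.det_zero_of_column_eq hne fun l => by simp [hij])
  obtain ⟨w, hw⟩ := Equiv.Perm.exists_extending_pair (Sum.inr : b → a ⊕ b) e Sum.inr_injective hinj
  let S := C.submatrix id e
  have hS2 : (C.submatrix id w).toCols₂ = S := by
    ext i j
    change C i (w (Sum.inr j)) = C i (e j)
    rw [← hw]
  refine ⟨w, S⁻¹ * (C.submatrix id w).toCols₁, fun i j => ?_, ?_⟩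
  -- The columns `e` were chosen to maximize the absolute value of the minor. By Cramer's rule the
  -- entries of `Z` are quotients of other minors by this one, so they are integral.
  · have h1 : (S⁻¹ * (C.submatrix id w).toCols₁) i j =
        (S.det)⁻¹ * (C.submatrix id (Function.update e i (w (Sum.inl j)))).det := by
      have h2 := congrFun (Matrix.det_smul_inv_mulVec_eq_cramer S
        (fun l => C l (w (Sum.inl j))) (isUnit_iff_ne_zero.2 hdet)) i
      rw [Matrix.cramer_apply] at h2
      have h3 : S.updateCol i (fun l => C l (w (Sum.inl j))) =
          C.submatrix id (Function.update e i (w (Sum.inl j))) := by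
        ext l m
        by_cases hm : m = i
        · subst hm; simp
        · simp [hm, S]
      rw [h3] at h2
      rw [← h2, Pi.smul_apply, smul_eq_mul, inv_mul_cancel_left₀ hdet]
      rfl
    rw [h1, norm_mul, norm_inv, inv_mul_le_iff₀ (norm_pos_iff.2 hdet), mul_one]
    exact he _
  · rw [hS2, Matrix.mul_nonsing_inv_cancel_left _ _ (isUnit_iff_ne_zero.2 hdet)]

end Columns

/-! ### Iwasawa decomposition for the block parabolic -/

section Iwasawa

variable {a b k : Type*} [Fintype a] [DecidableEq a] [Fintype b] [DecidableEq b]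
  [NontriviallyNormedField k] [LocallyCompactSpace k] [IsUltrametricDist k]

theorem diagGL_mul_upperGL_mem_maxCompact {p : GL a k × GL b k} {u : Matrix a b k} :
    diagGL p * upperGL u ∈ maxCompact (a ⊕ b) k ↔
      (p.1 ∈ maxCompact a k ∧ p.2 ∈ maxCompact b k) ∧ u ∈ unitCube a b k := by
  have h1 : (diagGL p * upperGL u).val = Matrix.fromBlocks p.1.val (p.1.val * u) 0 p.2.val := by
    rw [Units.val_mul, diagGL_val, upperGL_val, Matrix.fromBlocks_multiply]; simp
  have h2 : ((diagGL p * upperGL u)⁻¹).val =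
      Matrix.fromBlocks (p.1⁻¹).val (-u * (p.2⁻¹).val) 0 (p.2⁻¹).val := by
    rw [mul_inv_rev, upperGL_inv, ← map_inv, Units.val_mul, diagGL_val, upperGL_val,
      Matrix.fromBlocks_multiply]; simp
  have hblock : ∀ {A : Matrix a a k} {B : Matrix a b k} {D : Matrix b b k},
      Matrix.fromBlocks A B 0 D ∈ unitCube (a ⊕ b) (a ⊕ b) k ↔
        A ∈ unitCube a a k ∧ B ∈ unitCube a b k ∧ D ∈ unitCube b b k := by
    intro A B D
    simp only [unitCube, Set.mem_setOf_eq, Sum.forall, Matrix.fromBlocks_apply₁₁,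
      Matrix.fromBlocks_apply₁₂, Matrix.fromBlocks_apply₂₁, Matrix.fromBlocks_apply₂₂,
      Matrix.zero_apply, norm_zero, zero_le_one, implies_true, true_and, forall_and]
    tauto
  rw [mem_maxCompact_iff, h1, h2, hblock, hblock, mem_maxCompact_iff, mem_maxCompact_iff]
  constructor
  · rintro ⟨⟨h3, h4, h5⟩, h6, h7, h8⟩
    refine ⟨⟨⟨h3, h6⟩, h5, h8⟩, ?_⟩
    have := unitCube_mul h6 h4
    rwa [← Matrix.mul_assoc, Units.inv_mul, Matrix.one_mul] at this
  · rintro ⟨⟨⟨h3, h6⟩, h5, h8⟩, h9⟩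
    exact ⟨⟨h3, unitCube_mul h3 h9, h5⟩, h6, unitCube_mul (unitCube_neg h9) h8, h8⟩

/-- A permutation `P` of the columns makes the last block of the lower rows dominant. An integral
column operation `N` then clears the lower left block. Both `P` and `N` lie in the maximal compact
subgroup. -/
theorem exists_iwasawa (g : GL (a ⊕ b) k) : ∃ p u, ∃ h ∈ maxCompact (a ⊕ b) k,
    g = diagGL p * upperGL u * h := by
  obtain ⟨w, Z, hZ, hw⟩ := exists_dominant_columns (C := g.val.toRows₂)
    (X := (g⁻¹).val.toCols₂) (by
      have h := g.mul_inv
      have h1 := congrArg (fun M => M.toRows₂.toCols₂) h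
      ext i j
      have h2 := congrFun (congrFun h1 i) j
      simp only [Matrix.toCols₂, Matrix.toRows₂, Matrix.of_apply] at h2
      rw [Matrix.mul_apply] at h2
      rw [Matrix.mul_apply]
      simp only [Matrix.toCols₂, Matrix.toRows₂, Matrix.of_apply]
      rw [h2]
      simp [Matrix.one_apply])
  let P : GL (a ⊕ b) k :=
    { val := (1 : Matrix (a ⊕ b) (a ⊕ b) k).submatrix id w
      inv := (1 : Matrix (a ⊕ b) (a ⊕ b) k).submatrix w id
      val_inv := by rw [Matrix.submatrix_mul_equiv]; simp
      inv_val := by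
        have := Matrix.submatrix_mul (1 : Matrix (a ⊕ b) (a ⊕ b) k) 1 w id w Function.bijective_id
        rw [← this]; simp }
  let N : GL (a ⊕ b) k :=
    { val := Matrix.fromBlocks 1 0 (-Z) 1
      inv := Matrix.fromBlocks 1 0 Z 1
      val_inv := by simp [Matrix.fromBlocks_multiply]
      inv_val := by simp [Matrix.fromBlocks_multiply] }
  have hP : P ∈ maxCompactSubgroup (a ⊕ b) k :=
    mem_maxCompact_iff.2 ⟨fun i j => one_mem_unitCube i (w j), fun i j => one_mem_unitCube (w i) j⟩
  have hN : N ∈ maxCompactSubgroup (a ⊕ b) k := by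
    refine mem_maxCompact_iff.2 ⟨?_, ?_⟩
    · rintro (i | i) (j | j)
      · exact one_mem_unitCube i j
      · simp [N]
      · simpa [N] using hZ i j
      · exact one_mem_unitCube i j
    · rintro (i | i) (j | j)
      · exact one_mem_unitCube i j
      · change ‖(0 : k)‖ ≤ 1
        simp
      · exact hZ i j
      · exact one_mem_unitCube i j
  have h0 : (g * P * N).val.toBlocks₂₁ = 0 := by
    have h1 : (g * P).val = g.val.submatrix id w := by
      change g.val * (1 : Matrix (a ⊕ b) (a ⊕ b) k).submatrix id w = _
      ext i j
      simp [Matrix.mul_apply, Matrix.one_apply]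
    have h2 : (g.val.submatrix id w).toBlocks₂₁ = (g.val.submatrix id w).toBlocks₂₂ * Z := hw
    change ((g * P).val * Matrix.fromBlocks 1 0 (-Z) 1).toBlocks₂₁ = 0
    rw [h1, ← Matrix.fromBlocks_toBlocks (g.val.submatrix id w), Matrix.fromBlocks_multiply,
      Matrix.toBlocks_fromBlocks₂₁, h2]
    simp
  obtain ⟨p, u, hpu⟩ := exists_upper_of_block_eq_zero h0
  refine ⟨p, u, N⁻¹ * P⁻¹, (maxCompactSubgroup (a ⊕ b) k).mul_mem
    ((maxCompactSubgroup (a ⊕ b) k).inv_mem hN) ((maxCompactSubgroup (a ⊕ b) k).inv_mem hP), ?_⟩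
  rw [← hpu]
  group

end Iwasawa

/-! ## Integration over quotients by means of weights -/

section Iwasawa

variable {G T : Type*} [Group G] [MeasurableSpace G] [MeasurableMul₂ G] [MeasurableInv G]
  [MeasurableSpace T]

/-- If every coset of `K` has preimage of volume one under `j`, then integration over the group
is integration over `T × K`. -/
theorem lintegral_eq_of_coset_measure (μ : Measure G) [μ.IsMulLeftInvariant] [SFinite μ]
    (τ : Measure T) [SFinite τ] {j : T → G} (hj : Measurable j) (K : Subgroup G)
    (hK : MeasurableSet (K : Set G)) (h : ∀ g, τ {t | g⁻¹ * j t ∈ K} = 1) {φ : G → ℝ≥0∞}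
    (hφ : Measurable φ) :
    ∫⁻ g, φ g ∂μ = ∫⁻ t, ∫⁻ k in K, φ (j t * k) ∂μ ∂τ := by
  have h1 : ∀ t, ∫⁻ k in K, φ (j t * k) ∂μ =
      ∫⁻ g, (K : Set G).indicator 1 ((j t)⁻¹ * g) * φ g ∂μ := by
    intro t
    rw [← lintegral_mul_left_eq_self (μ := μ) _ (j t), ← lintegral_indicator hK]
    refine lintegral_congr fun k => ?_
    rw [inv_mul_cancel_left]
    by_cases hk : k ∈ (K : Set G) <;> simp [hk]
  simp_rw [h1]
  have hm : Measurable fun p : T × G => (K : Set G).indicator (1 : G → ℝ≥0∞) ((j p.1)⁻¹ * p.2) :=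
    (measurable_one.indicator hK).comp ((hj.comp measurable_fst).inv.mul measurable_snd)
  -- After translating `k` by `j t`, left invariance and Tonelli leave each `g` weighted by the
  -- volume of the `t` with `j t` in `g K`, which is one. No modulus function enters.
  rw [lintegral_lintegral_swap (hm.mul (hφ.comp measurable_snd)).aemeasurable]
  refine lintegral_congr fun g => ?_
  have hm' : Measurable fun t => (K : Set G).indicator (1 : G → ℝ≥0∞) ((j t)⁻¹ * g) :=
    hm.comp measurable_prodMk_right
  rw [lintegral_mul_const _ hm']
  have h2 : ∀ t, (K : Set G).indicator (1 : G → ℝ≥0∞) ((j t)⁻¹ * g) =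
      {t | g⁻¹ * j t ∈ K}.indicator 1 t := by
    intro t
    have : (j t)⁻¹ * g ∈ (K : Set G) ↔ t ∈ {t | g⁻¹ * j t ∈ K} := by
      rw [SetLike.mem_coe, ← K.inv_mem_iff, mul_inv_rev, inv_inv]; rfl
    by_cases ht : t ∈ {t | g⁻¹ * j t ∈ K}
    · rw [Set.indicator_of_mem ht, Set.indicator_of_mem (this.2 ht)]; rfl
    · rw [Set.indicator_of_notMem ht, Set.indicator_of_notMem (fun h => ht (this.1 h))]
  simp_rw [h2]
  have hms : MeasurableSet {t | g⁻¹ * j t ∈ K} := (measurable_const.mul hj) hK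
  rw [lintegral_indicator_one hms, h, one_mul]

theorem map_eq_of_coset_measure (μ : Measure G) [μ.IsMulLeftInvariant] [SFinite μ]
    (τ : Measure T) [SFinite τ] {j : T → G} (hj : Measurable j) (K : Subgroup G)
    (hK : MeasurableSet (K : Set G)) (h : ∀ g, τ {t | g⁻¹ * j t ∈ K} = 1) :
    (τ.prod (μ.restrict K)).map (fun p => j p.1 * p.2) = μ := by
  have hm : Measurable fun p : T × G => j p.1 * p.2 := (hj.comp measurable_fst).mul measurable_snd
  refine Measure.ext_of_lintegral _ fun φ hφ => ?_
  rw [lintegral_map hφ hm, lintegral_prod (fun p : T × G => φ (j p.1 * p.2))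
    (hφ.comp hm).aemeasurable, lintegral_eq_of_coset_measure μ τ hj K hK h hφ]

end Iwasawa

/-! ### Weights on quotients -/

section Weight

variable {A : Type*} [Group A] [MeasurableSpace A] {S : Subgroup A}

/-- A function whose integral over every orbit of `S` is one. -/
structure IsWeight (S : Subgroup A) (ν : Measure S) (θ : A → NNReal) : Prop where
  measurable : Measurable θ
  lintegral_eq_one : ∀ a, ∫⁻ s : S, (θ ((s : A) * a) : ℝ≥0∞) ∂ν = 1

/-- Invariance under left multiplication by `S`. -/
def IsLeftInvariant {X : Type*} (S : Subgroup A) (Φ : A → X) : Prop :=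
  ∀ s ∈ S, ∀ a, Φ (s * a) = Φ a

theorem IsLeftInvariant.out_mk {X : Type*} {Φ : A → X} (hΦ : IsLeftInvariant S Φ) (a : A) :
    Φ (Quotient.mk (QuotientGroup.rightRel S) a).out = Φ a := by
  have h : (QuotientGroup.rightRel S) (Quotient.mk (QuotientGroup.rightRel S) a).out a :=
    Quotient.exact (Quotient.out_eq _)
  rw [QuotientGroup.rightRel_apply] at h
  have := hΦ _ h (Quotient.mk (QuotientGroup.rightRel S) a).out
  rw [inv_mul_cancel_right] at this
  exact this.symm

theorem IsLeftInvariant.measurable_out {X : Type*} [MeasurableSpace X] {Φ : A → X}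
    (hΦ : IsLeftInvariant S Φ) (hm : Measurable Φ) :
    Measurable fun q : Quotient (QuotientGroup.rightRel S) => Φ q.out := by
  refine measurable_from_quotient.2 ?_
  have : (fun q : Quotient (QuotientGroup.rightRel S) => Φ q.out) ∘ Quotient.mk'' = Φ :=
    funext fun a => hΦ.out_mk a
  rwa [this]

variable {μ : Measure A} {ν : Measure S} {ρ : Measure (Quotient (QuotientGroup.rightRel S))}
  [MeasurableMul A]

/-- On each orbit of `S` the function `Φ` is constant while `θ` integrates to one, so the fibre
integral of `θ Φ` is the value of `Φ`. -/
theorem IsWeight.lintegral (hρ : IsQuotientMeasure μ S ν ρ) {θ : A → NNReal}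
    (hθ : IsWeight S ν θ) {Φ : A → ℝ≥0∞} (hm : Measurable Φ) (hΦ : IsLeftInvariant S Φ) :
    ∫⁻ q, Φ q.out ∂ρ = ∫⁻ a, θ a * Φ a ∂μ := by
  refine Eq.trans ?_ (hρ (fun a => θ a * Φ a) (hθ.measurable.coe_nnreal_ennreal.mul hm)).symm
  refine lintegral_congr fun q => ?_
  have h1 : ∀ s : S, Φ ((s : A) * q.out) = Φ q.out := fun s => hΦ s s.2 _
  simp_rw [h1]
  have h2 : Measurable fun s : S => (θ ((s : A) * q.out) : ℝ≥0∞) :=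
    (hθ.measurable.comp ((measurable_mul_const q.out).comp measurable_subtype_coe)).coe_nnreal_ennreal
  rw [lintegral_mul_const _ h2, hθ.lintegral_eq_one, one_mul]

/-- The quotient measure is thus the image of `θ μ`, which carries Bochner integrals and
integrability over to the group. -/
theorem IsWeight.eq_map (hρ : IsQuotientMeasure μ S ν ρ) {θ : A → NNReal}
    (hθ : IsWeight S ν θ) :
    ρ = (μ.withDensity fun a => θ a).map (Quotient.mk (QuotientGroup.rightRel S)) := by
  have hmk : Measurable (Quotient.mk (QuotientGroup.rightRel S)) := measurable_quotient_mk''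
  refine Measure.ext_of_lintegral _ fun φ hφ => ?_
  rw [lintegral_map hφ hmk]
  refine Eq.trans ?_ (lintegral_withDensity_eq_lintegral_mul _
    hθ.measurable.coe_nnreal_ennreal (hφ.comp hmk)).symm
  have hinv : IsLeftInvariant S (φ ∘ Quotient.mk (QuotientGroup.rightRel S)) := by
    intro s hs a
    refine congrArg φ (Quotient.sound ?_)
    change QuotientGroup.rightRel S _ _
    rw [QuotientGroup.rightRel_apply]
    simpa using S.inv_mem hs
  refine Eq.trans ?_ (hθ.lintegral hρ (hφ.comp hmk) hinv)
  simp only [Function.comp_apply, Quotient.out_eq]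

theorem IsWeight.integral (hρ : IsQuotientMeasure μ S ν ρ) {θ : A → NNReal}
    (hθ : IsWeight S ν θ) {Φ : A → ℂ} (hm : Measurable Φ) (hΦ : IsLeftInvariant S Φ) :
    ∫ q, Φ q.out ∂ρ = ∫ a, θ a • Φ a ∂μ := by
  have hmk : Measurable (Quotient.mk (QuotientGroup.rightRel S)) := measurable_quotient_mk''
  rw [hθ.eq_map hρ, integral_map hmk.aemeasurable (hΦ.measurable_out hm).aestronglyMeasurable,
    integral_withDensity_eq_integral_smul hθ.measurable]
  simp_rw [hΦ.out_mk]

theorem IsWeight.integrable (hρ : IsQuotientMeasure μ S ν ρ) {θ : A → NNReal}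
    (hθ : IsWeight S ν θ) {Φ : A → ℂ} (hm : Measurable Φ) (hΦ : IsLeftInvariant S Φ) :
    Integrable (fun q : Quotient (QuotientGroup.rightRel S) => Φ q.out) ρ ↔
      Integrable (fun a => θ a • Φ a) μ := by
  have hmk : Measurable (Quotient.mk (QuotientGroup.rightRel S)) := measurable_quotient_mk''
  rw [hθ.eq_map hρ, integrable_map_measure (hΦ.measurable_out hm).aestronglyMeasurable
    hmk.aemeasurable, ← integrable_withDensity_iff_integrable_smul hθ.measurable]
  refine integrable_congr (Filter.Eventually.of_forall fun a => ?_)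
  exact hΦ.out_mk a

end Weight

/-! ### Descent of integrals to a subgroup with the same stabilizer -/

section Descent

variable {A B U : Type*} [Group A] [MeasurableSpace A] [MeasurableMul₂ A] [Group B]
  [MeasurableSpace B] [MeasurableMul₂ B] [MeasurableSpace U]
  {S : Subgroup A} {R : Subgroup B} {μ : Measure A} {μB : Measure B} {ν : Measure R}
  {i : R →* S} {ρ : Measure (Quotient (QuotientGroup.rightRel S))}
  {ρB : Measure (Quotient (QuotientGroup.rightRel R))}

/-- The measure on `S` is the image of that on `R`, so orbit integrals over `R` are orbit integrals
over `S` based at `j m * c`. It matters that every right translate by `c` is again a weight. -/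
theorem IsWeight.comp_mul {θ : A → NNReal} (hθ : IsWeight S (ν.map i) θ) (hi : Measurable i)
    {j : B →* A} (hj : Measurable j) (hij : ∀ r : R, (i r : A) = j r) (c : A) :
    IsWeight R ν fun m => θ (j m * c) where
  measurable := hθ.measurable.comp (hj.mul_const c)
  lintegral_eq_one m := by
    have h := hθ.lintegral_eq_one (j m * c)
    have hm : Measurable fun s : S => (θ ((s : A) * (j m * c)) : ℝ≥0∞) :=
      (hθ.measurable.comp ((measurable_mul_const _).comp
        measurable_subtype_coe)).coe_nnreal_ennreal
    rw [lintegral_map hm hi] at h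
    rw [← h]
    refine lintegral_congr fun r => ?_
    rw [hij, map_mul, mul_assoc]

/-- Descent of integrals over quotients: integration over `S \ A` in terms of integration over
`R \ B`, when `A` decomposes as `B U`. -/
theorem integral_quotient_descent [SFinite μB] {μU : Measure U} [SFinite μU] {j : B →* A}
    (hj : Measurable j) {υ : U → A} (hυ : Measurable υ)
    (hμ : μ = (μB.prod μU).map fun p => j p.1 * υ p.2)
    (hi : Measurable i) (hij : ∀ r : R, (i r : A) = j r)
    (hρ : IsQuotientMeasure μ S (ν.map i) ρ) (hρB : IsQuotientMeasure μB R ν ρB)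
    {θ : A → NNReal} (hθ : IsWeight S (ν.map i) θ) {Φ : A → ℂ} (hm : Measurable Φ)
    (hΦ : IsLeftInvariant S Φ)
    (hint : Integrable (fun q : Quotient (QuotientGroup.rightRel S) => Φ q.out) ρ) :
    Integrable (fun q : Quotient (QuotientGroup.rightRel R) => ∫ u, Φ (j q.out * υ u) ∂μU) ρB ∧
    ∫ q, Φ q.out ∂ρ = ∫ q, ∫ u, Φ (j q.out * υ u) ∂μU ∂ρB := by
  have hinv : ∀ c, IsLeftInvariant R fun m => Φ (j m * c) := by
    intro c r hr m
    have := hΦ (i ⟨r, hr⟩) (i ⟨r, hr⟩).2 (j m * c)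
    rw [hij] at this
    simpa [mul_assoc] using this
  have hmc : ∀ c, Measurable fun m => Φ (j m * c) := fun c => hm.comp (hj.mul_const c)
  have hjυ : Measurable fun p : B × U => j p.1 * υ p.2 :=
    (hj.comp measurable_fst).mul (hυ.comp measurable_snd)
  have hw : ∀ c, IsWeight R ν fun m => θ (j m * c) := hθ.comp_mul hi hj hij
  have hw1 : IsWeight R ν fun m => θ (j m) := by simpa using hw 1
  have hΨm : Measurable fun m => ∫ u, Φ (j m * υ u) ∂μU :=
    ((hm.comp hjυ).stronglyMeasurable.integral_prod_right (f := fun m u => Φ (j m * υ u))).measurable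
  have hΨi : IsLeftInvariant R fun m => ∫ u, Φ (j m * υ u) ∂μU := by
    intro r hr m
    exact integral_congr_ae (Filter.Eventually.of_forall fun u => hinv (υ u) r hr m)
  rw [hw1.integrable hρB hΨm hΨi, hw1.integral hρB hΨm hΨi, hθ.integral hρ hm hΦ]
  rw [hθ.integrable hρ hm hΦ] at hint
  have hθΦ : Measurable fun a => θ a • Φ a := hθ.measurable.smul hm
  have hint' : Integrable (fun p : B × U => θ (j p.1 * υ p.2) • Φ (j p.1 * υ p.2))
      (μB.prod μU) := by
    rw [hμ] at hint
    exact (integrable_map_measure hθΦ.aestronglyMeasurable hjυ.aemeasurable).1 hint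
  have hm1 : Measurable fun p : B × U => θ (j p.1) • Φ (j p.1 * υ p.2) :=
    (hθ.measurable.comp (hj.comp measurable_fst)).smul (hm.comp hjυ)
  -- For fixed `u`, both `m ↦ θ(m u)` and `m ↦ θ(m)` are weights for `R`, so either one computes the
  -- integral of `‖Φ(m u)‖` over `R \ B`. Integrability therefore passes from one weight to the
  -- other.
  have hint1 : Integrable (fun p : B × U => θ (j p.1) • Φ (j p.1 * υ p.2)) (μB.prod μU) := by
    refine ⟨hm1.aestronglyMeasurable, ?_⟩
    have h1 := hint'.2
    rw [hasFiniteIntegral_iff_enorm] at h1 ⊢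
    refine lt_of_eq_of_lt ?_ h1
    refine (lintegral_prod_symm' _ hm1.enorm).trans
      (Eq.trans ?_ (lintegral_prod_symm' _ (hθΦ.comp hjυ).enorm).symm)
    refine lintegral_congr fun u => ?_
    have h2 : ∀ t : NNReal, ∀ z : ℂ, ‖t • z‖ₑ = t * ‖z‖ₑ := fun t z => by
      rw [NNReal.smul_def, enorm_smul]; simp
    simp_rw [Function.comp_apply, h2]
    have e1 := hw1.lintegral hρB (hmc (υ u)).enorm
      (fun r hr m => congrArg _ (hinv (υ u) r hr m))
    have e2 := (hw (υ u)).lintegral hρB (hmc (υ u)).enorm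
      (fun r hr m => congrArg _ (hinv (υ u) r hr m))
    exact e1.symm.trans e2
  have hpull : ∀ m, θ (j m) • ∫ u, Φ (j m * υ u) ∂μU = ∫ u, θ (j m) • Φ (j m * υ u) ∂μU := by
    intro m
    rw [NNReal.smul_def, ← integral_smul]; rfl
  simp_rw [hpull]
  refine ⟨hint1.integral_prod_left, ?_⟩
  rw [integral_integral (f := fun m u => θ (j m) • Φ (j m * υ u)) hint1, hμ,
    integral_map hjυ.aemeasurable hθΦ.aestronglyMeasurable,
    integral_prod_symm _ hint', integral_prod_symm _ hint1]
  -- The same comparison of the two weights, for each `u`, now for the integrals themselves.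
  refine integral_congr_ae (Filter.Eventually.of_forall fun u => ?_)
  exact ((hw (υ u)).integral hρB (hmc (υ u)) (hinv (υ u))).symm.trans
    (hw1.integral hρB (hmc (υ u)) (hinv (υ u)))

end Descent

/-! ## Existence of weights and convergence -/

section Cosets

variable {A : Type*} [Group A] [TopologicalSpace A] [IsTopologicalGroup A]

theorem isLocallyConstant_of_right_invariant {X : Type*} {K : Subgroup A} (hK : IsOpen (K : Set A))
    {f : A → X} (hf : ∀ a, ∀ k ∈ K, f (a * k) = f a) : IsLocallyConstant f := by
  rw [IsLocallyConstant.iff_exists_open]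
  refine fun a => ⟨(fun x => a⁻¹ * x) ⁻¹' (K : Set A), hK.preimage (continuous_const_mul _), ?_,
    fun x hx => ?_⟩
  · simp [K.one_mem]
  · have := hf a _ hx
    rwa [mul_inv_cancel_left] at this

theorem isOpen_of_right_invariant {K : Subgroup A} (hK : IsOpen (K : Set A)) {s : Set A}
    (hs : ∀ a ∈ s, ∀ k ∈ K, a * k ∈ s) : IsOpen s := by
  have : IsLocallyConstant fun a => a ∈ s := isLocallyConstant_of_right_invariant hK fun a k hk =>
    propext ⟨fun h => by simpa using hs _ h k⁻¹ (K.inv_mem hk), fun h => hs a h k hk⟩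
  have h1 := this {True}
  convert h1 using 1
  ext a
  simp

variable [MeasurableSpace A] [BorelSpace A] {S K : Subgroup A} {μ : Measure A} {ν : Measure S}
  {ρ : Measure (Quotient (QuotientGroup.rightRel S))}

/-- The points of the quotient in the double coset of `r`. -/
def doubleCosetSet (S K : Subgroup A) (r : A) : Set (Quotient (QuotientGroup.rightRel S)) :=
  {q | ∃ s ∈ S, ∃ k ∈ K, q.out = s * r * k}

/-- Within the double coset `S r K` the factor in `K` does not affect membership, and the factor in
`S` is removed by right invariance of `ν`. -/
theorem measure_coset_eq [ν.IsMulRightInvariant] [MeasurableMul S]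
    {a r : A} (h : ∃ s ∈ S, ∃ k ∈ K, a = s * r * k) :
    ν {s : S | r⁻¹ * ((s : A) * a) ∈ K} = ν {s : S | r⁻¹ * ((s : A) * r) ∈ K} := by
  obtain ⟨s₀, hs₀, k, hk, rfl⟩ := h
  rw [← measure_preimage_mul_right ν ⟨s₀, hs₀⟩ {s : S | r⁻¹ * ((s : A) * r) ∈ K}]
  congr 1
  ext s
  simp only [Set.mem_setOf_eq, Set.mem_preimage, Subgroup.coe_mul]
  have : r⁻¹ * ((s : A) * (s₀ * r * k)) = r⁻¹ * (s * s₀ * r) * k := by group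
  rw [this]
  exact K.mul_mem_cancel_right hk

theorem coset_eq_empty {a r : A} (h : ¬ ∃ s ∈ S, ∃ k ∈ K, a = s * r * k) :
    {s : S | r⁻¹ * ((s : A) * a) ∈ K} = ∅ := by
  refine Set.eq_empty_iff_forall_notMem.2 fun s hs => h ⟨(s : A)⁻¹, S.inv_mem s.2, _, hs, ?_⟩
  group

theorem measurableSet_coset (hK : IsOpen (K : Set A)) (a r : A) :
    MeasurableSet {s : S | r⁻¹ * ((s : A) * a) ∈ K} := by
  refine (hK.preimage (f := fun s : A => r⁻¹ * (s * a)) ?_).measurableSet.preimage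
    measurable_subtype_coe
  fun_prop

theorem measurableSet_doubleCosetSet (hK : IsOpen (K : Set A)) (r : A) :
    MeasurableSet (doubleCosetSet S K r) := by
  have h1 : MeasurableSet {a : A | ∃ s ∈ S, ∃ k ∈ K, a = s * r * k} := by
    refine (isOpen_of_right_invariant hK ?_).measurableSet
    rintro a ⟨s, hs, k, hk, rfl⟩ k' hk'
    exact ⟨s, hs, k * k', K.mul_mem hk hk', by group⟩
  have h2 : IsLeftInvariant S fun a : A => (a ∈ {a : A | ∃ s ∈ S, ∃ k ∈ K, a = s * r * k}) := by
    intro s hs a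
    refine propext ⟨?_, ?_⟩
    · rintro ⟨s', hs', k, hk, h⟩
      exact ⟨s⁻¹ * s', S.mul_mem (S.inv_mem hs) hs', k, hk, by
        rw [← inv_mul_cancel_left s a, h]; group⟩
    · rintro ⟨s', hs', k, hk, rfl⟩
      exact ⟨s * s', S.mul_mem hs hs', k, hk, by group⟩
  exact measurableSet_setOf.2 (h2.measurable_out (measurableSet_setOf.1 h1))

variable [ν.IsMulRightInvariant] [MeasurableMul S]

/-- The defining identity of the quotient measure, applied to the indicator of `r K`: its inner
integral is constant on the double coset of `r` and zero elsewhere. -/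
theorem measure_coset_mul (hρ : IsQuotientMeasure μ S ν ρ) (hK : IsOpen (K : Set A)) (r : A) :
    μ {a | r⁻¹ * a ∈ K} = ν {s : S | r⁻¹ * ((s : A) * r) ∈ K} * ρ (doubleCosetSet S K r) := by
  have hm : MeasurableSet {a | r⁻¹ * a ∈ K} :=
    (hK.preimage (continuous_const_mul r⁻¹)).measurableSet
  have h := hρ ({a | r⁻¹ * a ∈ K}.indicator 1) (measurable_one.indicator hm)
  rw [lintegral_indicator_one hm] at h
  rw [h, ← lintegral_indicator_const (measurableSet_doubleCosetSet hK r)]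
  refine lintegral_congr fun q => ?_
  have h1 : ∀ s : S, ({a | r⁻¹ * a ∈ K}.indicator 1 ((s : A) * q.out) : ℝ≥0∞) =
      {s : S | r⁻¹ * ((s : A) * q.out) ∈ K}.indicator 1 s := fun s => rfl
  simp_rw [h1]
  rw [lintegral_indicator_one (measurableSet_coset hK _ _)]
  by_cases hq : q ∈ doubleCosetSet S K r
  · rw [Set.indicator_of_mem hq, measure_coset_eq hq]
  · rw [Set.indicator_of_notMem hq, coset_eq_empty hq, measure_empty]

/-- Since a coset of `K` has finite positive volume, the product formula forces the volume of `S ∩ r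
K r⁻¹` to be finite and positive, and that of the double coset to be finite. Nothing about the
topology of `S` is needed. -/
theorem measure_coset_ne (hρ : IsQuotientMeasure μ S ν ρ) (hK : IsOpen (K : Set A)) {r : A}
    (h0 : μ {a | r⁻¹ * a ∈ K} ≠ 0) (h1 : μ {a | r⁻¹ * a ∈ K} ≠ ∞) :
    ν {s : S | r⁻¹ * ((s : A) * r) ∈ K} ≠ 0 ∧ ν {s : S | r⁻¹ * ((s : A) * r) ∈ K} ≠ ∞ ∧
      ρ (doubleCosetSet S K r) ≠ ∞ := by
  rw [measure_coset_mul hρ hK] at h0 h1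
  refine ⟨left_ne_zero_of_mul h0, fun h => h1 ?_, fun h => h1 ?_⟩
  · rw [h, ENNReal.top_mul (right_ne_zero_of_mul h0)]
  · rw [h, ENNReal.mul_top (left_ne_zero_of_mul h0)]

/-- Choose one `r` in each double coset of `S` and `K`, and let `θ` on `r K` be the inverse of the
volume of `S ∩ r K r⁻¹`, and zero on the rest of the double coset. It is right `K`-invariant, hence
locally constant and measurable. -/
theorem exists_weight (hρ : IsQuotientMeasure μ S ν ρ) (hK : IsOpen (K : Set A))
    (h0 : ∀ r, μ {a | r⁻¹ * a ∈ K} ≠ 0) (h1 : ∀ r, μ {a | r⁻¹ * a ∈ K} ≠ ∞) :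
    ∃ θ : A → NNReal, IsWeight S ν θ := by
  classical
  let r : A → A := fun a => (Quotient.mk (DoubleCoset.setoid (S : Set A) K) a).out
  have hr : ∀ a, ∃ s ∈ S, ∃ k ∈ K, a = s * r a * k := by
    intro a
    have h : DoubleCoset.setoid (S : Set A) (K : Set A) (r a) a :=
      Quotient.exact (Quotient.out_eq _)
    exact DoubleCoset.rel_iff.1 h
  have hrs : ∀ a, ∀ s ∈ S, ∀ k ∈ K, r (s * a * k) = r a := by
    intro a s hs k hk
    refine congrArg Quotient.out (Quotient.sound ?_).symm
    exact DoubleCoset.rel_iff.2 ⟨s, hs, k, hk, rfl⟩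
  let v : A → ℝ≥0∞ := fun x => ν {s : S | x⁻¹ * ((s : A) * x) ∈ K}
  let θ : A → NNReal := fun a => if (r a)⁻¹ * a ∈ K then (v (r a))⁻¹.toNNReal else 0
  refine ⟨θ, ?_, fun a => ?_⟩
  · have : IsLocallyConstant θ := by
      refine isLocallyConstant_of_right_invariant hK fun a k hk => ?_
      have h2 : r (a * k) = r a := by simpa using hrs a 1 S.one_mem k hk
      simp only [θ, h2, ← mul_assoc, K.mul_mem_cancel_right hk]
    exact this.continuous.measurable
  · obtain ⟨hv0, hv1, -⟩ := measure_coset_ne hρ hK (h0 (r a)) (h1 (r a))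
    have h2 : ∀ s : S, (θ ((s : A) * a) : ℝ≥0∞) =
        {s : S | (r a)⁻¹ * ((s : A) * a) ∈ K}.indicator (fun _ => (v (r a))⁻¹) s := by
      intro s
      have h3 : r ((s : A) * a) = r a := by simpa using hrs a s s.2 1 K.one_mem
      by_cases hs : (r a)⁻¹ * ((s : A) * a) ∈ K
      · rw [Set.indicator_of_mem (by exact hs)]
        simp only [θ, h3, hs, if_true]
        exact ENNReal.coe_toNNReal (ENNReal.inv_ne_top.2 hv0)
      · rw [Set.indicator_of_notMem (by exact hs)]
        simp only [θ, h3, hs, if_false, ENNReal.coe_zero]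
    simp_rw [h2]
    rw [lintegral_indicator_const (measurableSet_coset hK _ _), measure_coset_eq (hr a)]
    exact ENNReal.inv_mul_cancel hv0 hv1

theorem integrable_of_support_subset (hρ : IsQuotientMeasure μ S ν ρ) (hK : IsOpen (K : Set A))
    (h0 : ∀ r, μ {a | r⁻¹ * a ∈ K} ≠ 0) (h1 : ∀ r, μ {a | r⁻¹ * a ∈ K} ≠ ∞) {Φ : A → ℂ}
    (hm : Measurable Φ) (hΦ : IsLeftInvariant S Φ) {C : ℝ} (hC : ∀ a, ‖Φ a‖ ≤ C) (t : Finset A)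
    (ht : ∀ a, Φ a ≠ 0 → ∃ r ∈ t, ∃ s ∈ S, ∃ k ∈ K, a = s * r * k) :
    Integrable (fun q : Quotient (QuotientGroup.rightRel S) => Φ q.out) ρ := by
  let B : Set (Quotient (QuotientGroup.rightRel S)) := ⋃ r ∈ t, doubleCosetSet S K r
  have hB : ρ B < ∞ := by
    refine (measure_biUnion_finset_le t _).trans_lt (ENNReal.sum_lt_top.2 fun r _ => ?_)
    exact (measure_coset_ne hρ hK (h0 r) (h1 r)).2.2.lt_top
  rw [← integrableOn_iff_integrable_of_support_subset (s := B)]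
  · exact Measure.integrableOn_of_bounded hB.ne (hΦ.measurable_out hm).aestronglyMeasurable
      (M := C) (Filter.Eventually.of_forall fun q => hC _)
  · intro q hq
    obtain ⟨r, hr, h⟩ := ht _ hq
    exact Set.mem_biUnion hr h

end Cosets

/-! ## The groups acting, their Haar measures and Iwasawa decompositions -/

section Reindex

variable {a b k : Type*} [Fintype a] [DecidableEq a] [Fintype b] [DecidableEq b] [CommRing k]

/-- Reordering of blocks. -/
def blockSwap (a b k : Type*) [Fintype a] [DecidableEq a] [Fintype b] [DecidableEq b]
    [CommRing k] : GL ((a ⊕ a) ⊕ (b ⊕ b)) k ≃* GL ((a ⊕ b) ⊕ (a ⊕ b)) k :=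
  Units.mapEquiv (Matrix.reindexAlgEquiv k k (Equiv.sumSumSumComm a a b b) : _ ≃* _)

theorem levi_eq (p : GL (a ⊕ a) k × GL (b ⊕ b) k) : levi p = blockSwap a b k (diagGL p) := rfl

theorem unip_eq (u : Matrix (a ⊕ a) (b ⊕ b) k) : unip u = blockSwap a b k (upperGL u) := rfl

theorem blockSwap_val (g : GL ((a ⊕ a) ⊕ (b ⊕ b)) k) : (blockSwap a b k g).val =
    g.val.submatrix (Equiv.sumSumSumComm a a b b).symm (Equiv.sumSumSumComm a a b b).symm := rfl

theorem unip_add (u v : Matrix (a ⊕ a) (b ⊕ b) k) : unip (u + v) = unip u * unip v := by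
  rw [unip_eq, unip_eq, unip_eq, upperGL_add, map_mul]

theorem unip_neg (u : Matrix (a ⊕ a) (b ⊕ b) k) : unip (-u) = (unip u)⁻¹ := by
  rw [unip_eq, unip_eq, ← map_inv, upperGL_inv]

theorem unip_mul_levi (u : Matrix (a ⊕ a) (b ⊕ b) k) (p : GL (a ⊕ a) k × GL (b ⊕ b) k) :
    unip u * levi p = levi p * unip ((p.1⁻¹).val * u * p.2.val) := by
  rw [unip_eq, unip_eq, levi_eq, ← map_mul, upperGL_mul_diagGL, map_mul]

theorem unip_conj_levi (u : Matrix (a ⊕ a) (b ⊕ b) k) (p : GL (a ⊕ a) k × GL (b ⊕ b) k) :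
    levi p * unip u = unip (p.1.val * u * (p.2⁻¹).val) * levi p := by
  rw [unip_mul_levi]
  simp only [← Matrix.mul_assoc, Units.inv_mul, Matrix.one_mul]
  rw [Matrix.mul_assoc, Units.inv_mul, Matrix.mul_one]

theorem diagGL_upperGL (P Q : Matrix a b k) :
    diagGL (upperGL P, upperGL Q) = unip (Matrix.fromBlocks P 0 0 Q) := by
  refine Units.ext ?_
  rw [unip_eq, blockSwap_val, diagGL_val, upperGL_val, upperGL_val, upperGL_val]
  ext ((i | i) | (i | i)) ((j | j) | (j | j)) <;> simp [Matrix.one_apply]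

theorem unip_map {F E : Type*} [Field F] [Field E] [Algebra F E] (u : Matrix (a ⊕ a) (b ⊕ b) F) :
    extGL F E (unip u) = unip (u.map (algebraMap F E)) := by
  refine Units.ext ?_
  change (unip u).val.map (algebraMap F E) = _
  rw [unip_eq, unip_eq, blockSwap_val, blockSwap_val, upperGL_val, upperGL_val]
  ext ((i | i) | (i | i)) ((j | j) | (j | j)) <;> simp [Matrix.one_apply, apply_ite]

theorem blockSwap_mem_maxCompact {k : Type*} [NontriviallyNormedField k]
    {g : GL ((a ⊕ a) ⊕ (b ⊕ b)) k} :
    blockSwap a b k g ∈ maxCompact ((a ⊕ b) ⊕ (a ⊕ b)) k ↔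
      g ∈ maxCompact ((a ⊕ a) ⊕ (b ⊕ b)) k := by
  let e := Equiv.sumSumSumComm a a b b
  constructor
  · intro h i j
    have h1 := h (e i) (e j)
    rw [← map_inv, blockSwap_val, blockSwap_val, Matrix.submatrix_apply, Matrix.submatrix_apply,
      Equiv.symm_apply_apply, Equiv.symm_apply_apply] at h1
    exact h1
  · intro h i j
    rw [← map_inv, blockSwap_val, blockSwap_val]
    exact h _ _

end Reindex

/-! ### Haar measures and integral points of the acting groups -/

section Groups

attribute [local instance] properSpace_of_locallyCompact matrixBorel matrixBorel_borelSpace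
  matrix_secondCountable matHaar_isAddHaar gl_secondCountable glHaar_isHaar

theorem glHaar_sFinite (ι k : Type*) [Fintype ι] [DecidableEq ι] [NontriviallyNormedField k]
    [LocallyCompactSpace k] [IsUltrametricDist k] : SFinite (glHaar ι k) := inferInstance

theorem gl_measurableMul₂ (ι k : Type*) [Fintype ι] [DecidableEq ι] [NontriviallyNormedField k]
    [LocallyCompactSpace k] : MeasurableMul₂ (GL ι k) := inferInstance

theorem prod_measurableMul₂ {G H : Type*} [Mul G] [MeasurableSpace G] [MeasurableMul₂ G] [Mul H]
    [MeasurableSpace H] [MeasurableMul₂ H] : MeasurableMul₂ (G × H) :=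
  ⟨(((measurable_fst.comp measurable_fst).mul (measurable_fst.comp measurable_snd)).prodMk
    ((measurable_snd.comp measurable_fst).mul (measurable_snd.comp measurable_snd)))⟩

attribute [local instance] prod_measurableMul₂ glHaar_sFinite gl_measurableMul₂

variable (F E : Type*) [NontriviallyNormedField F] [LocallyCompactSpace F] [IsUltrametricDist F]
  [NontriviallyNormedField E] [LocallyCompactSpace E] [IsUltrametricDist E]

set_option synthInstance.maxHeartbeats 200000

section One

variable (ι : Type*) [Fintype ι] [DecidableEq ι]

/-- The maximal compact subgroup of `H' × H''`. -/
def compactG : Subgroup ((GL ι E × GL ι E) × GL (ι ⊕ ι) F) :=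
  ((maxCompactSubgroup ι E).prod (maxCompactSubgroup ι E)).prod (maxCompactSubgroup (ι ⊕ ι) F)

theorem compactG_coe : (compactG F E ι : Set ((GL ι E × GL ι E) × GL (ι ⊕ ι) F)) =
    (maxCompact ι E ×ˢ maxCompact ι E) ×ˢ maxCompact (ι ⊕ ι) F := rfl

theorem isOpen_compactG :
    IsOpen (compactG F E ι : Set ((GL ι E × GL ι E) × GL (ι ⊕ ι) F)) :=
  (isOpen_maxCompact.prod isOpen_maxCompact).prod isOpen_maxCompact

theorem isCompact_compactG :
    IsCompact (compactG F E ι : Set ((GL ι E × GL ι E) × GL (ι ⊕ ι) F)) :=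
  (isCompact_maxCompact.prod isCompact_maxCompact).prod isCompact_maxCompact

theorem haarG_isHaar [NormedAlgebra F E] : (haarG F E ι).IsHaarMeasure := by
  have := Measure.prod.instIsHaarMeasure (glHaar ι E) (glHaar ι E)
  exact Measure.prod.instIsHaarMeasure ((glHaar ι E).prod (glHaar ι E)) (glHaar (ι ⊕ ι) F)

theorem haarG_coset [NormedAlgebra F E] (r : (GL ι E × GL ι E) × GL (ι ⊕ ι) F) :
    haarG F E ι {x | r⁻¹ * x ∈ compactG F E ι} = 1 := by
  have := haarG_isHaar F E ι
  change haarG F E ι ((fun x => r⁻¹ * x) ⁻¹' (compactG F E ι :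
    Set ((GL ι E × GL ι E) × GL (ι ⊕ ι) F))) = 1
  rw [measure_preimage_mul, compactG_coe, haarG, Measure.prod_prod, Measure.prod_prod,
    glHaar_maxCompact, glHaar_maxCompact, one_mul, one_mul]

end One

section Two

variable (a b : Type*) [Fintype a] [DecidableEq a] [Fintype b] [DecidableEq b]

/-- The maximal compact subgroup of `(H' ∩ L) × L(F)`. -/
def compactL : Subgroup (((GL a E × GL a E) × (GL b E × GL b E)) ×
    (GL (a ⊕ a) F × GL (b ⊕ b) F)) :=
  (((maxCompactSubgroup a E).prod (maxCompactSubgroup a E)).prod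
    ((maxCompactSubgroup b E).prod (maxCompactSubgroup b E))).prod
    ((maxCompactSubgroup (a ⊕ a) F).prod (maxCompactSubgroup (b ⊕ b) F))

theorem isOpen_compactL : IsOpen (compactL F E a b : Set (((GL a E × GL a E) × (GL b E × GL b E)) ×
    (GL (a ⊕ a) F × GL (b ⊕ b) F))) :=
  ((isOpen_maxCompact.prod isOpen_maxCompact).prod
    (isOpen_maxCompact.prod isOpen_maxCompact)).prod (isOpen_maxCompact.prod isOpen_maxCompact)

theorem haarL_isHaar [NormedAlgebra F E] : (haarL F E a b).IsHaarMeasure := by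
  have := Measure.prod.instIsHaarMeasure (glHaar a E) (glHaar a E)
  have := Measure.prod.instIsHaarMeasure (glHaar b E) (glHaar b E)
  have := Measure.prod.instIsHaarMeasure (glHaar (a ⊕ a) F) (glHaar (b ⊕ b) F)
  have := Measure.prod.instIsHaarMeasure ((glHaar a E).prod (glHaar a E))
    ((glHaar b E).prod (glHaar b E))
  exact Measure.prod.instIsHaarMeasure (((glHaar a E).prod (glHaar a E)).prod
    ((glHaar b E).prod (glHaar b E))) ((glHaar (a ⊕ a) F).prod (glHaar (b ⊕ b) F))

theorem haarL_sFinite [NormedAlgebra F E] : SFinite (haarL F E a b) := by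
  unfold haarL; infer_instance

theorem haarG_sFinite [NormedAlgebra F E] : SFinite (haarG F E a) := by
  unfold haarG; infer_instance

theorem haarL_coset [NormedAlgebra F E] (r : ((GL a E × GL a E) × (GL b E × GL b E)) ×
    (GL (a ⊕ a) F × GL (b ⊕ b) F)) :
    haarL F E a b {x | r⁻¹ * x ∈ compactL F E a b} = 1 := by
  have := haarL_isHaar F E a b
  change haarL F E a b ((fun x => r⁻¹ * x) ⁻¹' (((maxCompact a E ×ˢ maxCompact a E) ×ˢ
    (maxCompact b E ×ˢ maxCompact b E)) ×ˢ (maxCompact (a ⊕ a) F ×ˢ maxCompact (b ⊕ b) F))) = 1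
  rw [measure_preimage_mul, haarL]
  simp only [Measure.prod_prod, glHaar_maxCompact, one_mul]

/-- The unipotent parts of `H' × H''`. -/
abbrev UnipG := (Matrix a b E × Matrix a b E) × Matrix (a ⊕ a) (b ⊕ b) F

/-- The Haar measure on the unipotent parts. -/
def haarU : Measure (UnipG F E a b) :=
  ((matHaar a b E 1).prod (matHaar a b E 1)).prod (matHaar (a ⊕ a) (b ⊕ b) F 1)

theorem haarU_isHaar : (haarU F E a b).IsAddHaarMeasure := by
  have := Measure.prod.instIsAddHaarMeasure (matHaar a b E 1) (matHaar a b E 1)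
  exact Measure.prod.instIsAddHaarMeasure ((matHaar a b E 1).prod (matHaar a b E 1))
    (matHaar (a ⊕ a) (b ⊕ b) F 1)

theorem haarU_sFinite : SFinite (haarU F E a b) := by
  unfold haarU; infer_instance

/-- The integral unipotent elements. -/
def cubeU : Set (UnipG F E a b) :=
  (unitCube a b E ×ˢ unitCube a b E) ×ˢ unitCube (a ⊕ a) (b ⊕ b) F

theorem haarU_cubeU : haarU F E a b (cubeU F E a b) = 1 := by
  simp only [haarU, cubeU, Measure.prod_prod, matHaar_unitCube, one_mul]

/-- The inclusion of `(H' ∩ L) × L(F)` in `H' × H''`. -/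
def inclG : ((GL a E × GL a E) × (GL b E × GL b E)) × (GL (a ⊕ a) F × GL (b ⊕ b) F) →*
    (GL (a ⊕ b) E × GL (a ⊕ b) E) × GL ((a ⊕ b) ⊕ (a ⊕ b)) F :=
  MonoidHom.prodMap (embH E a b) levi

variable {F E a b}

/-- The embedding of the unipotent parts. -/
def unipG (v : UnipG F E a b) : (GL (a ⊕ b) E × GL (a ⊕ b) E) × GL ((a ⊕ b) ⊕ (a ⊕ b)) F :=
  ((upperGL v.1.1, upperGL v.1.2), unip v.2)

omit [LocallyCompactSpace F] [IsUltrametricDist F] [LocallyCompactSpace E] [IsUltrametricDist E] in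
theorem unipG_add (v w : UnipG F E a b) : unipG (v + w) = unipG v * unipG w := by
  simp only [unipG, Prod.fst_add, Prod.snd_add, upperGL_add, unip_add, Prod.mk_mul_mk]

/-- The Levi subgroup normalizes the unipotent radical. Only the existence of `w` is needed, since
it will act as a translation. -/
theorem unipG_mul_inclG (v : UnipG F E a b) (m : ((GL a E × GL a E) × (GL b E × GL b E)) ×
    (GL (a ⊕ a) F × GL (b ⊕ b) F)) : ∃ w : UnipG F E a b,
    unipG v * inclG F E a b m = inclG F E a b m * unipG w :=
  ⟨(((m.1.1.1⁻¹).val * v.1.1 * m.1.2.1.val, (m.1.1.2⁻¹).val * v.1.2 * m.1.2.2.val),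
    (m.2.1⁻¹).val * v.2 * m.2.2.val),
    Prod.ext (Prod.ext (upperGL_mul_diagGL v.1.1 (m.1.1.1, m.1.2.1))
      (upperGL_mul_diagGL v.1.2 (m.1.1.2, m.1.2.2))) (unip_mul_levi v.2 m.2)⟩

theorem inclG_mul_unipG_mem {m : ((GL a E × GL a E) × (GL b E × GL b E)) ×
    (GL (a ⊕ a) F × GL (b ⊕ b) F)} {v : UnipG F E a b} :
    inclG F E a b m * unipG v ∈ compactG F E (a ⊕ b) ↔
      m ∈ compactL F E a b ∧ v ∈ cubeU F E a b := by
  have h1 : diagGL (m.1.1.1, m.1.2.1) * upperGL v.1.1 ∈ maxCompact (a ⊕ b) E ↔ _ :=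
    diagGL_mul_upperGL_mem_maxCompact
  have h2 : diagGL (m.1.1.2, m.1.2.2) * upperGL v.1.2 ∈ maxCompact (a ⊕ b) E ↔ _ :=
    diagGL_mul_upperGL_mem_maxCompact
  have h3 : levi m.2 * unip v.2 ∈ maxCompact ((a ⊕ b) ⊕ (a ⊕ b)) F ↔
      (m.2.1 ∈ maxCompact (a ⊕ a) F ∧ m.2.2 ∈ maxCompact (b ⊕ b) F) ∧
        v.2 ∈ unitCube (a ⊕ a) (b ⊕ b) F := by
    rw [levi_eq, unip_eq, ← map_mul, blockSwap_mem_maxCompact]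
    exact diagGL_mul_upperGL_mem_maxCompact
  have h4 : inclG F E a b m * unipG v ∈ compactG F E (a ⊕ b) ↔
    (diagGL (m.1.1.1, m.1.2.1) * upperGL v.1.1 ∈ maxCompact (a ⊕ b) E ∧
      diagGL (m.1.1.2, m.1.2.2) * upperGL v.1.2 ∈ maxCompact (a ⊕ b) E) ∧
      levi m.2 * unip v.2 ∈ maxCompact ((a ⊕ b) ⊕ (a ⊕ b)) F := Iff.rfl
  have h5 : m ∈ compactL F E a b ↔ ((m.1.1.1 ∈ maxCompact a E ∧ m.1.1.2 ∈ maxCompact a E) ∧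
    (m.1.2.1 ∈ maxCompact b E ∧ m.1.2.2 ∈ maxCompact b E)) ∧
    (m.2.1 ∈ maxCompact (a ⊕ a) F ∧ m.2.2 ∈ maxCompact (b ⊕ b) F) := Iff.rfl
  have h6 : v ∈ cubeU F E a b ↔ (v.1.1 ∈ unitCube a b E ∧ v.1.2 ∈ unitCube a b E) ∧
    v.2 ∈ unitCube (a ⊕ a) (b ⊕ b) F := Iff.rfl
  rw [h4, h1, h2, h3, h5, h6]
  exact ⟨fun ⟨⟨⟨⟨p₁, p₂⟩, p₃⟩, ⟨q₁, q₂⟩, q₃⟩, ⟨r₁, r₂⟩, r₃⟩ =>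
      ⟨⟨⟨⟨p₁, q₁⟩, p₂, q₂⟩, r₁, r₂⟩, ⟨p₃, q₃⟩, r₃⟩,
    fun ⟨⟨⟨⟨p₁, q₁⟩, p₂, q₂⟩, r₁, r₂⟩, ⟨p₃, q₃⟩, r₃⟩ =>
      ⟨⟨⟨⟨p₁, p₂⟩, p₃⟩, ⟨q₁, q₂⟩, q₃⟩, ⟨r₁, r₂⟩, r₃⟩⟩

theorem exists_iwasawaG (g : (GL (a ⊕ b) E × GL (a ⊕ b) E) × GL ((a ⊕ b) ⊕ (a ⊕ b)) F) :
    ∃ m v, ∃ h ∈ compactG F E (a ⊕ b), g = inclG F E a b m * unipG v * h := by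
  obtain ⟨p₁, u₁, h₁, hh₁, e₁⟩ := exists_iwasawa g.1.1
  obtain ⟨p₂, u₂, h₂, hh₂, e₂⟩ := exists_iwasawa g.1.2
  obtain ⟨p₃, u₃, h₃, hh₃, e₃⟩ := exists_iwasawa ((blockSwap a b F).symm g.2)
  refine ⟨(((p₁.1, p₂.1), (p₁.2, p₂.2)), p₃), ((u₁, u₂), u₃), ((h₁, h₂), blockSwap a b F h₃),
    ⟨⟨hh₁, hh₂⟩, blockSwap_mem_maxCompact.2 hh₃⟩, Prod.ext (Prod.ext e₁ e₂) ?_⟩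
  have := congrArg (blockSwap a b F) e₃
  rw [MulEquiv.apply_symm_apply, map_mul, map_mul] at this
  exact this

end Two

end Groups

/-! ### The volume of a coset in Iwasawa coordinates -/

section CosetVolume

attribute [local instance] properSpace_of_locallyCompact matrixBorel matrixBorel_borelSpace
  matrix_secondCountable matHaar_isAddHaar gl_secondCountable glHaar_isHaar
  prod_measurableMul₂ glHaar_sFinite gl_measurableMul₂

variable {F E : Type*} [NontriviallyNormedField F] [LocallyCompactSpace F] [IsUltrametricDist F]
  [NontriviallyNormedField E] [LocallyCompactSpace E] [IsUltrametricDist E] [NormedAlgebra F E]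
  {a b : Type*} [Fintype a] [DecidableEq a] [Fintype b] [DecidableEq b]

theorem continuous_diagGL {k : Type*} [NontriviallyNormedField k] :
    Continuous fun p : GL a k × GL b k => diagGL p := by
  have h : ∀ {f : GL a k × GL b k → Matrix a a k} {g : GL a k × GL b k → Matrix b b k},
      Continuous f → Continuous g → Continuous fun p => Matrix.fromBlocks (f p) 0 0 (g p) :=
    fun hf hg => hf.matrix_fromBlocks continuous_const continuous_const hg
  refine continuous_to_gl (h (gl_continuous_val.comp continuous_fst)
    (gl_continuous_val.comp continuous_snd)) ?_
  simp_rw [← map_inv]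
  exact h (gl_continuous_inv_val.comp continuous_fst) (gl_continuous_inv_val.comp continuous_snd)

theorem continuous_upperGL {k : Type*} [NontriviallyNormedField k] :
    Continuous fun u : Matrix a b k => upperGL u := by
  refine continuous_to_gl ?_ ?_
  · exact continuous_const.matrix_fromBlocks continuous_id continuous_const continuous_const
  · simp_rw [upperGL_inv]
    exact continuous_const.matrix_fromBlocks continuous_neg continuous_const continuous_const

theorem continuous_blockSwap {k : Type*} [NontriviallyNormedField k] :
    Continuous (blockSwap a b k) := by
  refine continuous_to_gl ?_ ?_
  · simp_rw [blockSwap_val]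
    exact gl_continuous_val.matrix_submatrix _ _
  · simp_rw [← map_inv, blockSwap_val]
    exact gl_continuous_inv_val.matrix_submatrix _ _

theorem continuous_levi {k : Type*} [NontriviallyNormedField k] :
    Continuous fun p : GL (a ⊕ a) k × GL (b ⊕ b) k => levi p :=
  continuous_blockSwap.comp continuous_diagGL

theorem continuous_unip {k : Type*} [NontriviallyNormedField k] :
    Continuous fun u : Matrix (a ⊕ a) (b ⊕ b) k => unip u :=
  continuous_blockSwap.comp continuous_upperGL

theorem continuous_inclG : Continuous (inclG F E a b) := by
  refine Continuous.prodMk (Continuous.prodMk ?_ ?_) (continuous_levi.comp continuous_snd)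
  · exact continuous_diagGL.comp ((continuous_fst.comp (continuous_fst.comp continuous_fst)).prodMk
      (continuous_fst.comp (continuous_snd.comp continuous_fst)))
  · exact continuous_diagGL.comp ((continuous_snd.comp (continuous_fst.comp continuous_fst)).prodMk
      (continuous_snd.comp (continuous_snd.comp continuous_fst)))

theorem continuous_unipG : Continuous (unipG : UnipG F E a b → _) :=
  ((continuous_upperGL.comp (continuous_fst.comp continuous_fst)).prodMk
    (continuous_upperGL.comp (continuous_snd.comp continuous_fst))).prodMk
    (continuous_unip.comp continuous_snd)

/-- With `g = m₀ v₀ h₀`, the condition becomes `m₀⁻¹ m` integral and `w(m) + v` integral, where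
`w(m)` does not depend on `v`. Both sets are translates of sets of volume one. Writing the unipotent
factor to the right of `m` is what avoids a modulus. -/
theorem coset_volume_descent
    (g : (GL (a ⊕ b) E × GL (a ⊕ b) E) × GL ((a ⊕ b) ⊕ (a ⊕ b)) F) :
    ((haarL F E a b).prod (haarU F E a b))
      {t | g⁻¹ * (inclG F E a b t.1 * unipG t.2) ∈ compactG F E (a ⊕ b)} = 1 := by
  have := haarL_sFinite F E a b
  have := haarU_sFinite F E a b
  have := haarU_isHaar F E a b
  obtain ⟨m₀, v₀, h₀, hh₀, rfl⟩ := exists_iwasawaG g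
  have hw : ∀ m, ∃ w : UnipG F E a b,
      (unipG v₀)⁻¹ * inclG F E a b (m₀⁻¹ * m) = inclG F E a b (m₀⁻¹ * m) * unipG w := by
    intro m
    have h1 : (unipG v₀ : (GL (a ⊕ b) E × GL (a ⊕ b) E) × GL ((a ⊕ b) ⊕ (a ⊕ b)) F)⁻¹ =
        unipG (-v₀) := by
      rw [inv_eq_iff_mul_eq_one, ← unipG_add, add_neg_cancel]
      exact Prod.ext (Prod.ext (Units.ext (by simp [unipG, upperGL_val]))
        (Units.ext (by simp [unipG, upperGL_val])))
        (Units.ext (by simp [unipG, unip_eq, blockSwap_val, upperGL_val]))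
    rw [h1]
    exact unipG_mul_inclG _ _
  choose w hw using hw
  have h1 : ∀ m v, (inclG F E a b m₀ * unipG v₀ * h₀)⁻¹ * (inclG F E a b m * unipG v) ∈
      compactG F E (a ⊕ b) ↔ m₀⁻¹ * m ∈ compactL F E a b ∧ w m + v ∈ cubeU F E a b := by
    intro m v
    have h2 : (inclG F E a b m₀ * unipG v₀ * h₀)⁻¹ * (inclG F E a b m * unipG v) =
        h₀⁻¹ * (inclG F E a b (m₀⁻¹ * m) * unipG (w m + v)) := by
      rw [unipG_add, ← mul_assoc (inclG F E a b (m₀⁻¹ * m)), ← hw, map_mul, map_inv]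
      group
    rw [h2, Subgroup.mul_mem_cancel_left _ (Subgroup.inv_mem _ hh₀), inclG_mul_unipG_mem]
  have hms : MeasurableSet {t : (((GL a E × GL a E) × (GL b E × GL b E)) ×
      (GL (a ⊕ a) F × GL (b ⊕ b) F)) × UnipG F E a b |
      (inclG F E a b m₀ * unipG v₀ * h₀)⁻¹ * (inclG F E a b t.1 * unipG t.2) ∈
        compactG F E (a ⊕ b)} := by
    have hc : Measurable fun t : (((GL a E × GL a E) × (GL b E × GL b E)) ×
      (GL (a ⊕ a) F × GL (b ⊕ b) F)) × UnipG F E a b =>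
        (inclG F E a b m₀ * unipG v₀ * h₀)⁻¹ * (inclG F E a b t.1 * unipG t.2) :=
      ((continuous_inclG.measurable.comp measurable_fst).mul
        (continuous_unipG.measurable.comp measurable_snd)).const_mul _
    exact hc (isOpen_compactG F E (a ⊕ b)).measurableSet
  rw [Measure.prod_apply hms]
  have h3 : ∀ m, haarU F E a b (Prod.mk m ⁻¹' {t : (((GL a E × GL a E) × (GL b E × GL b E)) ×
      (GL (a ⊕ a) F × GL (b ⊕ b) F)) × UnipG F E a b |
      (inclG F E a b m₀ * unipG v₀ * h₀)⁻¹ * (inclG F E a b t.1 * unipG t.2) ∈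
        compactG F E (a ⊕ b)}) = {m | m₀⁻¹ * m ∈ compactL F E a b}.indicator 1 m := by
    intro m
    simp only [Set.preimage_setOf_eq, h1]
    by_cases hm : m₀⁻¹ * m ∈ compactL F E a b
    · rw [Set.indicator_of_mem (by exact hm)]
      simp only [hm, true_and]
      change haarU F E a b ((fun v => w m + v) ⁻¹' cubeU F E a b) = 1
      rw [measure_preimage_add, haarU_cubeU]
    · rw [Set.indicator_of_notMem (by exact hm)]
      simp [hm]
  simp_rw [h3]
  rw [lintegral_indicator_one, haarL_coset]
  exact ((isOpen_compactL F E a b).preimage (continuous_const_mul _)).measurableSet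

end CosetVolume

/-! ## Characters and the integrand -/

section Characters

variable {F E : Type*} [Field F] [Field E] [Algebra F E] (σ : E ≃ₐ[F] E) (χ ηt : Eˣ →* ℂˣ)
  {ι : Type*} [Fintype ι] [DecidableEq ι]

theorem chiH_mul (h h' : GL ι E × GL ι E) : chiH σ χ (h * h') = chiH σ χ h * chiH σ χ h' := by
  simp only [chiH, Prod.fst_mul, Prod.snd_mul, map_mul, Units.val_mul]
  ring

theorem etaChar_mul (hη : ∀ c : Fˣ, (ηt (Units.map (algebraMap F E : F →* E) c) : ℂ) =
    etaChar F E c) (c d : Fˣ) : etaChar F E (c * d) = etaChar F E c * etaChar F E d := by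
  rw [← hη, ← hη, ← hη, map_mul, map_mul, Units.val_mul]

theorem chiEta_mul (hη : ∀ c : Fˣ, (ηt (Units.map (algebraMap F E : F →* E) c) : ℂ) =
    etaChar F E c) (g g' : GL ι F) : chiEta F χ (g * g') = chiEta F χ g * chiEta F χ g' := by
  simp only [chiEta, map_mul, Units.val_mul, etaChar_mul ηt hη]
  ring

theorem det_blockGL_upper {a b k : Type*} [Fintype a] [DecidableEq a] [Fintype b] [DecidableEq b]
    [CommRing k] (u : Matrix a b k) : Matrix.GeneralLinearGroup.det (upperGL u) = 1 := by
  refine Units.ext ?_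
  change (Matrix.fromBlocks 1 u 0 1).det = 1
  simp

theorem det_unip {a b k : Type*} [Fintype a] [DecidableEq a] [Fintype b] [DecidableEq b]
    [CommRing k] (u : Matrix (a ⊕ a) (b ⊕ b) k) : Matrix.GeneralLinearGroup.det (unip u) = 1 := by
  refine Units.ext ?_
  change (unip u).val.det = 1
  rw [unip_eq, blockSwap_val, Matrix.det_submatrix_equiv_self, upperGL_val]
  simp

theorem chiH_upper {a b : Type*} [Fintype a] [DecidableEq a] [Fintype b] [DecidableEq b]
    (P Q : Matrix a b E) : chiH σ χ (upperGL P, upperGL Q) = 1 := by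
  have h : Matrix.GeneralLinearGroup.det (conjGL σ (upperGL Q)) = 1 := by
    refine Units.ext ?_
    change ((upperGL Q).val.map σ).det = 1
    rw [upperGL_val, Matrix.fromBlocks_map]
    simp
  simp only [chiH]
  rw [map_mul, det_blockGL_upper, h, one_mul, map_one, Units.val_one]

theorem chiEta_unip {a b : Type*} [Fintype a] [DecidableEq a] [Fintype b] [DecidableEq b]
    (u : Matrix (a ⊕ a) (b ⊕ b) F) : chiEta F χ (unip u) = 1 := by
  have h : etaChar F E 1 = 1 := by
    rw [etaChar, if_pos ⟨1, by simp⟩]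
  rw [chiEta, unip_map, det_unip, det_unip, map_one, h, Units.val_one, mul_one]

end Characters

/-! ### Continuity of the integrand and invariance under the stabilizer -/

section Integrand

variable {F E : Type*} [NontriviallyNormedField F] [NontriviallyNormedField E] [NormedAlgebra F E]
  {σ : E ≃ₐ[F] E} {χ ηt : Eˣ →* ℂˣ} {ι : Type*} [Fintype ι] [DecidableEq ι]

theorem continuous_gl_det {k : Type*} [NontriviallyNormedField k] :
    Continuous fun g : GL ι k => Matrix.GeneralLinearGroup.det g := by
  refine Units.continuous_iff.2 ⟨?_, ?_⟩
  · exact gl_continuous_val.matrix_det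
  · have : ∀ g : GL ι k, ((Matrix.GeneralLinearGroup.det g)⁻¹ : kˣ).val = (g⁻¹).val.det :=
      fun g => by rw [← map_inv]; rfl
    simp_rw [this]
    exact gl_continuous_inv_val.matrix_det

theorem continuous_conjGL (hσc : Continuous σ) : Continuous fun g : GL ι E => conjGL σ g := by
  have h : ∀ {f : GL ι E → Matrix ι ι E}, Continuous f → Continuous fun g => (f g).map σ :=
    fun hf => continuous_matrix fun i j => hσc.comp (hf.matrix_elem i j)
  refine continuous_to_gl (h gl_continuous_val) ?_
  simp_rw [← map_inv]
  exact h gl_continuous_inv_val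

theorem continuous_extGL : Continuous fun g : GL ι F => extGL F E g := by
  have h : ∀ {f : GL ι F → Matrix ι ι F}, Continuous f →
      Continuous fun g => (f g).map (algebraMap F E) :=
    fun hf => continuous_matrix fun i j => (continuous_algebraMap F E).comp (hf.matrix_elem i j)
  refine continuous_to_gl (h gl_continuous_val) ?_
  simp_rw [← map_inv]
  exact h gl_continuous_inv_val

theorem continuous_chiH (hχ : Continuous χ) (hσc : Continuous σ) :
    Continuous fun h : GL ι E × GL ι E => chiH σ χ h :=
  Units.continuous_val.comp (hχ.comp (continuous_gl_det.comp
    (continuous_fst.mul ((continuous_conjGL hσc).comp continuous_snd))))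

theorem etaChar_ne_zero (c : Fˣ) : etaChar F E c ≠ 0 := by
  unfold etaChar; split_ifs <;> norm_num

theorem chiEta_ne_zero (g : GL ι F) : chiEta F χ g ≠ 0 :=
  mul_ne_zero (Units.ne_zero _) (etaChar_ne_zero _)

theorem continuous_chiEta (hχ : Continuous χ) (hηt : Continuous ηt)
    (hη : ∀ c : Fˣ, (ηt (Units.map (algebraMap F E : F →* E) c) : ℂ) = etaChar F E c) :
    Continuous fun g : GL ι F => chiEta F χ g := by
  have h2 : Continuous fun c : Fˣ => Units.map (algebraMap F E : F →* E) c := by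
    refine Units.continuous_iff.2 ⟨?_, ?_⟩
    · exact (continuous_algebraMap F E).comp Units.continuous_val
    · exact (continuous_algebraMap F E).comp Units.continuous_coe_inv
  refine Continuous.mul (Units.continuous_val.comp (hχ.comp
    (continuous_gl_det.comp continuous_extGL))) ?_
  simp_rw [← hη]
  exact Units.continuous_val.comp (hηt.comp (h2.comp continuous_gl_det))

theorem continuous_integrandG (hχ : Continuous χ) (hηt : Continuous ηt) (hσc : Continuous σ)
    (hη : ∀ c : Fˣ, (ηt (Units.map (algebraMap F E : F →* E) c) : ℂ) = etaChar F E c)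
    (x : GL (ι ⊕ ι) E) {f : GL (ι ⊕ ι) E → ℂ} (hf : Continuous f) :
    Continuous (integrandG F σ χ x f) := by
  refine Continuous.mul (Continuous.mul (hf.comp ?_) ((continuous_chiH hχ hσc).comp
    continuous_fst)) (Continuous.inv₀ ((continuous_chiEta hχ hηt hη).comp continuous_snd)
      fun p => chiEta_ne_zero _)
  exact ((continuous_diagGL.comp continuous_fst).inv.mul continuous_const).mul
    (continuous_extGL.comp continuous_snd)

/-- The character of the integrand is trivial on stabilizers. -/
theorem chiH_eq_chiEta_of_mem [CharZero F] (hdeg : Module.finrank F E = 2)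
    (hσ : σ ≠ AlgEquiv.refl) {x : GL (ι ⊕ ι) E} {α : Matrix ι ι E}
    (hs : (toSymm σ x).val = sPrime σ α) (hα : α * α.map σ = α.map σ * α) (hu : IsUnit α)
    {p : (GL ι E × GL ι E) × GL (ι ⊕ ι) F} (hp : p ∈ stabG F x) :
    chiH σ χ p.1 = chiEta F χ p.2 := by
  have hinv := involutive_of_finrank_eq_two σ hdeg
  obtain ⟨z, hz, hz0, hspan⟩ := exists_imaginary σ hdeg hσ
  obtain ⟨h1, h2⟩ := intertwines_of_diagGL_mul σ hinv hs hα (diagGL_mul_toSymm_of_mem σ hp)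
  have hconj : conjGL σ p.1.2 = p.1.1 := by
    refine Units.ext ?_
    change p.1.2.val.map σ = p.1.1.val
    rw [h1]
    ext i j
    simp [hinv]
  have hdα : α.det ≠ 0 := ((Matrix.isUnit_iff_isUnit_det _).1 hu).ne_zero
  have hdmap : ∀ M : Matrix ι ι E, (M.map σ).det = σ M.det := fun M =>
    ((σ : E →+* E).map_det M).symm
  -- Take determinants in `g α = α ḡ` and cancel `det α`, which is nonzero.
  have hfix : σ p.1.1.val.det = p.1.1.val.det := by
    have h3 := congrArg Matrix.det h2
    rw [Matrix.det_mul, Matrix.det_mul, hdmap, mul_comm] at h3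
    exact (mul_left_cancel₀ hdα h3).symm
  obtain ⟨c, hc⟩ := exists_algebraMap_of_fixed σ hz hz0 hspan hfix
  have hp1 : diagGL p.1 * x = x * extGL F E p.2 := by
    have : (diagGL p.1)⁻¹ * x * extGL F E p.2 = x := hp
    rw [mul_assoc, inv_mul_eq_iff_eq_mul] at this
    exact this.symm
  -- With `c` in `F` the determinant of `g`, the second block `ḡ` also has determinant `c`, so `det
  -- h'' = c²`. This is the norm of `c`, so `η` is trivial on it, and both sides are `χ(c²)`.
  have hdet2 : algebraMap F E p.2.val.det = algebraMap F E (c ^ 2) := by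
    have h4 := congrArg (fun g : GL (ι ⊕ ι) E => g.val.det) hp1
    simp only [Units.val_mul, Matrix.det_mul, diagGL_val] at h4
    rw [Matrix.det_fromBlocks_zero₂₁, h1, hdmap, hfix, ← hc, mul_comm] at h4
    have h5 := mul_left_cancel₀ (det_ne_zero_of_gl x) h4
    have h6 : (extGL F E p.2).val.det = algebraMap F E p.2.val.det :=
      ((algebraMap F E).map_det p.2.val).symm
    rw [h6] at h5
    rw [← h5, map_pow, pow_two]
  have hdet3 := (algebraMap F E).injective hdet2
  have heta : etaChar F E (Matrix.GeneralLinearGroup.det p.2) = 1 := by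
    rw [etaChar, if_pos]
    refine ⟨algebraMap F E c, ?_⟩
    rw [Algebra.norm_algebraMap, hdeg]
    exact hdet3.symm
  rw [chiEta, heta, mul_one, chiH, hconj]
  congr 2
  refine Units.ext ?_
  change (p.1.1 * p.1.1).val.det = (extGL F E p.2).val.det
  have h6 : (extGL F E p.2).val.det = algebraMap F E p.2.val.det :=
    ((algebraMap F E).map_det p.2.val).symm
  rw [h6, hdet2, Units.val_mul, Matrix.det_mul, ← hc, map_pow, pow_two]

theorem isLeftInvariant_integrandG [CharZero F] (hdeg : Module.finrank F E = 2)
    (hσ : σ ≠ AlgEquiv.refl)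
    (hη : ∀ c : Fˣ, (ηt (Units.map (algebraMap F E : F →* E) c) : ℂ) = etaChar F E c)
    {x : GL (ι ⊕ ι) E} {α : Matrix ι ι E}
    (hs : (toSymm σ x).val = sPrime σ α) (hα : α * α.map σ = α.map σ * α) (hu : IsUnit α)
    (f : GL (ι ⊕ ι) E → ℂ) : IsLeftInvariant (stabG F x) (integrandG F σ χ x f) := by
  intro s hs' p
  have h1 : (diagGL s.1)⁻¹ * x * extGL F E s.2 = x := hs'
  have h2 := chiH_eq_chiEta_of_mem (χ := χ) hdeg hσ hs hα hu hs'
  have h3 : (diagGL (s.1 * p.1))⁻¹ * x * extGL F E (s.2 * p.2) =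
      (diagGL p.1)⁻¹ * x * extGL F E p.2 := by
    conv_rhs => rw [← h1]
    rw [map_mul, map_mul]
    group
  have h4 := chiEta_ne_zero (χ := χ) s.2
  have h5 := chiEta_ne_zero (χ := χ) p.2
  simp only [integrandG, Prod.fst_mul, Prod.snd_mul]
  rw [h3, chiH_mul, chiEta_mul χ ηt hη, h2]
  field_simp

end Integrand

/-! ## Evaluation of the unipotent integral -/

section Evaluation

attribute [local instance] properSpace_of_locallyCompact matrixBorel matrixBorel_borelSpace
  matrix_secondCountable matHaar_isAddHaar gl_secondCountable glHaar_isHaar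
  prod_measurableMul₂ glHaar_sFinite gl_measurableMul₂

variable {F E : Type*} [NontriviallyNormedField F] [LocallyCompactSpace F] [IsUltrametricDist F]
  [NontriviallyNormedField E] [LocallyCompactSpace E] [IsUltrametricDist E] [NormedAlgebra F E]
  {a b : Type*} [Fintype a] [DecidableEq a] [Fintype b] [DecidableEq b]
  {σ : E ≃ₐ[F] E} {χ ηt : Eˣ →* ℂˣ}

/-- The unipotent coordinate of the orbit map at `y`. -/
def unipCoord (y : GL (a ⊕ a) E × GL (b ⊕ b) E) (v : UnipG F E a b) :
    Matrix (a ⊕ a) (b ⊕ b) E :=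
  y.1.val * v.2.map (algebraMap F E) * (y.2⁻¹).val - Matrix.fromBlocks v.1.1 0 0 v.1.2

/-- Moving the unipotent factors past `y = m⁻¹ x m''` collects them into a single element of `U(E)`
to the left of `y`. Characters are multiplicative and trivial on unipotent elements, so only those
of `m` and `k` remain. -/
theorem integrandG_descent
    (hη : ∀ c : Fˣ, (ηt (Units.map (algebraMap F E : F →* E) c) : ℂ) = etaChar F E c)
    (x : GL (a ⊕ a) E × GL (b ⊕ b) E) (f : GL ((a ⊕ b) ⊕ (a ⊕ b)) E → ℂ)
    (m : ((GL a E × GL a E) × (GL b E × GL b E)) × (GL (a ⊕ a) F × GL (b ⊕ b) F))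
    (v : UnipG F E a b) (k : (GL (a ⊕ b) E × GL (a ⊕ b) E) × GL ((a ⊕ b) ⊕ (a ⊕ b)) F) :
    integrandG F σ χ (levi x) f (inclG F E a b m * (unipG v * k)) =
      chiH σ χ (embH E a b m.1) * (chiEta F χ (levi m.2))⁻¹ *
        integrandG F σ χ (unip (unipCoord ((inclHL E a b m.1)⁻¹ * x * inclLF F E a b m.2) v) *
          levi ((inclHL E a b m.1)⁻¹ * x * inclLF F E a b m.2)) f k := by
  set y := (inclHL E a b m.1)⁻¹ * x * inclLF F E a b m.2 with hy
  have h1 : diagGL (inclG F E a b m * (unipG v * k)).1 =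
      levi (inclHL E a b m.1) * unip (Matrix.fromBlocks v.1.1 0 0 v.1.2) * diagGL k.1 := by
    rw [levi_inclHL, ← diagGL_upperGL, ← map_mul, ← map_mul, mul_assoc]
    rfl
  have h2 : extGL F E (inclG F E a b m * (unipG v * k)).2 =
      levi (inclLF F E a b m.2) * unip (v.2.map (algebraMap F E)) * extGL F E k.2 := by
    rw [levi_inclLF, ← unip_map, ← map_mul, ← map_mul, mul_assoc]
    rfl
  have h3 : (diagGL (inclG F E a b m * (unipG v * k)).1)⁻¹ * levi x *
      extGL F E (inclG F E a b m * (unipG v * k)).2 =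
      (diagGL k.1)⁻¹ * (unip (unipCoord y v) * levi y) * extGL F E k.2 := by
    have h4 : levi y = (levi (inclHL E a b m.1))⁻¹ * levi x * levi (inclLF F E a b m.2) := by
      rw [hy, map_mul, map_mul, map_inv]
    have h5 : unip (unipCoord y v) * levi y =
        (unip (Matrix.fromBlocks v.1.1 0 0 v.1.2))⁻¹ * (levi y * unip (v.2.map (algebraMap F E))) := by
      rw [unip_conj_levi, ← unip_neg, ← mul_assoc, ← unip_add, unipCoord, sub_eq_neg_add]
    rw [h1, h2, h5, h4]
    group
  have h6 : chiH σ χ (inclG F E a b m * (unipG v * k)).1 =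
      chiH σ χ (embH E a b m.1) * chiH σ χ k.1 := by
    change chiH σ χ (embH E a b m.1 * ((upperGL v.1.1, upperGL v.1.2) * k.1)) = _
    rw [chiH_mul, chiH_mul, chiH_upper, one_mul]
  have h7 : chiEta F χ (inclG F E a b m * (unipG v * k)).2 =
      chiEta F χ (levi m.2) * chiEta F χ k.2 := by
    change chiEta F χ (levi m.2 * (unip v.2 * k.2)) = _
    rw [chiEta_mul χ ηt hη, chiEta_mul χ ηt hη, chiEta_unip, one_mul]
  simp only [integrandG]
  rw [h3, h6, h7, mul_inv]
  ring

theorem continuous_unipCoord (y : GL (a ⊕ a) E × GL (b ⊕ b) E) :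
    Continuous (unipCoord y : UnipG F E a b → Matrix (a ⊕ a) (b ⊕ b) E) := by
  have h1 : Continuous fun v : UnipG F E a b => v.2.map (algebraMap F E) :=
    continuous_matrix fun i j =>
      (continuous_algebraMap F E).comp (continuous_snd.matrix_elem i j)
  exact ((continuous_const.matrix_mul h1).matrix_mul continuous_const).sub
    ((continuous_fst.comp continuous_fst).matrix_fromBlocks continuous_const continuous_const
      (continuous_snd.comp continuous_fst))

theorem map_unipCoord [CharZero F] (hdeg : Module.finrank F E = 2)
    (hσ : σ ≠ AlgEquiv.refl) {bE : Module.Basis (Fin 2) F E} (hbE : IsIntegralBasis bE)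
    {x : GL (a ⊕ a) E × GL (b ⊕ b) E} {α₁ : Matrix a a E} {α₂ : Matrix b b E}
    (hα₁ : (toSymm σ x.1).val = sPrime σ α₁) (hα₂ : (toSymm σ x.2).val = sPrime σ α₂)
    (hdet : LinearMap.det (twistedSylvester σ (-α₁.map σ) (α₂.map σ) :
      Matrix a b E →ₗ[F] Matrix a b E) ≠ 0)
    (p : ((GL a E × GL a E) × (GL b E × GL b E)) × (GL (a ⊕ a) F × GL (b ⊕ b) F))
    (y : GL (a ⊕ a) E × GL (b ⊕ b) E) (hy : y = (inclHL E a b p.1)⁻¹ * x * inclLF F E a b p.2) :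
    (haarU F E a b).map (unipCoord y) =
      ENNReal.ofReal (normAbs F (Algebra.discr F bE) ^ (Fintype.card a * Fintype.card b) *
        modQ y ^ (-(1 / 2) : ℝ) /
        normAbs F (LinearMap.det (twistedSylvester σ (-α₁.map σ) (α₂.map σ) :
          Matrix a b E →ₗ[F] Matrix a b E))) • matHaar (a ⊕ a) (b ⊕ b) E 1 := by
  have hm : Measurable (unipCoord y : UnipG F E a b → Matrix (a ⊕ a) (b ⊕ b) E) :=
    (continuous_unipCoord y).measurable
  refine Measure.ext_of_lintegral _ fun φ hφ => ?_
  rw [lintegral_map hφ hm, lintegral_smul_measure, smul_eq_mul,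
    ← lintegral_unipotent hdeg σ hσ hbE hα₁ hα₂ hdet p y hy hφ, haarU]
  refine (lintegral_prod_symm' _ (hφ.comp hm)).trans (lintegral_congr fun u => ?_)
  exact lintegral_prod (fun q : Matrix a b E × Matrix a b E => φ (unipCoord y (q, u)))
    ((hφ.comp hm).comp measurable_prodMk_right).aemeasurable

/-- The matrix `w` is a continuous function of `unip w * g`, so the image of `C` under that function
serves as `W`. -/
theorem isCompact_unip_support {k : Type*} [NontriviallyNormedField k]
    {C : Set (GL ((a ⊕ b) ⊕ (a ⊕ b)) k)} (hC : IsCompact C) (g : GL ((a ⊕ b) ⊕ (a ⊕ b)) k) :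
    ∃ W : Set (Matrix (a ⊕ a) (b ⊕ b) k), IsCompact W ∧ ∀ w, unip w * g ∈ C → w ∈ W := by
  let π : GL ((a ⊕ b) ⊕ (a ⊕ b)) k → Matrix (a ⊕ a) (b ⊕ b) k := fun h =>
    ((blockSwap a b k).symm (h * g⁻¹)).val.toBlocks₁₂
  have hπ : Continuous π := by
    refine continuous_matrix fun i j => ?_
    exact (gl_continuous_val.comp (continuous_mul_const g⁻¹)).matrix_elem
      (Equiv.sumSumSumComm a a b b (Sum.inl i)) (Equiv.sumSumSumComm a a b b (Sum.inr j))
  refine ⟨π '' C, hC.image hπ, fun w hw => ⟨_, hw, ?_⟩⟩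
  simp only [π, mul_inv_cancel_right, unip_eq, MulEquiv.symm_apply_apply, upperGL_val,
    Matrix.toBlocks_fromBlocks₁₂]

variable {ι : Type*} [Fintype ι] [DecidableEq ι]

/-- The translates of the support of `f` by the maximal compact subgroups. -/
theorem isCompact_translates (F : Type*) [NontriviallyNormedField F] [LocallyCompactSpace F]
    [IsUltrametricDist F] [NormedAlgebra F E] {f : GL (ι ⊕ ι) E → ℂ} (hf : HasCompactSupport f) :
    ∃ C : Set (GL (ι ⊕ ι) E), IsCompact C ∧ ∀ g, ∀ k ∈ compactG F E ι,
      f ((diagGL k.1)⁻¹ * g * extGL F E k.2) ≠ 0 → g ∈ C := by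
  let Ψ : ((GL ι E × GL ι E) × GL (ι ⊕ ι) F) × GL (ι ⊕ ι) E → GL (ι ⊕ ι) E := fun p =>
    diagGL p.1.1 * p.2 * (extGL F E p.1.2)⁻¹
  have hΨ : Continuous Ψ :=
    ((continuous_diagGL.comp (continuous_fst.comp continuous_fst)).mul continuous_snd).mul
      (continuous_extGL.comp (continuous_snd.comp continuous_fst)).inv
  refine ⟨Ψ '' ((compactG F E ι : Set _) ×ˢ tsupport f),
    ((isCompact_compactG F E ι).prod hf).image hΨ, fun g k hk hg => ?_⟩
  refine ⟨(k, (diagGL k.1)⁻¹ * g * extGL F E k.2), ⟨hk, subset_tsupport f hg⟩, ?_⟩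
  simp only [Ψ]
  group

theorem avgK_eq (hχ : Continuous χ) (hηt : Continuous ηt) (hσc : Continuous σ)
    (hη : ∀ c : Fˣ, (ηt (Units.map (algebraMap F E : F →* E) c) : ℂ) = etaChar F E c)
    {f : GL (ι ⊕ ι) E → ℂ} (hf : Continuous f) (g : GL (ι ⊕ ι) E) :
    avgK F σ χ f g = ∫ k in (compactG F E ι : Set ((GL ι E × GL ι E) × GL (ι ⊕ ι) F)),
      integrandG F σ χ g f k ∂haarG F E ι := by
  have := haarG_isHaar F E ι
  have hint : IntegrableOn (integrandG F σ χ g f)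
      (compactG F E ι : Set ((GL ι E × GL ι E) × GL (ι ⊕ ι) F)) (haarG F E ι) :=
    (continuous_integrandG hχ hηt hσc hη g hf).continuousOn.integrableOn_compact
      (isCompact_compactG F E ι)
  rw [compactG_coe, haarG] at hint ⊢
  rw [setIntegral_prod _ hint]
  rfl

theorem continuous_unip_integrand (hχ : Continuous χ) (hηt : Continuous ηt) (hσc : Continuous σ)
    (hη : ∀ c : Fˣ, (ηt (Units.map (algebraMap F E : F →* E) c) : ℂ) = etaChar F E c)
    {f : GL ((a ⊕ b) ⊕ (a ⊕ b)) E → ℂ} (hf : Continuous f) (l : GL ((a ⊕ b) ⊕ (a ⊕ b)) E) :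
    Continuous fun p : Matrix (a ⊕ a) (b ⊕ b) E × ((GL (a ⊕ b) E × GL (a ⊕ b) E) ×
      GL ((a ⊕ b) ⊕ (a ⊕ b)) F) => integrandG F σ χ (unip p.1 * l) f p.2 := by
  refine Continuous.mul (Continuous.mul (hf.comp ?_) ((continuous_chiH hχ hσc).comp
    (continuous_fst.comp continuous_snd))) (Continuous.inv₀ ((continuous_chiEta hχ hηt hη).comp
    (continuous_snd.comp continuous_snd)) fun p => chiEta_ne_zero _)
  exact ((continuous_diagGL.comp (continuous_fst.comp continuous_snd)).inv.mul
    ((continuous_unip.comp continuous_fst).mul continuous_const)).mul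
    (continuous_extGL.comp (continuous_snd.comp continuous_snd))

/-- For `k` in the compact group, a nonzero value puts `unip w * l` into a fixed compact set of
translates of the support, hence `w` into a compact set, on which the continuous integrand is
integrable. -/
theorem integrable_unip_integrand (hχ : Continuous χ) (hηt : Continuous ηt) (hσc : Continuous σ)
    (hη : ∀ c : Fˣ, (ηt (Units.map (algebraMap F E : F →* E) c) : ℂ) = etaChar F E c)
    {f : GL ((a ⊕ b) ⊕ (a ⊕ b)) E → ℂ} (hf : Continuous f) (hfs : HasCompactSupport f)
    (l : GL ((a ⊕ b) ⊕ (a ⊕ b)) E) :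
    Integrable (fun p : Matrix (a ⊕ a) (b ⊕ b) E × ((GL (a ⊕ b) E × GL (a ⊕ b) E) ×
      GL ((a ⊕ b) ⊕ (a ⊕ b)) F) => integrandG F σ χ (unip p.1 * l) f p.2)
      ((matHaar (a ⊕ a) (b ⊕ b) E 1).prod
        ((haarG F E (a ⊕ b)).restrict (compactG F E (a ⊕ b) : Set _))) := by
  have := haarG_sFinite F E (a ⊕ b)
  have := haarG_isHaar F E (a ⊕ b)
  obtain ⟨C, hC, hC'⟩ := isCompact_translates F hfs
  obtain ⟨W, hW, hW'⟩ := isCompact_unip_support hC l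
  have hg := continuous_unip_integrand hχ hηt hσc hη hf l
  have h1 := hg.continuousOn.integrableOn_compact (hW.prod (isCompact_compactG F E (a ⊕ b)))
    (μ := (matHaar (a ⊕ a) (b ⊕ b) E 1).prod (haarG F E (a ⊕ b)))
  have h2 := h1.of_forall_diff_eq_zero (t := Set.univ ×ˢ (compactG F E (a ⊕ b) : Set _))
    (MeasurableSet.univ.prod (isOpen_compactG F E (a ⊕ b)).measurableSet) (by
      rintro ⟨w, k⟩ ⟨⟨-, hk⟩, hwk⟩
      by_contra hne
      refine hwk ⟨hW' w (hC' _ k hk fun h0 => hne ?_), hk⟩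
      simp only [integrandG, h0, zero_mul])
  rwa [IntegrableOn, ← Measure.prod_restrict, Measure.restrict_univ] at h2

/-- The unipotent variables enter only through their coordinate in `U(E)`, so their measure may be
replaced by its image `c dw`. Integrating over `k` first then gives the average `f'_K`. -/
theorem integral_unipCoord (hχ : Continuous χ) (hηt : Continuous ηt) (hσc : Continuous σ)
    (hη : ∀ c : Fˣ, (ηt (Units.map (algebraMap F E : F →* E) c) : ℂ) = etaChar F E c)
    {f : GL ((a ⊕ b) ⊕ (a ⊕ b)) E → ℂ} (hf : Continuous f) (hfs : HasCompactSupport f)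
    (y : GL (a ⊕ a) E × GL (b ⊕ b) E) {c : ℝ} (hc : 0 ≤ c)
    (hmap : (haarU F E a b).map (unipCoord y) =
      ENNReal.ofReal c • matHaar (a ⊕ a) (b ⊕ b) E 1) :
    ∫ q, integrandG F σ χ (unip (unipCoord y q.1) * levi y) f q.2
      ∂((haarU F E a b).prod ((haarG F E (a ⊕ b)).restrict (compactG F E (a ⊕ b) : Set _))) =
      c * ∫ w, avgK F σ χ f (unip w * levi y) ∂matHaar (a ⊕ a) (b ⊕ b) E 1 := by
  have := haarU_sFinite F E a b
  have := haarG_sFinite F E (a ⊕ b)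
  have hm : Measurable (unipCoord y : UnipG F E a b → Matrix (a ⊕ a) (b ⊕ b) E) :=
    (continuous_unipCoord y).measurable
  have hg := (continuous_unip_integrand hχ hηt hσc hη hf (levi y)).measurable
  have hgi := integrable_unip_integrand hχ hηt hσc hη hf hfs (levi y)
  generalize hκ : (haarG F E (a ⊕ b)).restrict (compactG F E (a ⊕ b) : Set _) = κ at hgi ⊢
  have : SFinite κ := by rw [← hκ]; infer_instance
  have h1 : ((haarU F E a b).prod κ).map (Prod.map (unipCoord y) id) =
      ENNReal.ofReal c • (matHaar (a ⊕ a) (b ⊕ b) E 1).prod κ := by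
    rw [← Measure.map_prod_map _ _ hm measurable_id, Measure.map_id, hmap, Measure.prod_smul_left]
  have h2 := integral_map (μ := (haarU F E a b).prod κ) (φ := Prod.map (unipCoord y) id)
    (hm.prodMap measurable_id).aemeasurable hg.aestronglyMeasurable
  refine h2.symm.trans ?_
  rw [h1, integral_smul_measure, ENNReal.toReal_ofReal hc, integral_prod _ hgi, Complex.real_smul]
  congr 1
  refine integral_congr_ae (Filter.Eventually.of_forall fun w => ?_)
  simp only [avgK_eq hχ hηt hσc hη hf, hκ]

/-- The unipotent integral of the integrand is the integrand of the descent. -/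
theorem integral_unip_eq [CharZero F] (hdeg : Module.finrank F E = 2)
    (hσ : σ ≠ AlgEquiv.refl) {bE : Module.Basis (Fin 2) F E} (hbE : IsIntegralBasis bE)
    {x : GL (a ⊕ a) E × GL (b ⊕ b) E} {α₁ : Matrix a a E} {α₂ : Matrix b b E}
    (hα₁ : (toSymm σ x.1).val = sPrime σ α₁) (hα₂ : (toSymm σ x.2).val = sPrime σ α₂)
    (hdet : LinearMap.det (twistedSylvester σ (-α₁.map σ) (α₂.map σ) :
      Matrix a b E →ₗ[F] Matrix a b E) ≠ 0)
    (hχ : Continuous χ) (hηt : Continuous ηt)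
    (hη : ∀ c : Fˣ, (ηt (Units.map (algebraMap F E : F →* E) c) : ℂ) = etaChar F E c)
    {f : GL ((a ⊕ b) ⊕ (a ⊕ b)) E → ℂ} (hf : Continuous f) (hfs : HasCompactSupport f)
    (m : ((GL a E × GL a E) × (GL b E × GL b E)) × (GL (a ⊕ a) F × GL (b ⊕ b) F)) :
    ∫ q, integrandG F σ χ (levi x) f (inclG F E a b m * (unipG q.1 * q.2))
      ∂((haarU F E a b).prod ((haarG F E (a ⊕ b)).restrict (compactG F E (a ⊕ b) : Set _))) =
      ((normAbs F (LinearMap.det (twistedSylvester σ (-α₁.map σ) (α₂.map σ) :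
          Matrix a b E →ₗ[F] Matrix a b E)))⁻¹ : ℂ) *
      integrandL F σ χ x (descent F σ χ (ENNReal.ofReal (normAbs F (Algebra.discr F bE) ^
        (Fintype.card a * Fintype.card b))) f) m := by
  have h1 := map_unipCoord hdeg hσ hbE hα₁ hα₂ hdet m _ rfl
  simp_rw [integrandG_descent hη]
  simp only [integrandL, descent]
  generalize (inclHL E a b m.1)⁻¹ * x * inclLF F E a b m.2 = y at h1 ⊢
  have h3 := normAbs_nonneg (Algebra.discr F bE)
  have h4 := normAbs_pos hdet
  have h5 := (modQ_pos y).le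
  -- Of the Jacobian, `δ_Q(y)^{-1/2}` and the power of the discriminant are already part of the
  -- descent, the latter through the normalization of `dw`. Only `|det T|⁻¹` is left over.
  rw [integral_const_mul, integral_unipCoord hχ hηt (continuous_map_algEquiv hdeg σ) hη hf hfs y
    (by positivity) h1,
    matHaar_eq_smul (ENNReal.ofReal (normAbs F (Algebra.discr F bE) ^
      (Fintype.card a * Fintype.card b))), integral_smul_measure, ENNReal.toReal_ofReal
    (pow_nonneg h3 _), Complex.real_smul]
  push_cast
  ring

end Evaluation

/-! ## The descent of a Schwartz function -/

section Schwartz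

open Filter Topology

/-- Local constancy is uniform over the compact support. Applying the same to `v⁻¹` covers a `g`
outside the support whose translate `g v` lies in it. -/
theorem eventually_right_invariant {A X : Type*} [Group A] [TopologicalSpace A]
    [IsTopologicalGroup A] [Zero X] {f : A → X} (hf : IsLocallyConstant f)
    (hfs : HasCompactSupport f) : ∀ᶠ v in 𝓝 (1 : A), ∀ g, f (g * v) = f g := by
  have h1 : ∀ᶠ v in 𝓝 (1 : A), ∀ g ∈ tsupport f, f (g * v) = f g := by
    refine IsCompact.eventually_forall_of_forall_eventually hfs fun g _ => ?_
    have h2 : ∀ᶠ p in 𝓝 ((1 : A), g), f (p.2 * p.1) = f g := by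
      have h3 : Tendsto (fun p : A × A => p.2 * p.1) (𝓝 (1, g)) (𝓝 g) := by
        have : Continuous fun p : A × A => p.2 * p.1 := continuous_snd.mul continuous_fst
        simpa using this.tendsto (1, g)
      exact h3.eventually (hf.eventually_eq g)
    have h4 : ∀ᶠ p in 𝓝 ((1 : A), g), f p.2 = f g :=
      (continuous_snd.tendsto ((1 : A), g)).eventually (hf.eventually_eq g)
    filter_upwards [h2, h4] with p h5 h6
    rw [h5, h6]
  have h2 : ∀ᶠ v in 𝓝 (1 : A), ∀ g ∈ tsupport f, f (g * v⁻¹) = f g := by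
    have : Tendsto (fun v : A => v⁻¹) (𝓝 1) (𝓝 1) := by
      simpa using (continuous_inv (G := A)).tendsto 1
    exact this.eventually h1
  filter_upwards [h1, h2] with v h3 h4 g
  by_cases hg : g ∈ tsupport f
  · exact h3 g hg
  by_cases hgv : g * v ∈ tsupport f
  · simpa using (h4 _ hgv).symm
  · rw [image_eq_zero_of_notMem_tsupport hg, image_eq_zero_of_notMem_tsupport hgv]

attribute [local instance] properSpace_of_locallyCompact matrix_secondCountable gl_secondCountable

variable {F E : Type*} [NontriviallyNormedField F] [LocallyCompactSpace F] [IsUltrametricDist F]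
  [NontriviallyNormedField E] [LocallyCompactSpace E] [IsUltrametricDist E] [NormedAlgebra F E]
  {a b : Type*} [Fintype a] [DecidableEq a] [Fintype b] [DecidableEq b]
  {σ : E ≃ₐ[F] E} {χ ηt : Eˣ →* ℂˣ} {ι : Type*} [Fintype ι] [DecidableEq ι]

/-- Moving `v` past `k₂` replaces it by `k₂⁻¹ v k₂`, and compactness of `GL(𝔬_F)` keeps all these
conjugates in the neighbourhood where `f` is invariant. -/
theorem eventually_avgK_mul {f : GL (ι ⊕ ι) E → ℂ} (hf : IsLocallyConstant f)
    (hfs : HasCompactSupport f) :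
    ∀ᶠ v in 𝓝 (1 : GL (ι ⊕ ι) E), ∀ g, avgK F σ χ f (g * v) = avgK F σ χ f g := by
  have h1 := eventually_right_invariant hf hfs
  have h2 : ∀ᶠ v in 𝓝 (1 : GL (ι ⊕ ι) E), ∀ k ∈ maxCompact (ι ⊕ ι) F,
      ∀ g, f (g * ((extGL F E k)⁻¹ * v * extGL F E k)) = f g := by
    refine IsCompact.eventually_forall_of_forall_eventually isCompact_maxCompact fun k _ => ?_
    have h3 : Continuous fun p : GL (ι ⊕ ι) E × GL (ι ⊕ ι) F =>
        (extGL F E p.2)⁻¹ * p.1 * extGL F E p.2 :=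
      ((continuous_extGL.comp continuous_snd).inv.mul continuous_fst).mul
        (continuous_extGL.comp continuous_snd)
    have h4 := h3.tendsto (1, k)
    simp only [mul_one, inv_mul_cancel] at h4
    exact h4.eventually h1
  filter_upwards [h2] with v hv g
  refine setIntegral_congr_fun (isOpen_maxCompact.prod isOpen_maxCompact).measurableSet
    fun k₁ _ => setIntegral_congr_fun isOpen_maxCompact.measurableSet fun k₂ hk₂ => ?_
  have := hv k₂ hk₂ ((diagGL k₁)⁻¹ * g * extGL F E k₂)
  have h3 : (diagGL k₁)⁻¹ * g * extGL F E k₂ * ((extGL F E k₂)⁻¹ * v * extGL F E k₂) =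
      (diagGL k₁)⁻¹ * (g * v) * extGL F E k₂ := by group
  rw [h3] at this
  simp only [this]

theorem normAbs_eq_one_of_norm_sub_one_lt {c : E} (hc : ‖c - 1‖ < 1) : normAbs E c = 1 := by
  refine normAbs_eq_one_of_norm_eq_one ?_
  have h1 : ‖c - 1‖ ≠ ‖(1 : E)‖ := by rw [norm_one]; exact hc.ne
  have h2 := IsUltrametricDist.norm_add_eq_max_of_norm_ne_norm h1
  rwa [sub_add_cancel, norm_one, max_eq_right hc.le] at h2

theorem eventually_normAbs_det : ∀ᶠ g in 𝓝 (1 : GL ι E), normAbs E g.val.det = 1 := by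
  have h1 : Continuous fun g : GL ι E => ‖g.val.det - 1‖ :=
    ((gl_continuous_val.matrix_det).sub continuous_const).norm
  have h2 := h1.tendsto 1
  simp only [Units.val_one, Matrix.det_one, sub_self, norm_zero] at h2
  filter_upwards [h2.eventually (gt_mem_nhds one_pos)] with g hg
  exact normAbs_eq_one_of_norm_sub_one_lt hg

theorem eventually_modQ_mul : ∀ᶠ l in 𝓝 (1 : GL (a ⊕ a) E × GL (b ⊕ b) E),
    ∀ y, modQ (y * l) = modQ y := by
  filter_upwards [continuous_fst.continuousAt.eventually eventually_normAbs_det,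
    continuous_snd.continuousAt.eventually eventually_normAbs_det] with l h1 h2 y
  simp only [modQ, Prod.fst_mul, Prod.snd_mul, Units.val_mul, Matrix.det_mul, normAbs_mul, h1, h2,
    mul_one]

theorem isLocallyConstant_descent (c : ℝ≥0∞) {f : GL ((a ⊕ b) ⊕ (a ⊕ b)) E → ℂ}
    (hf : IsLocallyConstant f) (hfs : HasCompactSupport f) :
    IsLocallyConstant (descent F σ χ c f) := by
  have h1 : ∀ᶠ l in 𝓝 (1 : GL (a ⊕ a) E × GL (b ⊕ b) E), ∀ y,
      descent F σ χ c f (y * l) = descent F σ χ c f y := by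
    have h2 := continuous_levi.continuousAt (x := (1 : GL (a ⊕ a) E × GL (b ⊕ b) E))
    rw [ContinuousAt, map_one] at h2
    filter_upwards [h2.eventually (eventually_avgK_mul (σ := σ) (χ := χ) (F := F) hf hfs),
      eventually_modQ_mul] with l h3 h4 y
    simp only [descent, h4, map_mul, ← mul_assoc, h3]
  rw [IsLocallyConstant.iff_eventually_eq]
  intro y
  have h2 : Tendsto (fun y' => y⁻¹ * y') (𝓝 y) (𝓝 1) := by
    simpa using (continuous_const_mul y⁻¹).tendsto y
  filter_upwards [h2.eventually h1] with y' h3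
  simpa using h3 y

theorem isCompact_gl_of_isCompact {S T : Set (Matrix ι ι E)} (hS : IsCompact S)
    (hT : IsCompact T) : IsCompact {g : GL ι E | g.val ∈ S ∧ (g⁻¹).val ∈ T} := by
  have h1 : IsCompact (MulOpposite.unop ⁻¹' T) :=
    (MulOpposite.opHomeomorph.symm : (Matrix ι ι E)ᵐᵒᵖ ≃ₜ Matrix ι ι E).isCompact_preimage.2 hT
  exact gl_isClosedEmbedding.isCompact_preimage (hS.prod h1)

/-- The diagonal blocks of `unip w * levi y` and of its inverse are those of `y` and `y⁻¹`, whatever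
`w` is. If the product meets a compact set, then `y` and `y⁻¹` have entries in compact sets. -/
theorem hasCompactSupport_descent (c : ℝ≥0∞) {f : GL ((a ⊕ b) ⊕ (a ⊕ b)) E → ℂ}
    (hfs : HasCompactSupport f) : HasCompactSupport (descent F σ χ c f) := by
  obtain ⟨C, hC, hC'⟩ := isCompact_translates F hfs
  let e := Equiv.sumSumSumComm a a b b
  let π : Matrix ((a ⊕ b) ⊕ (a ⊕ b)) ((a ⊕ b) ⊕ (a ⊕ b)) E →
      Matrix (a ⊕ a) (a ⊕ a) E × Matrix (b ⊕ b) (b ⊕ b) E :=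
    fun g => (g.submatrix (e ∘ Sum.inl) (e ∘ Sum.inl), g.submatrix (e ∘ Sum.inr) (e ∘ Sum.inr))
  have hπ : Continuous π := (continuous_id.matrix_submatrix _ _).prodMk
    (continuous_id.matrix_submatrix _ _)
  have hπ' : ∀ w y, π (unip w * levi y).val = (y.1.val, y.2.val) := fun w y => by
    rw [unip_eq, levi_eq, ← map_mul, blockSwap_val, Units.val_mul, upperGL_val, diagGL_val,
      Matrix.fromBlocks_multiply]
    simp only [π, Matrix.submatrix_submatrix, Matrix.mul_zero, Matrix.zero_mul, Matrix.one_mul,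
      add_zero, zero_add, Prod.mk.injEq]
    constructor <;> ext (i | i) (j | j) <;> simp [e]
  have hπ'' : ∀ w y, π ((unip w * levi y)⁻¹).val = ((y.1⁻¹).val, (y.2⁻¹).val) := fun w y => by
    have : (unip w * levi y)⁻¹ = levi y⁻¹ * unip (-w) := by
      rw [mul_inv_rev, unip_neg, map_inv]
    rw [this, unip_conj_levi]
    exact hπ' _ _
  have hcv : Continuous fun g : GL ((a ⊕ b) ⊕ (a ⊕ b)) E => π g.val := hπ.comp gl_continuous_val
  have hci : Continuous fun g : GL ((a ⊕ b) ⊕ (a ⊕ b)) E => π (g⁻¹).val :=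
    hπ.comp gl_continuous_inv_val
  refine HasCompactSupport.intro
    ((isCompact_gl_of_isCompact (hC.image (continuous_fst.comp hcv))
      (hC.image (continuous_fst.comp hci))).prod
    (isCompact_gl_of_isCompact (hC.image (continuous_snd.comp hcv))
      (hC.image (continuous_snd.comp hci)))) fun y hy => ?_
  have h1 : ∀ w, unip w * levi y ∉ C := fun w hw => hy
    ⟨⟨⟨_, hw, congrArg Prod.fst (hπ' w y)⟩, ⟨_, hw, congrArg Prod.fst (hπ'' w y)⟩⟩,
      ⟨⟨_, hw, congrArg Prod.snd (hπ' w y)⟩, ⟨_, hw, congrArg Prod.snd (hπ'' w y)⟩⟩⟩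
  have h2 : ∀ w, avgK F σ χ f (unip w * levi y) = 0 := fun w => by
    rw [avgK]
    refine setIntegral_eq_zero_of_forall_eq_zero fun k₁ hk₁ =>
      setIntegral_eq_zero_of_forall_eq_zero fun k₂ hk₂ => ?_
    have h3 : f ((diagGL k₁)⁻¹ * (unip w * levi y) * extGL F E k₂) = 0 := by
      by_contra h
      refine h1 w (hC' _ (k₁, k₂) ?_ h)
      rw [← SetLike.mem_coe, compactG_coe]
      exact ⟨hk₁, hk₂⟩
    rw [h3, zero_mul, zero_mul]
  simp only [descent, h2, integral_zero, mul_zero]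

end Schwartz

/-! ## Rational orbits -/

section RationalOrbit

open TensorProduct

variable {F E Ω : Type*} [Field F] [Field E] [Algebra F E] [Field Ω] [Algebra F Ω]
  {J : Type*} (ℬ : Module.Basis J F Ω)

/-- The coordinate of an element of `Ω ⊗ E` in a basis of `Ω`. -/
def tensorCoord (E : Type*) [Field E] [Algebra F E] (j : J) : Ω ⊗[F] E →ₗ[F] E :=
  (TensorProduct.lid F E).toLinearMap ∘ₗ (ℬ.coord j).rTensor E

theorem tensorCoord_tmul (j : J) (w : Ω) (z : E) :
    tensorCoord ℬ E j (w ⊗ₜ z) = ℬ.repr w j • z := by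
  simp [tensorCoord]

theorem tensorCoord_mul (j : J) (y : Ω ⊗[F] E) (z : E) :
    tensorCoord ℬ E j (y * (1 ⊗ₜ z)) = tensorCoord ℬ E j y * z := by
  induction y using TensorProduct.induction_on with
  | zero => simp
  | tmul w u => simp [tensorCoord_tmul]
  | add y y' h h' => rw [add_mul, map_add, h, h', map_add, add_mul]

theorem tensorCoord_map (σ : E ≃ₐ[F] E) (j : J) (y : Ω ⊗[F] E) :
    tensorCoord ℬ E j (Algebra.TensorProduct.map (AlgHom.id F Ω) (σ : E →ₐ[F] E) y) =
      σ (tensorCoord ℬ E j y) := by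
  induction y using TensorProduct.induction_on with
  | zero => simp
  | tmul w u => simp [tensorCoord_tmul]
  | add y y' h h' => rw [map_add, map_add, h, h', map_add, map_add]

/-- The expansion is stated for every larger index set so that finitely many matrix entries can
share one. -/
theorem exists_sum_tensorCoord (y : Ω ⊗[F] E) :
    ∃ I : Finset J, ∀ I', I ⊆ I' → y = ∑ j ∈ I', ℬ j ⊗ₜ tensorCoord ℬ E j y := by
  classical
  induction y using TensorProduct.induction_on with
  | zero => exact ⟨∅, fun _ _ => by simp⟩
  | tmul w u =>
    refine ⟨(ℬ.repr w).support, fun I' hI => ?_⟩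
    simp only [tensorCoord_tmul]
    conv_lhs => rw [← ℬ.linearCombination_repr w, Finsupp.linearCombination_apply, Finsupp.sum,
      Finset.sum_subset hI fun j _ hj => by
        rw [Finsupp.notMem_support_iff.1 hj, zero_smul], TensorProduct.sum_tmul]
    exact Finset.sum_congr rfl fun j _ => TensorProduct.smul_tmul _ _ _
  | add y y' h h' =>
    obtain ⟨I, hI⟩ := h
    obtain ⟨I', hI'⟩ := h'
    refine ⟨I ∪ I', fun I'' hs => ?_⟩
    conv_lhs => rw [hI I'' (Finset.union_subset_left hs), hI' I'' (Finset.union_subset_right hs),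
      ← Finset.sum_add_distrib]
    exact Finset.sum_congr rfl fun j _ => by rw [map_add, TensorProduct.tmul_add]

variable {m n p : Type*} [Fintype m] [Fintype n] [Fintype p]

theorem tensorCoord_matrix_mul (j : J) (M : Matrix m n (Ω ⊗[F] E)) (N : Matrix n p E) :
    (M * N.map (Algebra.TensorProduct.includeRight : E →ₐ[F] Ω ⊗[F] E)).map (tensorCoord ℬ E j) =
      M.map (tensorCoord ℬ E j) * N := by
  ext i k
  simp [Matrix.mul_apply, tensorCoord_mul]

theorem tensorCoord_mul_matrix (j : J) (M : Matrix m n E) (N : Matrix n p (Ω ⊗[F] E)) :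
    (M.map (Algebra.TensorProduct.includeRight : E →ₐ[F] Ω ⊗[F] E) * N).map (tensorCoord ℬ E j) =
      M * N.map (tensorCoord ℬ E j) := by
  ext i k
  simp only [Matrix.mul_apply, Matrix.map_apply, map_sum,
    Algebra.TensorProduct.includeRight_apply]
  refine Finset.sum_congr rfl fun l _ => ?_
  rw [mul_comm, tensorCoord_mul, mul_comm]

/-- A tuple of matrices with an invertible combination over `Ω ⊗ E` has one over `F`. -/
theorem exists_isUnit_combination [Infinite F] {ι : Type*} [Fintype ι] [DecidableEq ι] {J : Type*}
    (I : Finset J) (w₁ w₂ : J → Matrix ι ι E) (c : J → Ω)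
    (h₁ : IsUnit (∑ j ∈ I, (w₁ j).map fun z => c j ⊗ₜ[F] z))
    (h₂ : IsUnit (∑ j ∈ I, (w₂ j).map fun z => c j ⊗ₜ[F] z)) :
    ∃ d : J → F, IsUnit (∑ j ∈ I, d j • w₁ j) ∧ IsUnit (∑ j ∈ I, d j • w₂ j) := by
  let W : (J → Matrix ι ι E) → Matrix ι ι (MvPolynomial J E) := fun w =>
    ∑ j ∈ I, (w j).map fun z => MvPolynomial.X j * MvPolynomial.C z
  let Ψ : MvPolynomial J E →+* Ω ⊗[F] E := MvPolynomial.eval₂Hom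
    (Algebra.TensorProduct.includeRight : E →ₐ[F] Ω ⊗[F] E) fun j => c j ⊗ₜ 1
  have hΨ : ∀ w, (W w).map Ψ = ∑ j ∈ I, (w j).map fun z => c j ⊗ₜ[F] z := fun w => by
    ext i k
    simp [W, Ψ, Matrix.sum_apply]
  have hev : ∀ w (d : J → F), (W w).map (MvPolynomial.eval fun j => algebraMap F E (d j)) =
      ∑ j ∈ I, d j • w j := fun w d => by
    ext i k
    simp only [W, Matrix.map_apply, Matrix.sum_apply, map_sum, map_mul, MvPolynomial.eval_X,
      MvPolynomial.eval_C, Matrix.smul_apply, Algebra.smul_def (A := E)]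
  have hne : (W w₁).det * (W w₂).det ≠ 0 := fun h0 => by
    -- Specializing the variables to the `c j` gives an invertible determinant over `Ω ⊗ E`, so the
    -- polynomial is nonzero. It then has a nonzero value at a point with coordinates in the
    -- infinite field `F`.
    have h3 := congrArg Ψ h0
    rw [map_mul, map_zero, RingHom.map_det, RingHom.map_det] at h3
    have h4 : IsUnit ((Ψ.mapMatrix (W w₁)).det * (Ψ.mapMatrix (W w₂)).det) := by
      refine IsUnit.mul ((Matrix.isUnit_iff_isUnit_det _).1 ?_)
        ((Matrix.isUnit_iff_isUnit_det _).1 ?_)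
      · have h5 : IsUnit ((W w₁).map Ψ) := (hΨ w₁).symm ▸ h₁
        exact h5
      · have h5 : IsUnit ((W w₂).map Ψ) := (hΨ w₂).symm ▸ h₂
        exact h5
    rw [h3] at h4
    exact not_isUnit_zero h4
  have hinf : (Set.range (algebraMap F E)).Infinite :=
    Set.infinite_range_of_injective (algebraMap F E).injective
  by_contra hcon
  refine hne (MvPolynomial.funext_set (fun _ => Set.range (algebraMap F E)) (fun _ => hinf)
    fun e he => ?_)
  choose d hd using fun j => he j trivial
  obtain rfl : (fun j => algebraMap F E (d j)) = e := funext hd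
  rw [map_zero, map_mul, RingHom.map_det, RingHom.map_det]
  by_contra h0
  refine hcon ⟨d, ?_, ?_⟩ <;> rw [Matrix.isUnit_iff_isUnit_det, isUnit_iff_ne_zero, ← hev]
  · exact left_ne_zero_of_mul h0
  · exact right_ne_zero_of_mul h0

/-- A rational point in the geometric orbit is in the rational orbit. -/
theorem exists_rational_of_geometric [Infinite F] (Ω : Type*) [Field Ω] [Algebra F Ω]
    {ι : Type*} [Fintype ι] [DecidableEq ι]
    (σ : E ≃ₐ[F] E) {s t : GL (ι ⊕ ι) E} {h : GL ι (Ω ⊗[F] E) × GL ι (Ω ⊗[F] E)}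
    (hh : diagGL h * toBC F Ω s * (conjBC σ Ω (diagGL h))⁻¹ = toBC F Ω t) :
    ∃ g : GL ι E × GL ι E, diagGL g * s * (conjGL σ (diagGL g))⁻¹ = t := by
  classical
  let ℬ := Module.Basis.ofVectorSpace F Ω
  let comp := fun (j : _) (M : Matrix ι ι (Ω ⊗[F] E)) => M.map (tensorCoord ℬ E j)
  have hI : ∀ M : Matrix ι ι (Ω ⊗[F] E), ∃ I : Finset _, ∀ I', I ⊆ I' →
      M = ∑ j ∈ I', (comp j M).map fun z => ℬ j ⊗ₜ[F] z := fun M => by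
    choose I hI using fun i k => exists_sum_tensorCoord ℬ (M i k)
    refine ⟨Finset.univ.biUnion fun i => Finset.univ.biUnion fun k => I i k, fun I' hI' => ?_⟩
    ext i k
    rw [Matrix.sum_apply]
    refine hI i k I' (Finset.Subset.trans ?_ hI')
    exact (Finset.subset_biUnion_of_mem (I i) (Finset.mem_univ k)).trans
      (Finset.subset_biUnion_of_mem (fun i => Finset.univ.biUnion fun k => I i k)
        (Finset.mem_univ i))
  obtain ⟨I₁, hI₁⟩ := hI h.1.val
  obtain ⟨I₂, hI₂⟩ := hI h.2.val
  have h1 := hI₁ (I₁ ∪ I₂) Finset.subset_union_left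
  have h2 := hI₂ (I₁ ∪ I₂) Finset.subset_union_right
  obtain ⟨d, hd₁, hd₂⟩ := exists_isUnit_combination (I₁ ∪ I₂) (fun j => comp j h.1.val)
    (fun j => comp j h.2.val) ℬ (h1 ▸ h.1.isUnit) (h2 ▸ h.2.isUnit)
  -- Rewritten as `h s = t h̄`, the orbit equation is linear in `h` with coefficients in `E`. It
  -- therefore holds for each coordinate of `h` in a basis of `Ω` over `F`, and for every
  -- `F`-combination of these.
  have hcomp : ∀ j, Matrix.fromBlocks (comp j h.1.val) 0 0 (comp j h.2.val) * s.val =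
      t.val * (Matrix.fromBlocks (comp j h.1.val) 0 0 (comp j h.2.val)).map σ := fun j => by
    rw [mul_inv_eq_iff_eq_mul] at hh
    have h3 := congrArg (fun g : GL (ι ⊕ ι) (Ω ⊗[F] E) => g.val.map (tensorCoord ℬ E j)) hh
    simp only [Units.val_mul] at h3
    have h4 := tensorCoord_matrix_mul ℬ j (diagGL h).val s.val
    have h5 := tensorCoord_mul_matrix ℬ j t.val (conjBC σ Ω (diagGL h)).val
    have h6 := h4.symm.trans (h3.trans h5)
    have h7 : (diagGL h).val.map (tensorCoord ℬ E j) =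
        Matrix.fromBlocks (comp j h.1.val) 0 0 (comp j h.2.val) := by
      rw [diagGL_val, Matrix.fromBlocks_map, Matrix.map_zero _ (map_zero _)]
    have h8 : (conjBC σ Ω (diagGL h)).val.map (tensorCoord ℬ E j) =
        ((diagGL h).val.map (tensorCoord ℬ E j)).map σ := by
      ext i k
      exact tensorCoord_map ℬ σ j _
    rwa [h8, h7] at h6
  obtain ⟨g₁, hg₁⟩ := hd₁
  obtain ⟨g₂, hg₂⟩ := hd₂
  refine ⟨(g₁, g₂), ?_⟩
  rw [mul_inv_eq_iff_eq_mul]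
  refine Units.ext ?_
  have h9 : (diagGL (g₁, g₂)).val = ∑ j ∈ I₁ ∪ I₂, d j •
      Matrix.fromBlocks (comp j h.1.val) 0 0 (comp j h.2.val) := by
    rw [diagGL_val, hg₁, hg₂]
    ext (i | i) (k | k) <;> simp [Matrix.sum_apply]
  have h10 : (conjGL σ (diagGL (g₁, g₂))).val = ∑ j ∈ I₁ ∪ I₂, d j •
      (Matrix.fromBlocks (comp j h.1.val) 0 0 (comp j h.2.val)).map σ := by
    change (diagGL (g₁, g₂)).val.map σ = _
    rw [h9]
    ext i k
    simp [Matrix.sum_apply]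
  rw [Units.val_mul, Units.val_mul, h9, h10, Finset.sum_mul, Finset.mul_sum]
  refine Finset.sum_congr rfl fun j _ => ?_
  rw [Matrix.smul_mul, hcomp, Matrix.mul_smul]

end RationalOrbit

/-! ## Zariski closed sets are closed -/

section ZariskiClosed

open TensorProduct

variable {F : Type*} [NontriviallyNormedField F] {Ω : Type*} [Field Ω] [Algebra F Ω]
  {X : Type*} [TopologicalSpace X]

/-- `Ω`-valued functions built from continuous `F`-valued functions. -/
def continuousSpan (F Ω X : Type*) [NontriviallyNormedField F] [Field Ω] [Algebra F Ω]
    [TopologicalSpace X] : Ω ⊗[F] C(X, F) →ₐ[Ω] (X → Ω) :=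
  Algebra.TensorProduct.lift (Algebra.ofId Ω (X → Ω))
    { toFun := fun f x => algebraMap F Ω (f x)
      map_one' := by ext; simp
      map_mul' := fun f g => by ext; simp
      map_zero' := by ext; simp
      map_add' := fun f g => by ext; simp
      commutes' := fun _ => rfl }
    fun _ _ => Commute.all _ _

/-- No topology on `Ω` is used: vanishing is tested by all `F`-linear functionals on `Ω`, each of
which turns the function into a continuous `F`-valued one. -/
theorem isClosed_zeros_continuousSpan (y : Ω ⊗[F] C(X, F)) :
    IsClosed {x | continuousSpan F Ω X y x = 0} := by
  have h1 : ∀ l : Module.Dual F Ω, Continuous fun x => l (continuousSpan F Ω X y x) := fun l => by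
    induction y using TensorProduct.induction_on with
    | zero => simpa using continuous_const
    | tmul w f =>
      have : (fun x => l (continuousSpan F Ω X (w ⊗ₜ f) x)) = fun x => f x * l w := by
        ext x
        have : continuousSpan F Ω X (w ⊗ₜ f) x = f x • w := by
          rw [continuousSpan, Algebra.TensorProduct.lift_tmul, Algebra.smul_def, mul_comm]
          rfl
        rw [this, map_smul, smul_eq_mul]
      rw [this]
      exact f.continuous.mul continuous_const
    | add y y' h h' =>
      simp only [map_add, Pi.add_apply]
      exact h.add h'
  have h2 : {x | continuousSpan F Ω X y x = 0} =
      ⋂ l : Module.Dual F Ω, {x | l (continuousSpan F Ω X y x) = 0} := by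
    ext x
    simp only [Set.mem_setOf_eq, Set.mem_iInter]
    exact (Module.forall_dual_apply_eq_zero_iff F _).symm
  rw [h2]
  exact isClosed_iInter fun l => isClosed_eq (h1 l) continuous_const

/-- The preimage of a Zariski closed set under a continuous map, through a linear map from a
finite-dimensional space over the local field, is closed. -/
theorem isClosed_preimage_of_isZariskiClosed [CompleteSpace F] {W V : Type*} [AddCommGroup W]
    [Module F W] [FiniteDimensional F W] [TopologicalSpace W] [IsTopologicalAddGroup W]
    [ContinuousSMul F W] [T2Space W] [AddCommGroup V] [Module Ω V] [Module F V]
    [IsScalarTower F Ω V] {Z : Set V} (hZ : IsZariskiClosed Ω Z) (T : W →ₗ[F] V) {φ : X → W}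
    (hφ : Continuous φ) : IsClosed {x | T (φ x) ∈ Z} := by
  obtain ⟨P, rfl⟩ := hZ
  have h1 : ∀ l : Module.Dual Ω V, ∃ y, continuousSpan F Ω X y = fun x => l (T (φ x)) := fun l => by
    let b := Module.finBasis F W
    let c : ∀ i, C(X, F) := fun i => ⟨fun x => b.coord i (φ x),
      (LinearMap.continuous_of_finiteDimensional _).comp hφ⟩
    refine ⟨∑ i, l (T (b i)) ⊗ₜ c i, ?_⟩
    ext x
    conv_rhs => rw [← b.sum_repr (φ x)]
    simp only [map_sum, Finset.sum_apply, continuousSpan, Algebra.TensorProduct.lift_tmul]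
    refine Finset.sum_congr rfl fun i _ => ?_
    rw [map_smul, ← algebraMap_smul Ω, map_smul, smul_eq_mul, mul_comm]
    rfl
  have h2 : ∀ p : MvPolynomial (Module.Dual Ω V) Ω, ∃ y, continuousSpan F Ω X y =
      fun x => MvPolynomial.eval (fun l : Module.Dual Ω V => l (T (φ x))) p := fun p => by
    induction p using MvPolynomial.induction_on with
    | C w =>
      refine ⟨algebraMap Ω _ w, ?_⟩
      rw [AlgHom.commutes]
      ext x
      simp
    | add p q hp hq =>
      obtain ⟨y, hy⟩ := hp
      obtain ⟨y', hy'⟩ := hq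
      refine ⟨y + y', ?_⟩
      rw [map_add, hy, hy']
      ext x
      simp
    | mul_X p l hp =>
      obtain ⟨y, hy⟩ := hp
      obtain ⟨y', hy'⟩ := h1 l
      refine ⟨y * y', ?_⟩
      rw [map_mul, hy, hy']
      ext x
      simp
  have h3 : {x | T (φ x) ∈ {v | ∀ p ∈ P, MvPolynomial.eval (fun l : Module.Dual Ω V => l v) p = 0}} =
      ⋂ p ∈ P, {x | MvPolynomial.eval (fun l : Module.Dual Ω V => l (T (φ x))) p = 0} := by
    ext x
    simp
  rw [h3]
  refine isClosed_biInter fun p _ => ?_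
  obtain ⟨y, hy⟩ := h2 p
  have h4 := isClosed_zeros_continuousSpan y
  rwa [hy] at h4

end ZariskiClosed

/-! ## Orbits and convergence -/

section Convergence

open Filter Topology

attribute [local instance] properSpace_of_locallyCompact matrix_secondCountable gl_secondCountable

/-- A closed orbit is locally compact, so the orbit map of a σ-compact group is open onto it. The
images of translates of `K` then form an open cover of the compact set of orbit points in `C`. -/
theorem finite_cover_of_isClosed_orbit {A X : Type*} [Group A] [TopologicalSpace A]
    [IsTopologicalGroup A] [SigmaCompactSpace A] [TopologicalSpace X] [T2Space X]
    [LocallyCompactSpace X] [MulAction A X] [ContinuousSMul A X] (x : X)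
    (hx : IsClosed (MulAction.orbit A x)) {K : Subgroup A} (hK : IsOpen (K : Set A)) {C : Set X}
    (hC : IsCompact C) : ∃ t : Finset A, ∀ a : A, a⁻¹ • x ∈ C →
      ∃ r ∈ t, ∃ s ∈ MulAction.stabilizer A x, ∃ k ∈ K, a = s * r * k := by
  let O := MulAction.orbit A x
  have : LocallyCompactSpace O := hx.isClosedEmbedding_subtypeVal.locallyCompactSpace
  have : ContinuousSMul A O := ⟨by
    refine Continuous.subtype_mk (f := fun p : A × O => p.1 • (p.2 : X)) ?_ _
    exact continuous_fst.smul (continuous_subtype_val.comp continuous_snd)⟩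
  let x₀ : O := ⟨x, MulAction.mem_orbit_self x⟩
  have hopen := isOpenMap_smul_of_sigmaCompact (G := A) x₀
  -- The image of `(r K)⁻¹`, with inverses because the points in question are `a⁻¹ • x`.
  let V : A → Set O := fun r => (fun g : A => g • x₀) '' ((fun g : A => g⁻¹ * r⁻¹) ''
    (K : Set A))
  have hV : ∀ r, IsOpen (V r) := fun r => by
    refine hopen _ ?_
    have : (fun g : A => g⁻¹ * r⁻¹) '' (K : Set A) =
        ((Homeomorph.inv A).trans (Homeomorph.mulRight r⁻¹)) '' (K : Set A) := rfl
    rw [this]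
    exact (Homeomorph.isOpenMap _) _ hK
  have hC' : IsCompact (Subtype.val ⁻¹' C : Set O) := hx.isClosedEmbedding_subtypeVal.isCompact_preimage hC
  obtain ⟨t, ht⟩ := hC'.elim_finite_subcover V hV (by
    rintro ⟨y, g, rfl⟩ -
    refine Set.mem_iUnion.2 ⟨g⁻¹, g, ⟨1, K.one_mem, by simp⟩, rfl⟩)
  refine ⟨t, fun a ha => ?_⟩
  have h1 := ht (show (⟨a⁻¹ • x, a⁻¹, rfl⟩ : O) ∈ _ from ha)
  simp only [Set.mem_iUnion] at h1
  obtain ⟨r, hr, -, ⟨k, hk, rfl⟩, h2⟩ := h1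
  have h3 : (k⁻¹ * r⁻¹) • x = a⁻¹ • x := congrArg Subtype.val h2
  refine ⟨r, hr, a * (k⁻¹ * r⁻¹), ?_, k, hk, by group⟩
  rw [MulAction.mem_stabilizer_iff, mul_smul, h3, smul_inv_smul]

variable {F E : Type*} [NontriviallyNormedField F] [LocallyCompactSpace F] [IsUltrametricDist F]
  [NontriviallyNormedField E] [LocallyCompactSpace E] [IsUltrametricDist E] [NormedAlgebra F E]
  {σ : E ≃ₐ[F] E} {χ ηt : Eˣ →* ℂˣ} {ι : Type*} [Fintype ι] [DecidableEq ι]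

/-- The action of `H' × H''` on `G'`. -/
def twoSidedAction (F E ι : Type*) [NontriviallyNormedField F] [NontriviallyNormedField E]
    [NormedAlgebra F E] [Fintype ι] [DecidableEq ι] :
    MulAction ((GL ι E × GL ι E) × GL (ι ⊕ ι) F) (GL (ι ⊕ ι) E) where
  smul p g := diagGL p.1 * g * (extGL F E p.2)⁻¹
  one_smul g := by
    change diagGL 1 * g * (extGL F E 1)⁻¹ = g
    simp
  mul_smul p q g := by
    change diagGL (p.1 * q.1) * g * (extGL F E (p.2 * q.2))⁻¹ =
      diagGL p.1 * (diagGL q.1 * g * (extGL F E q.2)⁻¹) * (extGL F E p.2)⁻¹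
    rw [map_mul, map_mul]
    group

theorem toSymm_twoSided (g : GL (ι ⊕ ι) E) (p : (GL ι E × GL ι E) × GL (ι ⊕ ι) F) :
    toSymm σ (diagGL p.1 * g * (extGL F E p.2)⁻¹) =
      diagGL p.1 * toSymm σ g * (conjGL σ (diagGL p.1))⁻¹ := by
  rw [toSymm, toSymm, map_mul, map_mul, map_inv, conjGL_extGL]
  group

/-- The orbit of `x` is the preimage, under `g ↦ g ḡ⁻¹`, of the rational points of the geometric
orbit of `x x̄⁻¹`. That geometric orbit is Zariski closed, so its preimage is closed. -/
theorem isClosed_orbit [CharZero F] (hdeg : Module.finrank F E = 2) (hσ : σ ≠ AlgEquiv.refl)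
    {x : GL (ι ⊕ ι) E} (hx : OrbitIsClosed σ (toSymm σ x)) :
    IsClosed {g | ∃ p : (GL ι E × GL ι E) × GL (ι ⊕ ι) F,
      diagGL p.1 * x * (extGL F E p.2)⁻¹ = g} := by
  obtain ⟨z, hz, hz0, hspan⟩ := exists_imaginary σ hdeg hσ
  have hfd : FiniteDimensional F E := Module.finite_of_finrank_eq_succ hdeg
  have hσc := continuous_map_algEquiv hdeg σ
  have hsc : Continuous fun g : GL (ι ⊕ ι) E => (toSymm σ g).val :=
    gl_continuous_val.comp (continuous_id.mul (continuous_conjGL hσc).inv)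
  let T : Matrix (ι ⊕ ι) (ι ⊕ ι) E →ₗ[F] Matrix (ι ⊕ ι) (ι ⊕ ι) (AlgebraicClosure F ⊗[F] E) :=
    (Algebra.TensorProduct.includeRight : E →ₐ[F] AlgebraicClosure F ⊗[F] E).toLinearMap.mapMatrix
  have h1 := isClosed_preimage_of_isZariskiClosed hx T hsc
  convert h1 using 1
  ext g
  constructor
  · rintro ⟨p, rfl⟩
    refine ⟨(toBC F _ p.1.1, toBC F _ p.1.2), ?_⟩
    change (_ : GL (ι ⊕ ι) (AlgebraicClosure F ⊗[F] E)).val =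
      (toBC F (AlgebraicClosure F) (toSymm σ (diagGL p.1 * x * (extGL F E p.2)⁻¹))).val
    rw [toSymm_twoSided, diagGL_toBC, conjBC_toBC, map_mul, map_mul, map_inv]
  · rintro ⟨h, hh⟩
    obtain ⟨h', hh'⟩ := exists_rational_of_geometric (AlgebraicClosure F) σ (Units.ext hh)
    -- Two elements with the same image under `g ↦ g ḡ⁻¹` differ on the right by an element fixed by
    -- conjugation, that is, by a point of `H''(F)`.
    have h2 : conjGL σ ((diagGL h' * x)⁻¹ * g) = (diagGL h' * x)⁻¹ * g := by
      have h3 : diagGL h' * (x * (conjGL σ x)⁻¹) * (conjGL σ (diagGL h'))⁻¹ * conjGL σ g = g :=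
        eq_mul_inv_iff_mul_eq.1 hh'
      rw [map_mul, map_inv, map_mul]
      conv_rhs => rw [← h3]
      group
    obtain ⟨k, hk⟩ := exists_extGL_of_conjGL_eq σ hz hz0 hspan h2
    refine ⟨(h', k⁻¹), ?_⟩
    rw [map_inv, inv_inv, hk]
    group

/-- Closedness of the orbit confines the support to finitely many double cosets of finite volume, on
which the integrand is bounded. -/
theorem integrable_integrandG [CharZero F] (hdeg : Module.finrank F E = 2)
    (hσ : σ ≠ AlgEquiv.refl) (hχ : Continuous χ) (hηt : Continuous ηt)
    (hη : ∀ c : Fˣ, (ηt (Units.map (algebraMap F E : F →* E) c) : ℂ) = etaChar F E c)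
    {x : GL (ι ⊕ ι) E} (hx : OrbitIsClosed σ (toSymm σ x)) {f : GL (ι ⊕ ι) E → ℂ}
    (hf : Continuous f) (hfs : HasCompactSupport f)
    (hinv : IsLeftInvariant (stabG F x) (integrandG F σ χ x f))
    {ν : Measure (stabG F x)} [ν.IsMulRightInvariant] [MeasurableMul (stabG F x)]
    {ρ : Measure (Quotient (QuotientGroup.rightRel (stabG F x)))}
    (hρ : IsQuotientMeasure (haarG F E ι) (stabG F x) ν ρ) :
    Integrable (fun q => integrandG F σ χ x f q.out) ρ := by
  have hg := continuous_integrandG hχ hηt (continuous_map_algEquiv hdeg σ) hη x hf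
  letI := twoSidedAction F E ι
  have : ContinuousSMul ((GL ι E × GL ι E) × GL (ι ⊕ ι) F) (GL (ι ⊕ ι) E) := ⟨by
    exact ((continuous_diagGL.comp (continuous_fst.comp continuous_fst)).mul continuous_snd).mul
      (continuous_extGL.comp (continuous_snd.comp continuous_fst)).inv⟩
  obtain ⟨t, ht⟩ := finite_cover_of_isClosed_orbit x (isClosed_orbit hdeg hσ hx)
    (isOpen_compactG F E ι) hfs
  have ht' : ∀ p, integrandG F σ χ x f p ≠ 0 → ∃ r ∈ t, ∃ s ∈ stabG F x, ∃ k ∈ compactG F E ι,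
      p = s * r * k := fun p hp => by
    have h1 : p⁻¹ • x = (diagGL p.1)⁻¹ * x * extGL F E p.2 := by
      change diagGL (p.1)⁻¹ * x * (extGL F E (p.2)⁻¹)⁻¹ = _
      rw [map_inv, map_inv, inv_inv]
    obtain ⟨r, hr, s, hs, k, hk, h⟩ := ht p (subset_tsupport f (by
      rw [h1]
      exact left_ne_zero_of_mul (left_ne_zero_of_mul hp)))
    refine ⟨r, hr, s, ?_, k, hk, h⟩
    have h2 : diagGL s.1 * x * (extGL F E s.2)⁻¹ = x := hs
    change (diagGL s.1)⁻¹ * x * extGL F E s.2 = x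
    rw [mul_inv_eq_iff_eq_mul] at h2
    rw [mul_assoc, ← h2, inv_mul_cancel_left]
  -- By invariance under the stabilizer, a bound on the compact translates `r K` is a bound on the
  -- whole support.
  have hD : IsCompact (⋃ r ∈ t, (fun k => r * k) '' (compactG F E ι : Set _)) :=
    t.finite_toSet.isCompact_biUnion fun r _ =>
      (isCompact_compactG F E ι).image (continuous_const_mul r)
  obtain ⟨C, hC⟩ := (hD.bddAbove_image hg.norm.continuousOn)
  refine integrable_of_support_subset hρ (isOpen_compactG F E ι)
    (fun r => by rw [haarG_coset]; exact one_ne_zero)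
    (fun r => by rw [haarG_coset]; exact ENNReal.one_ne_top) hg.measurable hinv (C := max C 0)
    (fun p => ?_) t ht'
  by_cases hp : integrandG F σ χ x f p = 0
  · rw [hp, norm_zero]
    exact le_max_right _ _
  obtain ⟨r, hr, s, hs, k, hk, rfl⟩ := ht' p hp
  rw [mul_assoc, hinv s hs]
  exact (hC ⟨r * k, Set.mem_biUnion hr ⟨k, hk, rfl⟩, rfl⟩).trans (le_max_left _ _)

end Convergence

/-! ## Parabolic descent of orbital integrals -/

section Descent

attribute [local instance] properSpace_of_locallyCompact matrixBorel matrixBorel_borelSpace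
  matrix_secondCountable matHaar_isAddHaar gl_secondCountable glHaar_isHaar
  prod_measurableMul₂ glHaar_sFinite gl_measurableMul₂

variable {F E : Type*} [NontriviallyNormedField F] [LocallyCompactSpace F] [IsUltrametricDist F]
  [NontriviallyNormedField E] [LocallyCompactSpace E] [IsUltrametricDist E] [NormedAlgebra F E]
  {a b : Type*} [Fintype a] [DecidableEq a] [Fintype b] [DecidableEq b]
  {σ : E ≃ₐ[F] E} {χ ηt : Eˣ →* ℂˣ}

variable (F E a b) in
-- The Iwasawa decomposition of the Haar measure: the pushforward identity holds because every coset
-- of the maximal compact subgroup has volume one in these coordinates.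
theorem haarG_eq_map : haarG F E (a ⊕ b) =
    ((haarL F E a b).prod ((haarU F E a b).prod
      ((haarG F E (a ⊕ b)).restrict (compactG F E (a ⊕ b) : Set _)))).map
      fun p => inclG F E a b p.1 * (unipG p.2.1 * p.2.2) := by
  have := haarL_sFinite F E a b
  have := haarU_sFinite F E a b
  have := haarG_sFinite F E (a ⊕ b)
  have := haarG_isHaar F E (a ⊕ b)
  have hj : Measurable fun t : (((GL a E × GL a E) × (GL b E × GL b E)) ×
      (GL (a ⊕ a) F × GL (b ⊕ b) F)) × UnipG F E a b => inclG F E a b t.1 * unipG t.2 :=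
    (continuous_inclG.measurable.comp measurable_fst).mul
      (continuous_unipG.measurable.comp measurable_snd)
  have h1 := map_eq_of_coset_measure (haarG F E (a ⊕ b)) ((haarL F E a b).prod (haarU F E a b)) hj
    (compactG F E (a ⊕ b)) (isOpen_compactG F E (a ⊕ b)).measurableSet coset_volume_descent
  conv_lhs => rw [← h1]
  rw [← Measure.prodAssoc_prod, Measure.map_map _ MeasurableEquiv.prodAssoc.measurable]
  · congr 1
    funext p
    exact mul_assoc _ _ _
  · exact (continuous_inclG.measurable.comp measurable_fst).mul
      ((continuous_unipG.measurable.comp (measurable_fst.comp measurable_snd)).mul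
        (measurable_snd.comp measurable_snd))

theorem measurable_stabIncl (x : GL (a ⊕ a) E × GL (b ⊕ b) E) : Measurable (stabIncl F x) := by
  refine Measurable.subtype_mk ?_
  exact continuous_inclG.measurable.comp measurable_subtype_coe

theorem subgroup_measurableMul {A : Type*} [Group A] [MeasurableSpace A] [MeasurableMul A]
    (S : Subgroup A) : MeasurableMul S where
  measurable_const_mul s :=
    ((measurable_const_mul (s : A)).comp measurable_subtype_coe).subtype_mk
  measurable_mul_const s :=
    ((measurable_mul_const (s : A)).comp measurable_subtype_coe).subtype_mk

/-- The Haar measure on the stabilizer is right invariant. -/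
theorem isMulRightInvariant_map_stabIncl {x : GL (a ⊕ a) E × GL (b ⊕ b) E}
    (hsurj : Function.Surjective (stabIncl F x))
    (hcomm : ∀ p q, p ∈ stabG F (levi x) → q ∈ stabG F (levi x) → p * q = q * p)
    (dt : Measure (stabL F x)) [dt.IsMulLeftInvariant] :
    (dt.map (stabIncl F x)).IsMulRightInvariant := by
  have := subgroup_measurableMul (stabL F x)
  have := subgroup_measurableMul (stabG F (levi x))
  have hm := measurable_stabIncl (F := F) x
  refine ⟨fun s => ?_⟩
  obtain ⟨r, rfl⟩ := hsurj s
  rw [Measure.map_map (measurable_mul_const _) hm]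
  -- Commutativity of the larger stabilizer turns right translation into left translation upstream,
  -- under which `dt` is invariant.
  have h1 : (fun y => y * stabIncl F x r) ∘ stabIncl F x = stabIncl F x ∘ fun y => r * y := by
    funext y
    refine Subtype.ext ?_
    rw [Function.comp_apply, Function.comp_apply, map_mul]
    exact hcomm _ _ (stabIncl F x y).2 (stabIncl F x r).2
  rw [h1, ← Measure.map_map hm (measurable_const_mul r), map_mul_left_eq_self]

theorem map_map_of_involutive {m n : Type*} (hinv : ∀ z, σ (σ z) = z) (M : Matrix m n E) :
    (M.map σ).map σ = M := by
  ext i j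
  exact hinv _

/-- Conjugating the equation of a kernel element `Y` gives `Y α₂ = α₁ Ȳ`, which says that `Y` is an
off-diagonal intertwiner. -/
theorem det_twistedSylvester_ne_zero (hinv : ∀ z, σ (σ z) = z) {α₁ : Matrix a a E}
    {α₂ : Matrix b b E} [FiniteDimensional F E]
    (h : ∀ Y : Matrix a b E, Y * α₂ = α₁ * Y.map σ → Y = 0) :
    LinearMap.det (twistedSylvester σ (-α₁.map σ) (α₂.map σ) :
      Matrix a b E →ₗ[F] Matrix a b E) ≠ 0 := by
  refine fun h0 => (LinearMap.bot_lt_ker_of_det_eq_zero h0).ne' (LinearMap.ker_eq_bot'.2 ?_)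
  intro Y hY
  refine h Y ?_
  have h1 : Y.map σ * α₂.map σ + -α₁.map σ * Y = 0 := hY
  rw [Matrix.neg_mul, ← sub_eq_add_neg, sub_eq_zero] at h1
  have h2 := congrArg (fun M : Matrix a b E => M.map (σ : E →+* E)) h1
  simp only [Matrix.map_mul] at h2
  change (Y.map σ).map σ * (α₂.map σ).map σ = (α₁.map σ).map σ * Y.map σ at h2
  rwa [map_map_of_involutive hinv, map_map_of_involutive hinv, map_map_of_involutive hinv] at h2

theorem map_norm_eq {ι : Type*} [Fintype ι] (hinv : ∀ z, σ (σ z) = z) {α : Matrix ι ι E}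
    (h : α * α.map σ = α.map σ * α) : (α * α.map σ).map σ = α * α.map σ := by
  have h2 : (α * α.map σ).map σ = α.map σ * (α.map σ).map σ := Matrix.map_mul (f := (σ : E →+* E))
  rw [h2, map_map_of_involutive hinv, h]

/-- Regularity of `x` provides the algebraic input: no nilpotent intertwiners, an invertible `α`,
equal and commutative stabilizers. The analytic input is convergence on the larger group. Descent of
the quotient integral and the unipotent Jacobian then give both the convergence for `L` and the
identity. -/
theorem orbital_descent [CharZero F] (hdeg : Module.finrank F E = 2) (hσ : σ ≠ AlgEquiv.refl)
    (hχ : Continuous χ) (hηt : Continuous ηt)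
    (hη : ∀ c : Fˣ, (ηt (Units.map (algebraMap F E : F →* E) c) : ℂ) = etaChar F E c)
    {bE : Module.Basis (Fin 2) F E} (hbE : IsIntegralBasis bE)
    {x : GL (a ⊕ a) E × GL (b ⊕ b) E} {α₁ : Matrix a a E} {α₂ : Matrix b b E}
    (hα₁ : (toSymm σ x.1).val = sPrime σ α₁) (hα₂ : (toSymm σ x.2).val = sPrime σ α₂)
    (hx : IsRegularSemisimple σ (toSymm σ (levi x)))
    {f : GL ((a ⊕ b) ⊕ (a ⊕ b)) E → ℂ} (hf : IsSchwartz f)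
    (dt : Measure (stabL F x)) [dt.IsHaarMeasure]
    {ρG : Measure (Quotient (QuotientGroup.rightRel (stabG F (levi x))))}
    (hρG : IsQuotientMeasure (haarG F E (a ⊕ b)) (stabG F (levi x)) (dt.map (stabIncl F x)) ρG)
    {ρL : Measure (Quotient (QuotientGroup.rightRel (stabL F x)))}
    (hρL : IsQuotientMeasure (haarL F E a b) (stabL F x) dt ρL)
    {fQ : GL (a ⊕ a) E × GL (b ⊕ b) E → ℂ}
    (hfQ : fQ = descent F σ χ (ENNReal.ofReal
      (normAbs F (Algebra.discr F bE) ^ (Fintype.card a * Fintype.card b))) f) :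
    Integrable (fun q => integrandG F σ χ (levi x) f q.out) ρG ∧
    Integrable (fun q => integrandL F σ χ x fQ q.out) ρL ∧
    ∃ l : F, algebraMap F (AlgebraicClosure E) l =
        lambdaPrime (α₁ * α₁.map σ) (α₂ * α₂.map σ) ∧
      orbitalG F σ χ ηt (levi x) ρG f =
        (normAbs F l : ℂ) * orbitalL F σ χ ηt x ρL fQ := by
  subst hfQ
  have hfd : FiniteDimensional F E := Module.finite_of_finrank_eq_succ hdeg
  have hinv := involutive_of_finrank_eq_two σ hdeg
  obtain ⟨z, hz, hz0, hspan⟩ := exists_imaginary σ hdeg hσ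
  have hs : (toSymm σ (levi x)).val = sPrime σ (Matrix.fromBlocks α₁ 0 0 α₂) := by
    rw [toSymm_levi]
    exact levi_val_sPrime σ hα₁ hα₂
  have hα := comm_of_symm σ hinv hs hx.1
  have hu := isUnit_of_stabIsTorus σ hinv hz hz0 hspan hs hα hx.2.2
  have hnil : ∀ X : Matrix (a ⊕ b) (a ⊕ b) E, X * X = 0 →
      X * Matrix.fromBlocks α₁ 0 0 α₂ = Matrix.fromBlocks α₁ 0 0 α₂ * X.map σ → X = 0 :=
    fun X => eq_zero_of_sq_zero_of_intertwines σ hinv hs hα hx.2.2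
  have hcomm : α₁ * α₁.map σ = α₁.map σ * α₁ ∧ α₂ * α₂.map σ = α₂.map σ * α₂ := by
    rw [Matrix.fromBlocks_map, Matrix.map_zero _ (map_zero _), Matrix.map_zero _ (map_zero _),
      Matrix.fromBlocks_multiply, Matrix.fromBlocks_multiply, Matrix.fromBlocks_inj] at hα
    simpa using And.intro hα.1 hα.2.2.2
  have hu₂ : IsUnit α₂ := by
    rw [Matrix.isUnit_iff_isUnit_det, Matrix.det_fromBlocks_zero₂₁] at hu
    exact (Matrix.isUnit_iff_isUnit_det _).2 (isUnit_of_mul_isUnit_right hu)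
  obtain ⟨γ₁, hγ₁⟩ := exists_map_algebraMap_of_fixed σ hz hz0 hspan (map_norm_eq hinv hcomm.1)
  obtain ⟨γ₂, hγ₂⟩ := exists_map_algebraMap_of_fixed σ hz hz0 hspan (map_norm_eq hinv hcomm.2)
  have hdet := det_twistedSylvester_ne_zero (F := F) hinv
    (blocks_eq_zero_of_intertwines σ hnil).1
  -- Only the squares of `det T` and of the resultant are known to agree, so the comparison is made
  -- in absolute value.
  have habs := normAbs_eq_of_sq_eq
    (det_twistedSylvester_sq σ hinv hdeg hz hz0 hcomm.1 hcomm.2 hu₂ hγ₁ hγ₂)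
  have hcont : Continuous f := hf.1.continuous
  have hleft := isLeftInvariant_integrandG (χ := χ) hdeg hσ hη hs hα hu f
  have hright := isMulRightInvariant_map_stabIncl
    (stabIncl_surjective σ hinv hz hz0 hspan hs hα hnil) (stabG_mul_comm σ hx.2.2) dt
  have := subgroup_measurableMul (stabG F (levi x))
  have hint := integrable_integrandG hdeg hσ hχ hηt hη hx.2.1 hcont hf.2 hleft hρG
  obtain ⟨θ, hθ⟩ := exists_weight hρG (isOpen_compactG F E (a ⊕ b))
    (fun r => by rw [haarG_coset]; exact one_ne_zero)
    (fun r => by rw [haarG_coset]; exact ENNReal.one_ne_top)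
  have := haarL_sFinite F E a b
  have := haarU_sFinite F E a b
  have := haarG_sFinite F E (a ⊕ b)
  obtain ⟨h1, h2⟩ := integral_quotient_descent (j := inclG F E a b)
    (υ := fun q : UnipG F E a b × ((GL (a ⊕ b) E × GL (a ⊕ b) E) × GL ((a ⊕ b) ⊕ (a ⊕ b)) F) =>
      unipG q.1 * q.2) continuous_inclG.measurable
    ((continuous_unipG.measurable.comp measurable_fst).mul measurable_snd) (haarG_eq_map F E a b)
    (measurable_stabIncl x) (fun _ => rfl) hρG hρL hθ
    (continuous_integrandG hχ hηt (continuous_map_algEquiv hdeg σ) hη (levi x) hcont).measurable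
    hleft hint
  simp only [integral_unip_eq hdeg hσ hbE hα₁ hα₂ hdet hχ hηt hη hcont hf.2] at h1 h2
  have hne : ((normAbs F (LinearMap.det (twistedSylvester σ (-α₁.map σ) (α₂.map σ) :
      Matrix a b E →ₗ[F] Matrix a b E)))⁻¹ : ℂ) ≠ 0 :=
    inv_ne_zero (Complex.ofReal_ne_zero.2 (normAbs_pos hdet).ne')
  -- Integrability on the Levi side comes from `h1` after removing the nonzero constant `|det T|⁻¹`.
  -- The witness for `λ'` is the inverse resultant of the matrices over `F` that represent `α₁ᾱ₁`
  -- and `α₂ᾱ₂`.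
  refine ⟨hint, (integrable_const_mul_iff hne.isUnit _).1 h1, (sylvesterDet γ₁ γ₂)⁻¹, ?_, ?_⟩
  · rw [lambdaPrime_eq, ← hγ₁, ← hγ₂, sylvesterDet_map, ← map_inv₀,
      ← IsScalarTower.algebraMap_apply]
  · rw [orbitalG, orbitalL, h2, integral_const_mul, normAbs_inv, ← habs]
    push_cast
    ring

end Descent

end

end ParabolicDescent

theorem mainTheorem8
    {F E : Type*} [NontriviallyNormedField F] [IsUltrametricDist F] [LocallyCompactSpace F]
    [CharZero F] [NontriviallyNormedField E] [LocallyCompactSpace E] [NormedAlgebra F E]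
    (hdeg : Module.finrank F E = 2) (σ : E ≃ₐ[F] E) (hσ : σ ≠ AlgEquiv.refl)
    (χ ηt : Eˣ →* ℂˣ) (hχ : Continuous χ) (hηt : Continuous ηt)
    (hη : ∀ c : Fˣ, (ηt (Units.map (algebraMap F E : F →* E) c) : ℂ) =
      ParabolicDescent.etaChar F E c)
    (bE : Module.Basis (Fin 2) F E) (hbE : ParabolicDescent.IsIntegralBasis bE)
    (n₁ n₂ : ℕ)
    (x : GL (Fin n₁ ⊕ Fin n₁) E × GL (Fin n₂ ⊕ Fin n₂) E)
    (α₁ : Matrix (Fin n₁) (Fin n₁) E) (α₂ : Matrix (Fin n₂) (Fin n₂) E)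
    (hα₁ : (ParabolicDescent.toSymm σ x.1).val = ParabolicDescent.sPrime σ α₁)
    (hα₂ : (ParabolicDescent.toSymm σ x.2).val = ParabolicDescent.sPrime σ α₂)
    (hx₁ : ParabolicDescent.IsRegularSemisimple σ (ParabolicDescent.toSymm σ x.1))
    (hx₂ : ParabolicDescent.IsRegularSemisimple σ (ParabolicDescent.toSymm σ x.2))
    (hx : ParabolicDescent.IsRegularSemisimple σ
      (ParabolicDescent.toSymm σ (ParabolicDescent.levi x)))
    (f : GL ((Fin n₁ ⊕ Fin n₂) ⊕ (Fin n₁ ⊕ Fin n₂)) E → ℂ)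
    (hf : ParabolicDescent.IsSchwartz f)
    (dt : MeasureTheory.Measure (ParabolicDescent.stabL F x)) [dt.IsHaarMeasure]
    (ρG : MeasureTheory.Measure (Quotient (QuotientGroup.rightRel
      (ParabolicDescent.stabG F (ParabolicDescent.levi x)))))
    (hρG : ParabolicDescent.IsQuotientMeasure
      (ParabolicDescent.haarG F E (Fin n₁ ⊕ Fin n₂))
      (ParabolicDescent.stabG F (ParabolicDescent.levi x))
      (dt.map (ParabolicDescent.stabIncl F x)) ρG)
    (ρL : MeasureTheory.Measure (Quotient (QuotientGroup.rightRel
      (ParabolicDescent.stabL F x))))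
    (hρL : ParabolicDescent.IsQuotientMeasure
      (ParabolicDescent.haarL F E (Fin n₁) (Fin n₂)) (ParabolicDescent.stabL F x) dt ρL)
    (fQ : GL (Fin n₁ ⊕ Fin n₁) E × GL (Fin n₂ ⊕ Fin n₂) E → ℂ)
    (hfQ : fQ = ParabolicDescent.descent F σ χ
      (ENNReal.ofReal
        (ParabolicDescent.normAbs F (Algebra.discr F bE) ^ (n₁ * n₂))) f) :
    ParabolicDescent.IsSchwartz fQ ∧
    MeasureTheory.Integrable (fun q => ParabolicDescent.integrandG F σ χ
      (ParabolicDescent.levi x) f q.out) ρG ∧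
    MeasureTheory.Integrable (fun q => ParabolicDescent.integrandL F σ χ x fQ q.out) ρL ∧
    ∃ l : F, algebraMap F (AlgebraicClosure E) l =
        ParabolicDescent.lambdaPrime (α₁ * α₁.map σ) (α₂ * α₂.map σ) ∧
      ParabolicDescent.orbitalG F σ χ ηt (ParabolicDescent.levi x) ρG f =
        (ParabolicDescent.normAbs F l : ℂ) *
          ParabolicDescent.orbitalL F σ χ ηt x ρL fQ := by
  have := ParabolicDescent.isUltrametricDist_extension F E
  refine ⟨?_, ParabolicDescent.orbital_descent hdeg hσ hχ hηt hη hbE hα₁ hα₂ hx hf dt hρG hρL ?_⟩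
  · rw [hfQ]
    exact ⟨ParabolicDescent.isLocallyConstant_descent _ hf.1 hf.2,
      ParabolicDescent.hasCompactSupport_descent _ hf.2⟩
  · simpa using hfQ
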